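/- **Theorem (inversion of the non-symmetric Askey–Wilson transform; diagonal terms).** *Parameters.* Let $q\in\mathbb C$ with $0<|q|<1$, fix a square root $q^{1/2}$, and let $\underline t=(k_0,k_1,u_0,u_1)$ be nonzero complex numbers with $k_0^2,k_1^2,u_1^2\notin\pm q^{\mathbb Z}$. Put $a=k_1u_1$, $b=-k_1u_1^{-1}$, $c=q^{1/2}k_0u_0$, $d=-q^{1/2}k_0u_0^{-1}$, and let $\underline{\tilde t}=(u_1,k_1,u_0,k_0)$ be the dual parameters ($k_0$ and $u_1$ interchanged). Assume that $ef\notin q^{\mathbb Z}$ for all $e,f\in\{a,b,c,d\}$ ($e=f$ allowed), and the same for the numbers $\tilde a,\tilde b,\tilde c,\tilde d$ built from $(\underline{\tilde t},q)$. A prime denotes objects for the inverse parameters $(\underline t^{-1},q^{-1})$, with square root $q^{-1/2}$. *Polynomials.* On $\mathcal A=\mathbb C[x^{\pm1}]$ let $(s_0f)(x)=f(qx^{-1})$, $(s_1f)(x)=f(x^{-1})$, and for $i=0,1$ $$T_i=k_i+k_i^{-1}\frac{(1-k_iu_iy_i)(1+k_iu_i^{-1}y_i)}{1-y_i^2}(s_i-\mathrm{id}),\qquad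 y_0=q^{1/2}x^{-1},\quad y_1=x,$$ and let $Y=T_1T_0$. Let $\epsilon(m)=1$ for $m\ge0$ and $\epsilon(m)=-1$ for $m<0$, and put $\gamma_m=(k_0k_1)^{\epsilon(m)}q^m$. These numbers are pairwise distinct. Let $P_m$ ($m\in\mathbb Z$) be the unique Laurent polynomial of the form $x^m+$ lower order terms with respect to $1\prec x^{-1}\prec x\prec x^{-2}\prec x^2\prec\cdots$ such that $YP_m=\gamma_mP_m$. Put $E_{\gamma_m}=P_m/P_m(k_1^{-1}u_1^{-1})$. Let $\sigma=\{\gamma_m\}_{m\in\mathbb Z}$ and $\sigma'=\{\gamma_m^{-1}\}_{m\in\mathbb Z}$; thus $E'_\gamma$ is defined for $\gamma\in\sigma'$. *Bilinear form.* Let $$\Delta(x;\underline t;q)=\frac{(x^2,\,qx^{-2};q)_\infty}{(ax,bx,cx,dx,\,qax^{-1},qbx^{-1},cx^{-1},dx^{-1};q)_\infty},\qquad \langle f,g\rangle=\frac1{2\pi i}\int_C f(x)g(x^{-1})\Delta(x;\underline t;q)\frac{dx}{x},$$ where $C$ is any counterclockwise rectifiable Jordan curve having $0$ and the points $aq^k,bq^k,cq^k,dq^k$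 ($k\ge0$) in its interior and the points $a^{-1}q^{-k},b^{-1}q^{-k},c^{-1}q^{-k},d^{-1}q^{-k}$ ($k\ge0$) in its exterior. *Transforms.* For $\gamma=\gamma_m^{-1}\in\sigma'$ let $$w(\gamma)=\epsilon(m)\operatorname*{Res}_{y=\gamma}\frac{\Delta(y;\underline{\tilde t};q)}{y}.$$ Let $F$ be the space of finitely supported functions $g:\sigma'\to\mathbb C$. For $f\in\mathcal A$ and $g\in F$ put $$(\mathcal Ff)(\gamma)=\langle f,E'_\gamma\rangle\quad(\gamma\in\sigma'),\qquad \mathcal G(g)=\sum_{\gamma\in\sigma'}g(\gamma)\,w(\gamma)\,E_{\gamma^{-1}}\in\mathcal A .$$ *Claim.* (i) $\mathcal F$ maps $\mathcal A$ into $F$, and with $c_{\underline t,q}=w(\gamma_0^{-1})\,\langle1,1\rangle$ we have $\mathcal G\circ\mathcal F=c_{\underline t,q}\,\mathrm{Id}_{\mathcal A}$ and $\mathcal F\circ\mathcal G=c_{\underline t,q}\,\mathrm{Id}_F$. (ii) $\langle1,1\rangle\ne0$, and for every $\gamma\in\sigma$ we have $w(\gamma^{-1})\neq0$ and $$\frac{\langle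 E_\gamma,E'_{\gamma^{-1}}\rangle}{\langle1,1\rangle}=\frac{w(\gamma_0^{-1})}{w(\gamma^{-1})}.$$ -/

import Mathlib

open scoped LaurentPolynomial

noncomputable section

namespace AskeyWilson

/-! ### Laurent polynomials -/

/-- The algebra `𝒜 = ℂ[x, x⁻¹]`; the monomial `x ^ m` is `LaurentPolynomial.T m`. -/
abbrev Laurent : Type := ℂ[T;T⁻¹]

/-- The value `f(x)` of a Laurent polynomial at a (nonzero) complex number. -/
def ev (f : Laurent) (x : ℂ) : ℂ := f.coeff.sum fun m c => c * x ^ m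

/-- The linear endomorphism of `𝒜` with prescribed values `x ^ m ↦ v m` on monomials. -/
def linExt (v : ℤ → Laurent) : Laurent →ₗ[ℂ] Laurent where
  toFun f := f.coeff.sum fun m c => c • v m
  map_add' f g := by
    rw [AddMonoidAlgebra.coeff_add]
    exact Finsupp.sum_add_index' (by simp) (by intros; rw [add_smul])
  map_smul' r f := by
    rw [AddMonoidAlgebra.coeff_smul, Finsupp.sum_smul_index' (by simp), Finsupp.smul_sum]
    simp [mul_smul]

/-! ### Parameters -/

/-- The parameters: a multiplicity function `(k₀, k₁, u₀, u₁)` together with the chosen square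
root `r = q^{1/2}` of the deformation parameter `q`. -/
structure Params where
  k₀ : ℂ
  k₁ : ℂ
  u₀ : ℂ
  u₁ : ℂ
  r : ℂ

namespace Params

variable (t : Params)

/-- The deformation parameter. -/
def q : ℂ := t.r ^ 2

/-- The inverse parameters `(t⁻¹, q⁻¹)`. -/
def inv : Params := ⟨t.k₀⁻¹, t.k₁⁻¹, t.u₀⁻¹, t.u₁⁻¹, t.r⁻¹⟩

/-- The dual parameters `(t̃, q)`: `k₀` and `u₁` are interchanged. -/
def dual : Params := ⟨t.u₁, t.k₁, t.u₀, t.k₀, t.r⟩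

def a : ℂ := t.k₁ * t.u₁
def b : ℂ := -(t.k₁ * t.u₁⁻¹)
def c : ℂ := t.r * t.k₀ * t.u₀
def d : ℂ := -(t.r * t.k₀ * t.u₀⁻¹)

/-- The four Askey-Wilson parameters as a set. -/
def abcd : Set ℂ := {t.a, t.b, t.c, t.d}

/-- No product of two (possibly equal) Askey-Wilson parameters is an integral power of `q`. -/
def ProductsGeneric : Prop :=
  ∀ e ∈ t.abcd, ∀ f ∈ t.abcd, ∀ n : ℤ, e * f ≠ t.q ^ n

/-- The standing assumptions on the parameters. -/
structure Admissible : Prop where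
  k₀_ne : t.k₀ ≠ 0
  k₁_ne : t.k₁ ≠ 0
  u₀_ne : t.u₀ ≠ 0
  u₁_ne : t.u₁ ≠ 0
  q_pos : 0 < ‖t.q‖
  q_lt : ‖t.q‖ < 1
  k₀_sq : ∀ n : ℤ, t.k₀ ^ 2 ≠ t.q ^ n ∧ t.k₀ ^ 2 ≠ -t.q ^ n
  k₁_sq : ∀ n : ℤ, t.k₁ ^ 2 ≠ t.q ^ n ∧ t.k₁ ^ 2 ≠ -t.q ^ n
  u₁_sq : ∀ n : ℤ, t.u₁ ^ 2 ≠ t.q ^ n ∧ t.u₁ ^ 2 ≠ -t.q ^ n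
  products : t.ProductsGeneric
  products_dual : t.dual.ProductsGeneric

end Params

/-! ### Difference-reflection operators

The two simple (co)roots enter through the monomial `x^{a_i^∨} = s x^η`, which is `q^{1/2} x⁻¹`
for `i = 0` and `x` for `i = 1`; moreover `x^{a_i} = (x^{a_i^∨})²`. -/

/-- The monomial `s x^η`. -/
def rootMonomial (s : ℂ) (η : ℤ) : Laurent := LaurentPolynomial.C s * LaurentPolynomial.T η

/-- The reflection `x^m ↦ s^{-2ηm} x^{-m}`. For `(s, η) = (q^{1/2}, -1)` this is
`s₀ : x^m ↦ q^m x^{-m}`, and for `(s, η) = (1, 1)` it is `s₁ : x^m ↦ x^{-m}`. -/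
def reflection (s : ℂ) (η : ℤ) : Laurent →ₗ[ℂ] Laurent :=
  linExt fun m => LaurentPolynomial.C (s ^ (-2 * η * m)) * LaurentPolynomial.T (-m)

/-- The quotient `(1 - y^n) / (1 - y)` for the monomial `y = e x^k` and `n : ℤ`, i.e.
`1 + y + ⋯ + y^{n-1}` if `n ≥ 0` and `-(y⁻¹ + ⋯ + y^n)` if `n < 0`. -/
def geomQuot (e : ℂ) (k n : ℤ) : Laurent :=
  if 0 ≤ n then
    ∑ j ∈ Finset.range n.toNat,
      LaurentPolynomial.C (e ^ (j : ℤ)) * LaurentPolynomial.T (k * j)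
  else
    -∑ j ∈ Finset.range (-n).toNat,
      LaurentPolynomial.C (e ^ (-((j : ℤ) + 1))) * LaurentPolynomial.T (k * (-((j : ℤ) + 1)))

/-- The divided difference `f ↦ (f - s_i f) / (1 - x^{a_i})`; see `dividedDiff_spec`. -/
def dividedDiff (s : ℂ) (η : ℤ) : Laurent →ₗ[ℂ] Laurent :=
  linExt fun m => LaurentPolynomial.T m * geomQuot (s ^ 2) (2 * η) (-η * m)

/-- The difference-reflection operator
`k + k⁻¹ (1 - k u x^{a^∨}) (1 + k u⁻¹ x^{a^∨}) / (1 - x^a) (s_a - id)`. -/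
def heckeOp (k u s : ℂ) (η : ℤ) : Laurent →ₗ[ℂ] Laurent :=
  k • LinearMap.id - k⁻¹ • (LinearMap.mulLeft ℂ
    ((1 - (k * u) • rootMonomial s η) * (1 + (k * u⁻¹) • rootMonomial s η)) ∘ₗ dividedDiff s η)

theorem linExt_C_mul_T (v : ℤ → Laurent) (r : ℂ) (m : ℤ) :
    linExt v (LaurentPolynomial.C r * LaurentPolynomial.T m) = r • v m := by
  rw [← LaurentPolynomial.single_eq_C_mul_T]
  change Finsupp.sum (AddMonoidAlgebra.coeff (AddMonoidAlgebra.single m r)) (fun m c => c • v m) = _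
  rw [AddMonoidAlgebra.coeff_single, Finsupp.sum_single_index (by simp)]

theorem geomQuot_spec (e : ℂ) (he : e ≠ 0) (k n : ℤ) :
    (1 - LaurentPolynomial.C e * LaurentPolynomial.T k) * geomQuot e k n =
      1 - LaurentPolynomial.C (e ^ n) * LaurentPolynomial.T (k * n) := by
  set Z : ℤ → Laurent := fun j => LaurentPolynomial.C (e ^ j) * LaurentPolynomial.T (k * j)
    with hZ
  have hmul : ∀ i j, Z i * Z j = Z (i + j) := by
    intro i j
    simp only [hZ, zpow_add₀ he, mul_add, LaurentPolynomial.T_add, map_mul]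
    ring
  have hone : LaurentPolynomial.C e * LaurentPolynomial.T k = Z 1 := by simp [hZ]
  have hzero : Z 0 = 1 := by simp [hZ]
  change (1 - LaurentPolynomial.C e * LaurentPolynomial.T k) * geomQuot e k n = 1 - Z n
  rw [hone]
  have pos : ∀ N : ℕ, (1 - Z 1) * ∑ j ∈ Finset.range N, Z j = 1 - Z N := by
    intro N
    induction N with
    | zero => simp [hzero]
    | succ N ih =>
      rw [Finset.sum_range_succ, mul_add, ih, sub_mul, hmul, one_mul]
      push_cast
      rw [add_comm (1 : ℤ)]
      ring
  have neg : ∀ N : ℕ, (1 - Z 1) * -∑ j ∈ Finset.range N, Z (-((j : ℤ) + 1)) = 1 - Z (-N) := by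
    intro N
    induction N with
    | zero => simp [hzero]
    | succ N ih =>
      rw [Finset.sum_range_succ, neg_add, mul_add, ih, mul_neg, sub_mul, hmul, one_mul]
      push_cast
      rw [show (1 : ℤ) + -((N : ℤ) + 1) = -N by ring]
      ring
  unfold geomQuot
  split_ifs with h
  · have := pos n.toNat
    rwa [Int.toNat_of_nonneg h] at this
  · have := neg (-n).toNat
    rwa [Int.toNat_of_nonneg (by omega), neg_neg] at this

/-- `dividedDiff` is the quotient of `f - s_i f` by `1 - x^{a_i}`. -/
theorem dividedDiff_spec (s : ℂ) (hs : s ≠ 0) (η : ℤ) (hη : η = 1 ∨ η = -1) (f : Laurent) :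
    (1 - rootMonomial s η ^ 2) * dividedDiff s η f = f - reflection s η f := by
  induction f using LaurentPolynomial.induction_on' with
  | add f g hf hg => rw [map_add, mul_add, hf, hg, map_add]; abel
  | C_mul_T m r =>
    have h1 : rootMonomial s η ^ 2 =
        LaurentPolynomial.C (s ^ 2) * LaurentPolynomial.T (2 * η) := by
      rw [rootMonomial, mul_pow, LaurentPolynomial.T_pow, map_pow]; simp
    have h2 : (s ^ 2) ^ (-η * m) = s ^ (-2 * η * m) := by
      rw [← zpow_natCast, ← zpow_mul]; congr 1; push_cast; ring
    have h3 : m + 2 * η * (-η * m) = -m := by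
      rcases hη with h | h <;> subst h <;> ring
    rw [dividedDiff, reflection, linExt_C_mul_T, linExt_C_mul_T, mul_smul_comm, mul_left_comm, h1,
      geomQuot_spec _ (pow_ne_zero 2 hs), h2, mul_sub, mul_left_comm, ← LaurentPolynomial.T_add, h3,
      LaurentPolynomial.smul_eq_C_mul, LaurentPolynomial.smul_eq_C_mul]
    ring

/-! ### The Cherednik-Dunkl operator and the non-symmetric Askey-Wilson polynomials -/

namespace Params

variable (t : Params)

/-- `T₀`, for the root `a₀` with `x^{a₀^∨} = q^{1/2} x⁻¹`. -/
def T₀ : Laurent →ₗ[ℂ] Laurent := heckeOp t.k₀ t.u₀ t.r (-1)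

/-- `T₁`, for the root `a₁` with `x^{a₁^∨} = x`. -/
def T₁ : Laurent →ₗ[ℂ] Laurent := heckeOp t.k₁ t.u₁ 1 1

/-- The Cherednik-Dunkl operator `Y = T₁ T₀`. -/
def Y : Laurent →ₗ[ℂ] Laurent := t.T₁ ∘ₗ t.T₀

end Params

/-- The sign `ε(m)`, equal to `1` for `m ≥ 0` and to `-1` for `m < 0`. -/
def sgnInt (m : ℤ) : ℤ := if 0 ≤ m then 1 else -1

/-- The strict total order on exponents given by `1 ≺ x⁻¹ ≺ x ≺ x⁻² ≺ x² ≺ ⋯`. -/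
def Prec (n m : ℤ) : Prop := |n| < |m| ∨ (|n| = |m| ∧ n < m)

/-- `P = x^m +` terms of lower order. -/
def IsMonicOfDegree (P : Laurent) (m : ℤ) : Prop :=
  P.coeff m = 1 ∧ ∀ n, n ≠ m → P.coeff n ≠ 0 → Prec n m

namespace Params

variable (t : Params)

/-- `γ_m = k₀^{ε(m)} k₁^{ε(m)} q^m`. -/
def eig (m : ℤ) : ℂ := t.k₀ ^ sgnInt m * t.k₁ ^ sgnInt m * t.q ^ m

/-- The monic non-symmetric Askey-Wilson polynomial `P_m`: the (unique) Laurent polynomial of the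
form `x^m +` lower order terms with `Y P = γ_m P`. -/
def monicPoly (m : ℤ) : Laurent :=
  Classical.epsilon fun P => IsMonicOfDegree P m ∧ t.Y P = t.eig m • P

/-- The spectrum `{γ_m}` of `Y`. -/
def spec : Set ℂ := Set.range t.eig

/-- The index `m` of a spectral point `γ = γ_m`. -/
def index (γ : ℂ) : ℤ := Function.invFun t.eig γ

/-- The renormalized polynomial `E_γ`, `γ = γ_m`, normalized to be `1` at `x₀⁻¹ = k₁⁻¹ u₁⁻¹`. -/
def E (γ : ℂ) : Laurent :=
  (ev (t.monicPoly (t.index γ)) (t.k₁⁻¹ * t.u₁⁻¹))⁻¹ • t.monicPoly (t.index γ)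

end Params

/-! ### The weight function and the bilinear form -/

/-- `(a; q)_∞ = ∏_{k ≥ 0} (1 - a q^k)`. -/
def qPochInf (a q : ℂ) : ℂ := ∏' k : ℕ, (1 - a * q ^ k)

/-- The weight function `Δ(x) = α(x) Δ₊(x)`, where
`Δ₊(x) = (x², x⁻²; q)_∞ / (a x, a/x, b x, b/x, c x, c/x, d x, d/x; q)_∞` and
`α(x) = (1 - a/x) (1 - b/x) / (1 - x⁻²)`. The factors of `α` are cancelled here. -/
def Params.weight (t : Params) (x : ℂ) : ℂ :=
  qPochInf (x ^ 2) t.q * qPochInf (t.q * x⁻¹ ^ 2) t.q /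
    (qPochInf (t.a * x) t.q * qPochInf (t.b * x) t.q *
      qPochInf (t.c * x) t.q * qPochInf (t.d * x) t.q *
      qPochInf (t.q * t.a * x⁻¹) t.q * qPochInf (t.q * t.b * x⁻¹) t.q *
      qPochInf (t.c * x⁻¹) t.q * qPochInf (t.d * x⁻¹) t.q)

/-- `(1 / 2πi) ∫_Γ h(x) dx` along the curve `Γ : [0, 1] → ℂ`. -/
def curveInt (Γ : ℝ → ℂ) (h : ℂ → ℂ) : ℂ :=
  (2 * Real.pi * Complex.I)⁻¹ * ∫ s in (0 : ℝ)..1, h (Γ s) * deriv Γ s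

/-- A rectifiable Jordan curve, in a Lipschitz (for instance constant speed) parametrization. -/
structure IsRectifiableJordan (Γ : ℝ → ℂ) : Prop where
  lipschitz : ∃ K, LipschitzOnWith K Γ (Set.Icc 0 1)
  closed : Γ 0 = Γ 1
  simple : Set.InjOn Γ (Set.Ico 0 1)

/-- `w` is off the curve and has winding number one; for a counterclockwise Jordan curve, these
are the points of the interior. -/
def InInterior (Γ : ℝ → ℂ) (w : ℂ) : Prop :=
  w ∉ Γ '' Set.Icc 0 1 ∧ curveInt Γ (fun x => (x - w)⁻¹) = 1

/-- `w` is off the curve and has winding number zero; for a Jordan curve, these are the points of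
the exterior. -/
def InExterior (Γ : ℝ → ℂ) (w : ℂ) : Prop :=
  w ∉ Γ '' Set.Icc 0 1 ∧ curveInt Γ (fun x => (x - w)⁻¹) = 0

/-- The counterclockwise contours separating the points `e q^k` (and their limit `0`) from the
points `e⁻¹ q^{-k}`, for `e ∈ {a, b, c, d}` and `k ≥ 0`. -/
structure Params.IsContour (t : Params) (Γ : ℝ → ℂ) : Prop where
  jordan : IsRectifiableJordan Γ
  zero_mem : InInterior Γ 0
  interior : ∀ e ∈ t.abcd, ∀ k : ℕ, InInterior Γ (e * t.q ^ k)
  exterior : ∀ e ∈ t.abcd, ∀ k : ℕ, InExterior Γ (e * t.q ^ k)⁻¹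

/-- The bilinear form `⟨f, g⟩ = (1 / 2πi) ∫_Γ f(x) g(x⁻¹) Δ(x) dx / x`. -/
def Params.pairing (t : Params) (Γ : ℝ → ℂ) (f g : Laurent) : ℂ :=
  curveInt Γ fun x => ev f x * ev g x⁻¹ * t.weight x / x

/-! ### The transforms -/

/-- The residue at `z`, as the integral over a small circle around `z`. -/
def residue (h : ℂ → ℂ) (z : ℂ) : ℂ :=
  Filter.limUnder (nhdsWithin (0 : ℝ) (Set.Ioi 0)) fun R =>
    (2 * Real.pi * Complex.I)⁻¹ * ∮ x in C(z, R), h x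

namespace Params

variable (t : Params)

/-- `w(γ; t̃; q) = Res_{y = γ} (Δ(y; t̃; q) / y) sgn(γ)`, for `γ = γ_m⁻¹` in the spectrum for the
inverse parameters, with `sgn(γ_m⁻¹) = ε(m)`. -/
def dualWeight (γ : ℂ) : ℂ :=
  residue (fun y => t.dual.weight y / y) γ * (sgnInt (t.inv.index γ) : ℂ)

/-- The non-symmetric Askey-Wilson transform `(ℱ f)(γ) = ⟨f, E'_γ⟩`, where `E'_γ` is `E_γ` for the
inverse parameters and `γ` lies in the spectrum for the inverse parameters. -/
def transformF (Γ : ℝ → ℂ) (f : Laurent) (γ : t.inv.spec) : ℂ :=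
  t.pairing Γ f (t.inv.E γ)

/-- `𝒢(g) = ∑_γ g(γ) E_{γ⁻¹} w(γ)`, for finitely supported `g` on the spectrum for the inverse
parameters. -/
def transformG (g : t.inv.spec →₀ ℂ) : Laurent :=
  g.sum fun γ z => (z * t.dualWeight γ) • t.E (γ : ℂ)⁻¹

/-- The constant `c = w(γ₀⁻¹; t̃; q) ⟨1, 1⟩`. -/
def const (Γ : ℝ → ℂ) : ℂ := t.dualWeight (t.eig 0)⁻¹ * t.pairing Γ 1 1

end Params

end AskeyWilson

end

open scoped LaurentPolynomial

noncomputable section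

namespace AskeyWilson

/-! ### Evaluation of Laurent polynomials -/

theorem ev_add (f g : Laurent) (x : ℂ) : ev (f + g) x = ev f x + ev g x := by
  unfold ev
  rw [AddMonoidAlgebra.coeff_add]
  exact Finsupp.sum_add_index' (by simp) (by intros; rw [add_mul])

theorem ev_C_mul_T (r : ℂ) (m : ℤ) (x : ℂ) :
    ev (LaurentPolynomial.C r * LaurentPolynomial.T m) x = r * x ^ m := by
  rw [← LaurentPolynomial.single_eq_C_mul_T]
  change Finsupp.sum (AddMonoidAlgebra.coeff (AddMonoidAlgebra.single m r)) _ = _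
  rw [AddMonoidAlgebra.coeff_single, Finsupp.sum_single_index (by simp)]

theorem ev_eq_eval₂ (f : Laurent) {x : ℂ} (hx : x ≠ 0) :
    ev f x = LaurentPolynomial.eval₂ (RingHom.id ℂ) (Units.mk0 x hx) f := by
  induction f using LaurentPolynomial.induction_on' with
  | add f g hf hg => rw [ev_add, hf, hg, map_add]
  | C_mul_T m r => rw [ev_C_mul_T, LaurentPolynomial.eval₂_C_mul_T]; simp

theorem ev_C (r x : ℂ) : ev (LaurentPolynomial.C r) x = r := by
  simpa using ev_C_mul_T r 0 x

theorem ev_T (m : ℤ) (x : ℂ) : ev (LaurentPolynomial.T m) x = x ^ m := by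
  simpa using ev_C_mul_T 1 m x

theorem ev_one (x : ℂ) : ev 1 x = 1 := by
  simpa using ev_C 1 x

theorem ev_zero (x : ℂ) : ev 0 x = 0 := by
  simpa using ev_C 0 x

theorem ev_mul (f g : Laurent) {x : ℂ} (hx : x ≠ 0) : ev (f * g) x = ev f x * ev g x := by
  simp only [ev_eq_eval₂ _ hx, map_mul]

theorem ev_smul (r : ℂ) (f : Laurent) (x : ℂ) : ev (r • f) x = r * ev f x := by
  induction f using LaurentPolynomial.induction_on' with
  | add f g hf hg => rw [smul_add, ev_add, ev_add, hf, hg, mul_add]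
  | C_mul_T m s =>
    rw [LaurentPolynomial.smul_eq_C_mul, ← mul_assoc, ← map_mul, ev_C_mul_T, ev_C_mul_T, mul_assoc]

theorem ev_neg (f : Laurent) (x : ℂ) : ev (-f) x = -ev f x := by
  rw [← neg_one_smul ℂ f, ev_smul, neg_one_mul]

theorem ev_sub (f g : Laurent) (x : ℂ) : ev (f - g) x = ev f x - ev g x := by
  rw [sub_eq_add_neg, ev_add, ev_neg, sub_eq_add_neg]

theorem ev_invert (f : Laurent) (x : ℂ) :
    ev (LaurentPolynomial.invert f) x = ev f x⁻¹ := by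
  induction f using LaurentPolynomial.induction_on' with
  | add f g hf hg => rw [map_add, ev_add, ev_add, hf, hg]
  | C_mul_T m s =>
    rw [map_mul, LaurentPolynomial.invert_C, LaurentPolynomial.invert_T, ev_C_mul_T, ev_C_mul_T,
      zpow_neg, inv_zpow]

theorem laurent_ext_of_finite {f g : Laurent} {S : Set ℂ} (hS : S.Finite)
    (h : ∀ x : ℂ, x ≠ 0 → x ∉ S → ev f x = ev g x) : f = g := by
  rw [← sub_eq_zero]
  obtain ⟨n, p, hp⟩ := LaurentPolynomial.exists_T_pow (f - g)
  have hp0 : p = 0 := by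
    apply Polynomial.eq_zero_of_infinite_isRoot
    refine Set.Infinite.mono ?_ ((hS.union (Set.finite_singleton (0 : ℂ))).infinite_compl)
    intro x hx
    simp only [Set.mem_compl_iff, Set.mem_union, Set.mem_singleton_iff, not_or] at hx
    have h2 := congrArg (fun F => ev F x) hp
    simp only [ev_mul _ _ hx.2, ev_sub, h x hx.2 hx.1, sub_self, zero_mul] at h2
    rw [ev_eq_eval₂ _ hx.2, LaurentPolynomial.eval₂_toLaurent] at h2
    simpa [Polynomial.IsRoot, Polynomial.eval₂_eq_eval_map] using h2
  rw [hp0, map_zero] at hp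
  exact (LaurentPolynomial.isUnit_T _).mul_left_eq_zero.mp hp.symm

theorem laurent_ext {f g : Laurent} (h : ∀ x : ℂ, x ≠ 0 → ev f x = ev g x) : f = g :=
  laurent_ext_of_finite Set.finite_empty fun x hx _ => h x hx

theorem laurent_ext_root {s : ℂ} (hs : s ≠ 0) {η : ℤ} (hη : η = 1 ∨ η = -1) {f g : Laurent}
    (h : ∀ x : ℂ, x ≠ 0 → (s * x ^ η) ^ 2 ≠ 1 → ev f x = ev g x) : f = g := by
  refine laurent_ext_of_finite (S := {s⁻¹, -s⁻¹, s, -s}) (by simp) fun x hx hxS => h x hx ?_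
  intro h1
  apply hxS
  simp only [Set.mem_insert_iff, Set.mem_singleton_iff]
  rcases (show _ = (1 : ℂ) ∨ _ = (-1 : ℂ) from sq_eq_sq_iff_eq_or_eq_neg.mp (h1.trans (one_pow 2).symm)) with h2 | h2
  · rcases hη with rfl | rfl
    · left; rw [zpow_one] at h2; exact eq_inv_of_mul_eq_one_right h2
    · right; right; left
      rw [zpow_neg_one] at h2; field_simp at h2; exact h2.symm
  · rcases hη with rfl | rfl
    · right; left
      rw [zpow_one] at h2; field_simp; linear_combination h2
    · right; right; right
      rw [zpow_neg_one] at h2; field_simp at h2; linear_combination h2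

/-! ### The difference-reflection operators -/

section HeckeOp

variable {k u s : ℂ} {η : ℤ}

theorem ev_rootMonomial (s : ℂ) (η : ℤ) (x : ℂ) : ev (rootMonomial s η) x = s * x ^ η :=
  ev_C_mul_T s η x

theorem ev_reflection (s : ℂ) (η : ℤ) (f : Laurent) (x : ℂ) :
    ev (reflection s η f) x = ev f (s ^ (-2 * η) * x⁻¹) := by
  induction f using LaurentPolynomial.induction_on' with
  | add f g hf hg => rw [map_add, ev_add, ev_add, hf, hg]
  | C_mul_T m r =>
    rw [reflection, linExt_C_mul_T, ev_smul, ev_C_mul_T, ev_C_mul_T, mul_zpow, zpow_mul, zpow_neg,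
      inv_zpow]

theorem ev_dividedDiff (hs : s ≠ 0) (hη : η = 1 ∨ η = -1) (f : Laurent) {x : ℂ} (hx : x ≠ 0) :
    (1 - (s * x ^ η) ^ 2) * ev (dividedDiff s η f) x =
      ev f x - ev f (s ^ (-2 * η) * x⁻¹) := by
  have := congrArg (fun F => ev F x) (dividedDiff_spec s hs η hη f)
  simpa only [ev_mul _ _ hx, ev_sub, ev_one, sq, ev_rootMonomial, ev_reflection] using this

theorem ev_heckeOp (hs : s ≠ 0) (hη : η = 1 ∨ η = -1) (f : Laurent) {x : ℂ} (hx : x ≠ 0)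
    (h1 : (s * x ^ η) ^ 2 ≠ 1) :
    ev (heckeOp k u s η f) x = k * ev f x - k⁻¹ * ((1 - k * u * (s * x ^ η)) *
      (1 + k * u⁻¹ * (s * x ^ η)) / (1 - (s * x ^ η) ^ 2)) *
        (ev f x - ev f (s ^ (-2 * η) * x⁻¹)) := by
  have h2 : 1 - (s * x ^ η) ^ 2 ≠ 0 := sub_ne_zero.mpr h1.symm
  rw [← ev_dividedDiff hs hη f hx]
  simp only [heckeOp, LinearMap.sub_apply, LinearMap.smul_apply, LinearMap.id_apply,
    LinearMap.comp_apply, LinearMap.mulLeft_apply, ev_sub, ev_smul, ev_mul _ _ hx, ev_add, ev_one,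
    ev_rootMonomial]
  rw [mul_assoc k⁻¹, div_mul_eq_mul_div, mul_div_assoc, mul_div_cancel_left₀ _ h2]

/-- The inverse of `heckeOp`; see `heckeOp_heckeInv`. -/
def heckeInv (k u s : ℂ) (η : ℤ) : Laurent →ₗ[ℂ] Laurent :=
  heckeOp k u s η - (k - k⁻¹) • LinearMap.id

theorem heckeInv_apply (f : Laurent) :
    heckeInv k u s η f = heckeOp k u s η f - (k - k⁻¹) • f := rfl

theorem reflect_root (hs : s ≠ 0) (hη : η = 1 ∨ η = -1) {x : ℂ} (hx : x ≠ 0) :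
    s * (s ^ (-2 * η) * x⁻¹) ^ η = (s * x ^ η)⁻¹ := by
  rcases hη with rfl | rfl
  · norm_num; field_simp
  · norm_num; field_simp

theorem reflect_reflect (hs : s ≠ 0) (x : ℂ) :
    s ^ (-2 * η) * (s ^ (-2 * η) * x⁻¹)⁻¹ = x := by
  have := zpow_ne_zero (-2 * η) hs
  rw [mul_inv, inv_inv, mul_inv_cancel_left₀ this]

theorem heckeOp_heckeOp (hk : k ≠ 0) (hu : u ≠ 0) (hs : s ≠ 0) (hη : η = 1 ∨ η = -1) (f : Laurent) :
    heckeOp k u s η (heckeOp k u s η f) = (k - k⁻¹) • heckeOp k u s η f + f := by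
  refine laurent_ext_root hs hη fun x hx h1 => ?_
  have hx' : s ^ (-2 * η) * x⁻¹ ≠ 0 := mul_ne_zero (zpow_ne_zero _ hs) (inv_ne_zero hx)
  have hy : s * x ^ η ≠ 0 := mul_ne_zero hs (zpow_ne_zero _ hx)
  have h1' : (s * (s ^ (-2 * η) * x⁻¹) ^ η) ^ 2 ≠ 1 := by
    rw [reflect_root hs hη hx, inv_pow]; exact inv_ne_one.mpr h1
  rw [ev_add, ev_smul, ev_heckeOp hs hη _ hx h1, ev_heckeOp hs hη _ hx h1,
    ev_heckeOp hs hη _ hx' h1', reflect_root hs hη hx, reflect_reflect hs]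
  generalize ev f (s ^ (-2 * η) * x⁻¹) = B
  generalize ev f x = A
  generalize s * x ^ η = y at *
  have h2 : 1 - y ^ 2 ≠ 0 := sub_ne_zero.mpr h1.symm
  have h3 : 1 - y⁻¹ ^ 2 = -(1 - y ^ 2) / y ^ 2 := by field_simp; ring
  rw [h3]
  field_simp
  ring

theorem heckeOp_heckeInv (hk : k ≠ 0) (hu : u ≠ 0) (hs : s ≠ 0) (hη : η = 1 ∨ η = -1)
    (f : Laurent) : heckeOp k u s η (heckeInv k u s η f) = f := by
  rw [heckeInv_apply, map_sub, map_smul, heckeOp_heckeOp hk hu hs hη]; abel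

theorem heckeInv_heckeOp (hk : k ≠ 0) (hu : u ≠ 0) (hs : s ≠ 0) (hη : η = 1 ∨ η = -1)
    (f : Laurent) : heckeInv k u s η (heckeOp k u s η f) = f := by
  rw [heckeInv_apply, heckeOp_heckeOp hk hu hs hη]; abel

theorem heckeOp_rootMonomial_mul (hk : k ≠ 0) (hu : u ≠ 0) (hs : s ≠ 0) (hη : η = 1 ∨ η = -1)
    (f : Laurent) :
    heckeOp k u s η (rootMonomial s η * f) =
      rootMonomial s⁻¹ (-η) * heckeInv k u s η f - (u - u⁻¹) • f := by
  refine laurent_ext_root hs hη fun x hx h1 => ?_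
  have hx' : s ^ (-2 * η) * x⁻¹ ≠ 0 := mul_ne_zero (zpow_ne_zero _ hs) (inv_ne_zero hx)
  have hy : s * x ^ η ≠ 0 := mul_ne_zero hs (zpow_ne_zero _ hx)
  rw [ev_heckeOp hs hη _ hx h1, heckeInv_apply, ev_sub, ev_mul _ _ hx, ev_mul _ _ hx, ev_sub,
    ev_mul _ _ hx', ev_heckeOp hs hη _ hx h1, ev_smul, ev_smul, ev_rootMonomial, ev_rootMonomial,
    ev_rootMonomial, reflect_root hs hη hx, zpow_neg, ← mul_inv]
  generalize ev f (s ^ (-2 * η) * x⁻¹) = B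
  generalize ev f x = A
  generalize s * x ^ η = y at *
  have h2 : 1 - y ^ 2 ≠ 0 := sub_ne_zero.mpr h1.symm
  field_simp
  ring

/-- Passing to the inverse parameters and conjugating by `x ↦ x⁻¹` inverts `heckeOp`. -/
theorem invert_heckeOp_inv (hk : k ≠ 0) (hu : u ≠ 0) (hs : s ≠ 0) (hη : η = 1 ∨ η = -1)
    (f : Laurent) :
    heckeOp k⁻¹ u⁻¹ s⁻¹ η (LaurentPolynomial.invert f) =
      LaurentPolynomial.invert (heckeInv k u s η f) := by
  refine laurent_ext_root (inv_ne_zero hs) hη fun x hx h1 => ?_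
  have hx' : x⁻¹ ≠ 0 := inv_ne_zero hx
  have hyy : s * x⁻¹ ^ η = (s⁻¹ * x ^ η)⁻¹ := by rw [mul_inv, inv_inv, inv_zpow]
  have hy : s⁻¹ * x ^ η ≠ 0 := mul_ne_zero (inv_ne_zero hs) (zpow_ne_zero _ hx)
  have h1' : (s * x⁻¹ ^ η) ^ 2 ≠ 1 := by
    rw [hyy, inv_pow]; exact inv_ne_one.mpr h1
  have hr : (s⁻¹ ^ (-2 * η) * x⁻¹)⁻¹ = s ^ (-2 * η) * x⁻¹⁻¹ := by
    rw [mul_inv, inv_zpow, inv_inv]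
  rw [ev_heckeOp (inv_ne_zero hs) hη _ hx h1, ev_invert, ev_invert, ev_invert, heckeInv_apply,
    ev_sub, ev_smul, ev_heckeOp hs hη _ hx' h1', hyy, hr]
  generalize ev f (s ^ (-2 * η) * x⁻¹⁻¹) = B
  generalize ev f x⁻¹ = A
  generalize s⁻¹ * x ^ η = y at *
  have h2 : 1 - y ^ 2 ≠ 0 := sub_ne_zero.mpr h1.symm
  have h3 : 1 - y⁻¹ ^ 2 = -(1 - y ^ 2) / y ^ 2 := by field_simp; ring
  rw [h3]
  field_simp
  ring

theorem heckeOp_symm (hs : s ≠ 0) (hη : η = 1 ∨ η = -1)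
    (f g : Laurent) :
    heckeOp k u s η f * g - f * heckeOp k u s η g =
      heckeOp k u s η (f * reflection s η g) - k • (f * reflection s η g) := by
  refine laurent_ext_root hs hη fun x hx h1 => ?_
  have hx' : s ^ (-2 * η) * x⁻¹ ≠ 0 := mul_ne_zero (zpow_ne_zero _ hs) (inv_ne_zero hx)
  simp only [ev_sub, ev_mul _ _ hx, ev_smul, ev_heckeOp hs hη _ hx h1, ev_mul _ _ hx',
    ev_reflection, reflect_reflect hs]
  ring

theorem ev_heckeOp_of_root (hs : s ≠ 0) (hη : η = 1 ∨ η = -1) (f : Laurent) {x : ℂ} (hx : x ≠ 0)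
    (h1 : (s * x ^ η) ^ 2 ≠ 1) (h2 : k * u * (s * x ^ η) = 1) :
    ev (heckeOp k u s η f) x = k * ev f x := by
  rw [ev_heckeOp hs hη f hx h1, h2]; simp

end HeckeOp

end AskeyWilson
end

open scoped LaurentPolynomial

noncomputable section

namespace AskeyWilson

/-! ### Generic parameters -/

namespace Params

/-- The algebraic part of the assumptions on the parameters, which is stable under inversion of the
parameters. -/
structure Generic (t : Params) : Prop where
  k₀_ne : t.k₀ ≠ 0
  k₁_ne : t.k₁ ≠ 0
  u₀_ne : t.u₀ ≠ 0
  u₁_ne : t.u₁ ≠ 0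
  r_ne : t.r ≠ 0
  q_zpow : ∀ n : ℤ, t.q ^ n = 1 → n = 0
  k₀_sq : ∀ n : ℤ, t.k₀ ^ 2 ≠ -t.q ^ n
  k₁_sq : ∀ n : ℤ, t.k₁ ^ 2 ≠ -t.q ^ n
  products : t.ProductsGeneric
  products_dual : t.dual.ProductsGeneric

theorem Admissible.generic {t : Params} (ht : t.Admissible) : t.Generic where
  k₀_ne := ht.k₀_ne
  k₁_ne := ht.k₁_ne
  u₀_ne := ht.u₀_ne
  u₁_ne := ht.u₁_ne
  r_ne := fun h => by have := ht.q_pos; simp [q, h] at this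
  q_zpow := fun n hn => by
    have h := congrArg norm hn
    rw [norm_zpow, norm_one] at h
    exact (zpow_eq_one_iff_right₀ ht.q_pos.le ht.q_lt.ne).mp h
  k₀_sq := fun n => (ht.k₀_sq n).2
  k₁_sq := fun n => (ht.k₁_sq n).2
  products := ht.products
  products_dual := ht.products_dual

variable {t : Params}

theorem abcd_inv (t : Params) {e : ℂ} (he : e ∈ t.inv.abcd) : e⁻¹ ∈ t.abcd := by
  simp only [abcd, Set.mem_insert_iff, Set.mem_singleton_iff, a, b, c, d, inv] at he ⊢
  rcases he with rfl | rfl | rfl | rfl <;> simp [mul_comm, mul_left_comm, inv_neg]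

theorem q_inv (t : Params) : t.inv.q = t.q⁻¹ := by simp [q, inv]

theorem ProductsGeneric.inv (h : t.ProductsGeneric) : t.inv.ProductsGeneric := by
  intro e he f hf n hn
  refine h _ (t.abcd_inv he) _ (t.abcd_inv hf) n ?_
  rw [← mul_inv, hn, q_inv, inv_zpow, inv_inv]

theorem dual_inv (t : Params) : t.inv.dual = t.dual.inv := rfl

theorem Generic.inv (ht : t.Generic) : t.inv.Generic where
  k₀_ne := inv_ne_zero ht.k₀_ne
  k₁_ne := inv_ne_zero ht.k₁_ne
  u₀_ne := inv_ne_zero ht.u₀_ne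
  u₁_ne := inv_ne_zero ht.u₁_ne
  r_ne := inv_ne_zero ht.r_ne
  q_zpow := fun n hn => by
    rw [q_inv, inv_zpow, inv_eq_one] at hn
    exact ht.q_zpow n hn
  k₀_sq := fun n hn => by
    refine ht.k₀_sq n ?_
    rw [q_inv] at hn
    simp only [Params.inv, inv_pow, inv_zpow] at hn
    rw [← inv_inj, hn, inv_neg]
  k₁_sq := fun n hn => by
    refine ht.k₁_sq n ?_
    rw [q_inv] at hn
    simp only [Params.inv, inv_pow, inv_zpow] at hn
    rw [← inv_inj, hn, inv_neg]
  products := ht.products.inv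
  products_dual := by rw [dual_inv]; exact ht.products_dual.inv

theorem Generic.q_ne (ht : t.Generic) : t.q ≠ 0 := pow_ne_zero 2 ht.r_ne

theorem a_mem (t : Params) : t.a ∈ t.abcd := by simp [abcd]
theorem b_mem (t : Params) : t.b ∈ t.abcd := by simp [abcd]
theorem c_mem (t : Params) : t.c ∈ t.abcd := by simp [abcd]
theorem d_mem (t : Params) : t.d ∈ t.abcd := by simp [abcd]

/-! ### The spectrum -/

theorem eig_of_nonneg (t : Params) {m : ℤ} (hm : 0 ≤ m) : t.eig m = t.k₀ * t.k₁ * t.q ^ m := by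
  simp [eig, sgnInt, hm]

theorem eig_of_neg (t : Params) {m : ℤ} (hm : m < 0) : t.eig m = (t.k₀ * t.k₁)⁻¹ * t.q ^ m := by
  simp [eig, sgnInt, not_le.mpr hm, mul_comm]

theorem eig_inv (t : Params) (m : ℤ) : t.inv.eig m = (t.eig m)⁻¹ := by
  simp only [eig, q_inv]
  simp [inv, mul_comm]

theorem Generic.k_sq (ht : t.Generic) (n : ℤ) : (t.k₀ * t.k₁) ^ 2 ≠ t.q ^ n := by
  have := ht.products_dual _ (a_mem _) _ (a_mem _) n
  rw [sq, mul_comm t.k₀]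
  exact this

theorem Generic.eig_ne_zero (ht : t.Generic) (m : ℤ) : t.eig m ≠ 0 :=
  mul_ne_zero (mul_ne_zero (zpow_ne_zero _ ht.k₀_ne) (zpow_ne_zero _ ht.k₁_ne))
    (zpow_ne_zero _ ht.q_ne)

theorem eig_neg (t : Params) {m : ℤ} (hm : m ≠ 0) : t.eig (-m) = (t.eig m)⁻¹ := by
  rcases lt_or_gt_of_ne hm with h | h
  · rw [eig_of_neg t h, eig_of_nonneg t (by omega), mul_inv, inv_inv, zpow_neg]
  · rw [eig_of_neg t (show -m < 0 by omega), eig_of_nonneg t (by omega), mul_inv _ (t.q ^ m), zpow_neg]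

theorem Generic.eig_reflect (ht : t.Generic) (m : ℤ) : t.eig (-m - 1) = (t.q * t.eig m)⁻¹ := by
  have hq := ht.q_ne
  have e : t.q ^ (-m - 1) = (t.q * t.q ^ m)⁻¹ := by
    rw [← zpow_one_add₀ hq, ← zpow_neg]; congr 1; ring
  rcases lt_or_ge m 0 with h | h
  · rw [eig_of_neg t h, eig_of_nonneg t (by omega), e]
    simp only [mul_inv, inv_inv]; ring
  · rw [eig_of_neg t (show -m - 1 < 0 by omega), eig_of_nonneg t h, e]
    simp only [mul_inv]; ring

theorem Generic.eig_injective (ht : t.Generic) : Function.Injective t.eig := by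
  have hq := ht.q_ne
  have hk : t.k₀ * t.k₁ ≠ 0 := mul_ne_zero ht.k₀_ne ht.k₁_ne
  have key : ∀ m n : ℤ, 0 ≤ m → n < 0 → t.eig m ≠ t.eig n := by
    intro m n hm hn h
    rw [eig_of_nonneg t hm, eig_of_neg t hn] at h
    apply ht.k_sq (n - m)
    rw [zpow_sub₀ hq]
    have := zpow_ne_zero m hq
    field_simp at h ⊢
    rw [eq_div_iff hk] at h
    linear_combination h
  have key' : ∀ m n : ℤ, t.q ^ m = t.q ^ n → m = n := by
    intro m n h
    have : t.q ^ (m - n) = 1 := by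
      rw [zpow_sub₀ hq, h, div_self (zpow_ne_zero _ hq)]
    have := ht.q_zpow _ this
    omega
  intro m n h
  rcases lt_or_ge m 0 with hm | hm <;> rcases lt_or_ge n 0 with hn | hn
  · rw [eig_of_neg t hm, eig_of_neg t hn] at h
    exact key' _ _ (mul_left_cancel₀ (inv_ne_zero hk) h)
  · exact absurd h.symm (key _ _ hn hm)
  · exact absurd h (key _ _ hm hn)
  · rw [eig_of_nonneg t hm, eig_of_nonneg t hn] at h
    exact key' _ _ (mul_left_cancel₀ hk h)

theorem Generic.eig_sq (ht : t.Generic) (m n : ℤ) : t.eig m ^ 2 ≠ t.q ^ n := by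
  have hq := ht.q_ne
  intro h
  have hk : t.k₀ * t.k₁ ≠ 0 := mul_ne_zero ht.k₀_ne ht.k₁_ne
  have e : t.q ^ (n - 2 * m) = t.q ^ n / (t.q ^ m) ^ 2 := by
    rw [zpow_sub₀ hq, mul_comm 2 m, zpow_mul]; norm_cast
  have h0 := zpow_ne_zero m hq
  rcases lt_or_ge m 0 with hm | hm
  · rw [eig_of_neg t hm] at h
    refine ht.k_sq (-(n - 2 * m)) ?_
    rw [zpow_neg, e, ← h]; field_simp
  · rw [eig_of_nonneg t hm] at h
    refine ht.k_sq (n - 2 * m) ?_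
    rw [e, ← h]; field_simp

theorem Generic.index_eig (ht : t.Generic) (m : ℤ) : t.index (t.eig m) = m :=
  Function.leftInverse_invFun ht.eig_injective m

/-- `γ_m = ã` only for `m = 0`, and `γ_m ≠ b̃`. -/
theorem Generic.eig_lower_ne (ht : t.Generic) {m : ℤ} (hm : m ≠ 0) :
    (t.eig m - t.k₀ * t.k₁) * (t.eig m + t.k₁ * t.k₀⁻¹) ≠ 0 := by
  have hq := ht.q_ne
  have hk0 := ht.k₀_ne
  have hk1 := ht.k₁_ne
  refine mul_ne_zero (fun h => hm (ht.eig_injective ?_)) fun h => ?_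
  · rw [eig_of_nonneg t le_rfl, zpow_zero, mul_one]; exact sub_eq_zero.mp h
  · rcases lt_or_ge m 0 with hm | hm
    · rw [eig_of_neg t hm] at h
      refine ht.k₁_sq m ?_
      field_simp at h
      linear_combination h
    · rw [eig_of_nonneg t hm] at h
      refine ht.k₀_sq (-m) ?_
      rw [zpow_neg]
      have h0 := zpow_ne_zero m hq
      field_simp at h
      rw [mul_zero] at h
      rw [eq_neg_iff_add_eq_zero, ← mul_left_inj' h0, add_mul, inv_mul_cancel₀ h0, zero_mul]
      exact (mul_eq_zero.mp h).resolve_left hk1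

theorem Generic.eig_raise_ne (ht : t.Generic) (m : ℤ) :
    (1 - t.r * t.u₁ * t.u₀ * t.eig m) * (1 + t.r * t.u₁ * t.u₀⁻¹ * t.eig m) ≠ 0 := by
  have hq := ht.q_ne
  have hk0 := ht.k₀_ne
  have hk1 := ht.k₁_ne
  have hu0 := ht.u₀_ne
  have hu1 := ht.u₁_ne
  have hr := ht.r_ne
  have hqr : t.q = t.r ^ 2 := rfl
  have e1 : t.q ^ (-m) = (t.q ^ m)⁻¹ := zpow_neg _ _
  have e2 : t.q ^ (m + 1) = t.q ^ m * t.q := zpow_add_one₀ hq m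
  have h0 := zpow_ne_zero m hq
  refine mul_ne_zero (fun h => ?_) fun h => ?_
  · rcases lt_or_ge m 0 with hm | hm
    · rw [eig_of_neg t hm] at h
      refine ht.products _ t.b_mem _ t.d_mem (m + 1) ?_
      rw [e2, hqr] at *
      simp only [b, d]
      field_simp at h ⊢
      linear_combination h
    · rw [eig_of_nonneg t hm] at h
      refine ht.products_dual _ (a_mem _) _ (c_mem _) (-m) ?_
      change _ = t.q ^ (-m)
      rw [e1]
      simp only [a, c, dual]
      field_simp at h ⊢
      linear_combination -h
  · rcases lt_or_ge m 0 with hm | hm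
    · rw [eig_of_neg t hm] at h
      refine ht.products _ t.b_mem _ t.c_mem (m + 1) ?_
      rw [e2, hqr] at *
      simp only [b, c]
      field_simp at h ⊢
      linear_combination -h
    · rw [eig_of_nonneg t hm] at h
      refine ht.products_dual _ (a_mem _) _ (d_mem _) (-m) ?_
      change _ = t.q ^ (-m)
      rw [e1]
      simp only [a, d, dual]
      field_simp at h ⊢
      linear_combination -h

/-! ### Intertwiners -/

/-- The inverse of `T₁`. -/
def T₁inv (t : Params) : Laurent →ₗ[ℂ] Laurent := heckeInv t.k₁ t.u₁ 1 1

/-- The inverse of `T₀`. -/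
def T₀inv (t : Params) : Laurent →ₗ[ℂ] Laurent := heckeInv t.k₀ t.u₀ t.r (-1)

/-- The operator `x⁻¹ T₁⁻¹`, which satisfies a quadratic relation with parameter `u₁`. -/
def U (t : Params) : Laurent →ₗ[ℂ] Laurent :=
  LinearMap.mulLeft ℂ (LaurentPolynomial.T (-1)) ∘ₗ t.T₁inv

theorem U_apply (t : Params) (f : Laurent) :
    t.U f = LaurentPolynomial.T (-1) * t.T₁inv f := rfl

theorem Y_apply (t : Params) (f : Laurent) : t.Y f = t.T₁ (t.T₀ f) := rfl

theorem T₁inv_apply (t : Params) (f : Laurent) :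
    t.T₁inv f = t.T₁ f - (t.k₁ - t.k₁⁻¹) • f := rfl

theorem Generic.T₁_T₁inv (ht : t.Generic) (f : Laurent) : t.T₁ (t.T₁inv f) = f :=
  heckeOp_heckeInv ht.k₁_ne ht.u₁_ne one_ne_zero (Or.inl rfl) f

theorem Generic.T₁inv_T₁ (ht : t.Generic) (f : Laurent) : t.T₁inv (t.T₁ f) = f :=
  heckeInv_heckeOp ht.k₁_ne ht.u₁_ne one_ne_zero (Or.inl rfl) f

theorem Generic.T₀inv_T₀ (ht : t.Generic) (f : Laurent) : t.T₀inv (t.T₀ f) = f :=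
  heckeInv_heckeOp ht.k₀_ne ht.u₀_ne ht.r_ne (Or.inr rfl) f

theorem Generic.T₀_T₀ (ht : t.Generic) (f : Laurent) :
    t.T₀ (t.T₀ f) = (t.k₀ - t.k₀⁻¹) • t.T₀ f + f :=
  heckeOp_heckeOp ht.k₀_ne ht.u₀_ne ht.r_ne (Or.inr rfl) f

theorem Generic.T₁_X_mul (ht : t.Generic) (f : Laurent) :
    t.T₁ (LaurentPolynomial.T 1 * f) = t.U f - (t.u₁ - t.u₁⁻¹) • f := by
  have := heckeOp_rootMonomial_mul ht.k₁_ne ht.u₁_ne one_ne_zero (η := 1) (Or.inl rfl) f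
  simp only [rootMonomial, map_one, one_mul, inv_one] at this
  exact this

theorem Generic.T₀_X_inv_mul (ht : t.Generic) (f : Laurent) :
    t.T₀ (LaurentPolynomial.T (-1) * f) =
      t.q⁻¹ • (LaurentPolynomial.T 1 * t.T₀inv f) - (t.r⁻¹ * (t.u₀ - t.u₀⁻¹)) • f := by
  have h := heckeOp_rootMonomial_mul ht.k₀_ne ht.u₀_ne ht.r_ne (η := -1) (Or.inr rfl) f
  have hr := ht.r_ne
  simp only [rootMonomial, ← LaurentPolynomial.smul_eq_C_mul, smul_mul_assoc, map_smul,
    neg_neg] at h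
  have h2 := congrArg (fun F => t.r⁻¹ • F) h
  simp only [smul_sub, smul_smul, inv_mul_cancel₀ hr, one_smul] at h2
  rw [T₀, h2, q, sq, mul_inv]
  rfl

variable {e : Laurent} {γ : ℂ}

/-- The coefficient in the intertwining relation of `T₁`. -/
def β (t : Params) (γ : ℂ) : ℂ :=
  ((t.k₀ - t.k₀⁻¹) + (t.k₁ - t.k₁⁻¹) * γ) / (γ - γ⁻¹)

/-- The coefficient in the intertwining relation of `U`. -/
def δ (t : Params) (γ : ℂ) : ℂ :=
  (t.r⁻¹ * (t.u₀ - t.u₀⁻¹) + (t.q * γ)⁻¹ * (t.u₁ - t.u₁⁻¹)) / ((t.q * γ)⁻¹ - γ)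

theorem Generic.T₀_eigen (ht : t.Generic) (he : t.Y e = γ • e) : t.T₀ e = γ • t.T₁inv e := by
  rw [← map_smul, ← he, Y_apply, ht.T₁inv_T₁]

theorem Generic.Y_T₁_eigen (ht : t.Generic) (hγ : γ ≠ 0) (he : t.Y e = γ • e) :
    t.Y (t.T₁ e) = γ⁻¹ • t.T₁ e + ((t.k₀ - t.k₀⁻¹) + (t.k₁ - t.k₁⁻¹) * γ) • e := by
  have h1 : t.T₀ e = γ • t.T₁ e - (γ * (t.k₁ - t.k₁⁻¹)) • e := by
    rw [ht.T₀_eigen he, T₁inv_apply, smul_sub, smul_smul]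
  have h2 : γ • t.T₀ (t.T₁ e) =
      ((t.k₀ - t.k₀⁻¹) + (t.k₁ - t.k₁⁻¹) * γ) • t.T₀ e + e := by
    have h3 := congrArg t.T₀ h1
    rw [ht.T₀_T₀, map_sub, map_smul, map_smul] at h3
    rw [add_smul, mul_comm _ γ, add_right_comm, h3]
    abel
  have h4 := congrArg t.T₁ h2
  rw [map_smul, map_add, map_smul, ← Y_apply, ← Y_apply, he] at h4
  have h5 := congrArg (fun F => γ⁻¹ • F) h4
  simp only [smul_add, smul_smul, inv_mul_cancel₀ hγ, one_smul] at h5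
  rw [h5, add_comm, mul_comm _ γ, inv_mul_cancel_left₀ hγ]

theorem Generic.eigen_T₁ (ht : t.Generic) (hγ : γ ≠ 0) (hγ2 : γ ^ 2 ≠ 1) (he : t.Y e = γ • e) :
    t.Y (t.T₁ e - t.β γ • e) = γ⁻¹ • (t.T₁ e - t.β γ • e) := by
  have h1 : γ - γ⁻¹ ≠ 0 := by
    intro h; apply hγ2; field_simp at h; linear_combination h
  have h2 : ((t.k₀ - t.k₀⁻¹) + (t.k₁ - t.k₁⁻¹) * γ) = t.β γ * (γ - γ⁻¹) := by
    rw [β, div_mul_cancel₀ _ h1]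
  rw [map_sub, map_smul, ht.Y_T₁_eigen hγ he, he, h2]
  module

theorem Generic.Y_U_eigen (ht : t.Generic) (hγ : γ ≠ 0) (he : t.Y e = γ • e) :
    t.Y (t.U e) = (t.q * γ)⁻¹ • t.U e -
      (t.r⁻¹ * (t.u₀ - t.u₀⁻¹) + (t.q * γ)⁻¹ * (t.u₁ - t.u₁⁻¹)) • e := by
  have h1 : t.T₀inv (t.T₁inv e) = γ⁻¹ • e := by
    have h := ht.T₀_eigen he
    have h2 := congrArg t.T₀inv h
    rw [ht.T₀inv_T₀, map_smul] at h2
    rw [h2, smul_smul, inv_mul_cancel₀ hγ, one_smul, ← h2]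
  rw [Y_apply, U_apply, ht.T₀_X_inv_mul, h1, map_sub, map_smul, map_smul, ht.T₁_T₁inv,
    mul_smul_comm, map_smul, ht.T₁_X_mul, mul_inv]
  rw [← U_apply]
  module

theorem Generic.eigen_U (ht : t.Generic) (hγ : γ ≠ 0) (hγ2 : t.q * γ ^ 2 ≠ 1)
    (he : t.Y e = γ • e) :
    t.Y (t.U e - t.δ γ • e) = (t.q * γ)⁻¹ • (t.U e - t.δ γ • e) := by
  have hq := ht.q_ne
  have h1 : (t.q * γ)⁻¹ - γ ≠ 0 := by
    intro h; apply hγ2; field_simp at h; linear_combination -h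
  have h2 : t.r⁻¹ * (t.u₀ - t.u₀⁻¹) + (t.q * γ)⁻¹ * (t.u₁ - t.u₁⁻¹) =
      t.δ γ * ((t.q * γ)⁻¹ - γ) := by
    rw [δ, div_mul_cancel₀ _ h1]
  rw [map_sub, map_smul, ht.Y_U_eigen hγ he, he, h2]
  module

theorem Generic.sub_β (ht : t.Generic) (hγ : γ ≠ 0) (hγ2 : γ ^ 2 ≠ 1) :
    t.k₁ - t.β γ =
      (γ - t.k₀ * t.k₁) * (γ + t.k₁ * t.k₀⁻¹) / (t.k₁ * (γ ^ 2 - 1)) := by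
  have h1 : γ ^ 2 - 1 ≠ 0 := sub_ne_zero.mpr hγ2
  have h2 : γ - γ⁻¹ = (γ ^ 2 - 1) / γ := by field_simp
  have hk0 := ht.k₀_ne
  have hk1 := ht.k₁_ne
  rw [β, h2]
  field_simp
  ring

theorem Generic.sub_δ (ht : t.Generic) (hγ : γ ≠ 0) (hγ2 : t.q * γ ^ 2 ≠ 1) :
    t.u₁ - t.δ γ =
      (1 - t.r * t.u₁ * t.u₀ * γ) * (1 + t.r * t.u₁ * t.u₀⁻¹ * γ) /
        (t.u₁ * (1 - t.q * γ ^ 2)) := by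
  have h1 : 1 - t.q * γ ^ 2 ≠ 0 := sub_ne_zero.mpr hγ2.symm
  have hq := ht.q_ne
  have h2 : (t.q * γ)⁻¹ - γ = (1 - t.q * γ ^ 2) / (t.q * γ) := by field_simp
  have h3 := mul_inv_cancel₀ ht.u₀_ne
  have h4 := mul_inv_cancel₀ ht.u₁_ne
  have hr := ht.r_ne
  have hqr : t.r⁻¹ * t.q = t.r := by rw [q]; field_simp
  have h5 : t.δ γ * (1 - t.q * γ ^ 2) =
      t.r * γ * (t.u₀ - t.u₀⁻¹) + (t.u₁ - t.u₁⁻¹) := by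
    rw [δ, h2, div_div_eq_mul_div, div_mul_cancel₀ _ h1]
    linear_combination (γ * (t.u₀ - t.u₀⁻¹)) * hqr +
      (t.u₁ - t.u₁⁻¹) * inv_mul_cancel₀ (mul_ne_zero hq hγ)
  rw [eq_div_iff (mul_ne_zero ht.u₁_ne h1)]
  have hqq : t.q = t.r ^ 2 := rfl
  rw [hqq] at h5 ⊢
  linear_combination -t.u₁ * h5 + h4 + t.r ^ 2 * t.u₁ ^ 2 * γ ^ 2 * h3

/-! ### Evaluation at the base point -/

/-- The point `k₁⁻¹ u₁⁻¹` at which the polynomials are normalized. -/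
def basePt (t : Params) : ℂ := t.k₁⁻¹ * t.u₁⁻¹

theorem Generic.basePt_ne (ht : t.Generic) : t.basePt ≠ 0 :=
  mul_ne_zero (inv_ne_zero ht.k₁_ne) (inv_ne_zero ht.u₁_ne)

theorem Generic.ev_T₁ (ht : t.Generic) (f : Laurent) :
    ev (t.T₁ f) t.basePt = t.k₁ * ev f t.basePt := by
  have hk1 := ht.k₁_ne
  have hu1 := ht.u₁_ne
  refine ev_heckeOp_of_root one_ne_zero (Or.inl rfl) f ht.basePt_ne (fun h => ?_) ?_
  · refine ht.products _ t.a_mem _ t.a_mem 0 ?_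
    rw [one_mul, zpow_one, basePt, ← mul_inv, inv_pow, inv_eq_one] at h
    rw [zpow_zero, ← h, a, sq]
  · simp only [basePt, one_mul, zpow_one]
    field_simp

theorem Generic.ev_T₁inv (ht : t.Generic) (f : Laurent) :
    ev (t.T₁inv f) t.basePt = t.k₁⁻¹ * ev f t.basePt := by
  rw [T₁inv_apply, ev_sub, ht.ev_T₁, ev_smul]; ring

theorem Generic.ev_U (ht : t.Generic) (f : Laurent) :
    ev (t.U f) t.basePt = t.u₁ * ev f t.basePt := by
  have hk1 := ht.k₁_ne
  have hu1 := ht.u₁_ne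
  rw [U_apply, ev_mul _ _ ht.basePt_ne, ev_T, ht.ev_T₁inv, basePt, zpow_neg_one]
  field_simp

theorem T₁_one (t : Params) : t.T₁ 1 = t.k₁ • 1 :=
  laurent_ext_root one_ne_zero (Or.inl rfl) fun x hx h1 => by
    rw [T₁, ev_heckeOp one_ne_zero (Or.inl rfl) _ hx h1, ev_smul]
    simp only [ev_one]
    ring

theorem Generic.T₀_one (ht : t.Generic) : t.T₀ 1 = t.k₀ • 1 :=
  laurent_ext_root ht.r_ne (Or.inr rfl) fun x hx h1 => by
    rw [T₀, ev_heckeOp ht.r_ne (Or.inr rfl) _ hx h1, ev_smul]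
    simp only [ev_one]
    ring

end Params

end AskeyWilson
end

open scoped LaurentPolynomial

noncomputable section

namespace AskeyWilson

/-! ### Laurent polynomials with prescribed support -/

/-- The Laurent polynomials supported in a set of exponents. -/
def suppIn (s : Set ℤ) : Submodule ℂ Laurent where
  carrier := {f | ∀ n, n ∉ s → f.coeff n = 0}
  add_mem' {f g} hf hg n hn := by
    rw [AddMonoidAlgebra.coeff_add, Finsupp.add_apply, hf n hn, hg n hn, add_zero]
  zero_mem' n _ := by simp
  smul_mem' r f hf n hn := by
    rw [AddMonoidAlgebra.coeff_smul, Finsupp.smul_apply, hf n hn, smul_zero]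

theorem suppIn_mono {s s' : Set ℤ} (h : s ⊆ s') : suppIn s ≤ suppIn s' :=
  fun _ hf n hn => hf n fun h' => hn (h h')

theorem T_mem_suppIn {s : Set ℤ} {m : ℤ} (hm : m ∈ s) : LaurentPolynomial.T m ∈ suppIn s := by
  intro n hn
  rw [LaurentPolynomial.T_apply, if_neg]
  rintro rfl
  exact hn hm

theorem suppIn_le_span (s : Set ℤ) :
    suppIn s ≤ Submodule.span ℂ (LaurentPolynomial.T '' s) := by
  intro f hf
  have h1 : f = f.coeff.sum fun m c => c • (LaurentPolynomial.T m : Laurent) := by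
    apply AddMonoidAlgebra.coeff_injective
    ext n
    rw [Finsupp.sum, AddMonoidAlgebra.coeff_sum, Finsupp.finsetSum_apply]
    simp [AddMonoidAlgebra.coeff_smul]
  rw [h1]
  refine Submodule.sum_mem _ fun m hm => Submodule.smul_mem _ _ (Submodule.subset_span ⟨m, ?_, rfl⟩)
  by_contra hms
  exact (Finsupp.mem_support_iff.mp hm) (hf m hms)

theorem linearMap_suppIn (F : Laurent →ₗ[ℂ] Laurent) {s s' : Set ℤ}
    (h : ∀ m ∈ s, F (LaurentPolynomial.T m) ∈ suppIn s') {f : Laurent} (hf : f ∈ suppIn s) :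
    F f ∈ suppIn s' := by
  have h1 : Submodule.span ℂ (LaurentPolynomial.T '' s) ≤ (suppIn s').comap F := by
    rw [Submodule.span_le]
    rintro _ ⟨m, hm, rfl⟩
    exact h m hm
  exact h1 (suppIn_le_span s hf)

theorem T_mul_mem_suppIn {s s' : Set ℤ} {k : ℤ} (h : ∀ m ∈ s, k + m ∈ s') {f : Laurent}
    (hf : f ∈ suppIn s) : LaurentPolynomial.T k * f ∈ suppIn s' :=
  linearMap_suppIn (LinearMap.mulLeft ℂ (LaurentPolynomial.T k)) (s := s) (fun m hm => by
    rw [LinearMap.mulLeft_apply, ← LaurentPolynomial.T_add]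
    exact T_mem_suppIn (h m hm)) hf

theorem C_mul_mem_suppIn {s : Set ℤ} (r : ℂ) {f : Laurent}
    (hf : f ∈ suppIn s) : LaurentPolynomial.C r * f ∈ suppIn s := by
  rw [← LaurentPolynomial.smul_eq_C_mul]; exact Submodule.smul_mem _ _ hf

theorem T_mul_geomQuot_mem {s : Set ℤ} (e : ℂ) (k n m : ℤ)
    (h : ∀ j : ℤ, 0 ≤ j → j < n → m + k * j ∈ s)
    (h' : ∀ j : ℤ, j < 0 → n ≤ j → m + k * j ∈ s) :
    LaurentPolynomial.T m * geomQuot e k n ∈ suppIn s := by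
  unfold geomQuot
  split_ifs with hn
  · rw [Finset.mul_sum]
    refine Submodule.sum_mem _ fun j hj => ?_
    rw [mul_left_comm, ← LaurentPolynomial.T_add]
    rw [Finset.mem_range] at hj
    exact C_mul_mem_suppIn _ (T_mem_suppIn (h j (by omega) (by omega)))
  · rw [mul_neg, Finset.mul_sum]
    refine Submodule.neg_mem _ (Submodule.sum_mem _ fun j hj => ?_)
    rw [mul_left_comm, ← LaurentPolynomial.T_add]
    rw [Finset.mem_range] at hj
    exact C_mul_mem_suppIn _ (T_mem_suppIn (h' _ (by omega) (by omega)))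

theorem dividedDiff_T_mem {N m : ℤ} (h1 : -N ≤ m) (h2 : m ≤ N) :
    dividedDiff 1 1 (LaurentPolynomial.T m) ∈ suppIn (Set.Icc (-N) (N - 2)) := by
  have h := linExt_C_mul_T
    (fun m => LaurentPolynomial.T m * geomQuot ((1 : ℂ) ^ 2) (2 * 1) (-1 * m)) 1 m
  rw [map_one, one_mul, one_smul] at h
  rw [dividedDiff, h]
  refine T_mul_geomQuot_mem _ _ _ _ (fun j hj hj' => ?_) fun j hj hj' => ?_
  · constructor <;> omega
  · constructor <;> omega

namespace Params

variable {t : Params}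

theorem T₁_mem (t : Params) {N : ℤ} {f : Laurent} (hf : f ∈ suppIn (Set.Icc (-N) N)) :
    t.T₁ f ∈ suppIn (Set.Icc (-N) N) := by
  have hD : dividedDiff 1 1 f ∈ suppIn (Set.Icc (-N) (N - 2)) :=
    linearMap_suppIn _ (fun m hm => dividedDiff_T_mem hm.1 hm.2) hf
  generalize hg : dividedDiff 1 1 f = g at hD
  have hT : t.T₁ f = t.k₁ • f - t.k₁⁻¹ • (g + (t.k₁ * t.u₁⁻¹ - t.k₁ * t.u₁) •
      (LaurentPolynomial.T 1 * g) - (t.k₁ * t.u₁ * (t.k₁ * t.u₁⁻¹)) •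
        (LaurentPolynomial.T 2 * g)) := by
    rw [T₁, heckeOp, LinearMap.sub_apply, LinearMap.smul_apply, LinearMap.smul_apply,
      LinearMap.comp_apply, hg]
    refine laurent_ext fun x hx => ?_
    simp only [LinearMap.mulLeft_apply, LinearMap.id_apply, ev_sub, ev_smul, ev_mul _ _ hx, ev_add,
      ev_one, ev_rootMonomial, ev_T, zpow_one, one_mul]
    rw [show x ^ (2 : ℤ) = x ^ 2 from by norm_cast]
    ring
  rw [hT]
  refine Submodule.sub_mem _ (Submodule.smul_mem _ _ hf) (Submodule.smul_mem _ _
    (Submodule.sub_mem _ (Submodule.add_mem _ (suppIn_mono (Set.Icc_subset_Icc le_rfl (by omega)) hD)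
      (Submodule.smul_mem _ _ (T_mul_mem_suppIn (fun m hm => ?_) hD))) (Submodule.smul_mem _ _
        (T_mul_mem_suppIn (fun m hm => ?_) hD))))
  · exact ⟨by have := hm.1; omega, by have := hm.2; omega⟩
  · exact ⟨by have := hm.1; omega, by have := hm.2; omega⟩

theorem T₁inv_mem (t : Params) {N : ℤ} {f : Laurent} (hf : f ∈ suppIn (Set.Icc (-N) N)) :
    t.T₁inv f ∈ suppIn (Set.Icc (-N) N) :=
  Submodule.sub_mem _ (t.T₁_mem hf) (Submodule.smul_mem _ _ hf)

theorem U_mem (t : Params) {N : ℤ} {f : Laurent} (hf : f ∈ suppIn (Set.Icc (-N) N)) :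
    t.U f ∈ suppIn (Set.Icc (-N - 1) N) := by
  rw [U_apply]
  refine T_mul_mem_suppIn (fun m hm => ?_) (t.T₁inv_mem hf)
  exact ⟨by have := hm.1; omega, by have := hm.2; omega⟩

end Params

/-- The exponents `n ≼ m`. -/
def lowerSet (m : ℤ) : Set ℤ := if 0 ≤ m then Set.Icc (-m) m else Set.Icc m (-m - 1)

theorem lowerSet_of_nonneg {m : ℤ} (hm : 0 ≤ m) : lowerSet m = Set.Icc (-m) m := if_pos hm

theorem lowerSet_of_neg {m : ℤ} (hm : m < 0) : lowerSet m = Set.Icc m (-m - 1) :=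
  if_neg (not_le.mpr hm)

theorem mem_lowerSet_iff {n m : ℤ} : n ∈ lowerSet m ↔ n = m ∨ Prec n m := by
  unfold lowerSet Prec
  split_ifs with h <;> rw [Set.mem_Icc]
  · rcases abs_cases n with h1 | h1 <;> rcases abs_cases m with h2 | h2 <;> omega
  · rcases abs_cases n with h1 | h1 <;> rcases abs_cases m with h2 | h2 <;> omega

/-- Induction along the order `0 ≺ -1 ≺ 1 ≺ -2 ≺ 2 ≺ ⋯`. -/
theorem chain_induction {P : ℤ → Prop} (h0 : P 0) (h1 : ∀ n : ℤ, 0 ≤ n → P n → P (-n - 1))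
    (h2 : ∀ n : ℤ, n < 0 → P n → P (-n)) (m : ℤ) : P m := by
  have key : ∀ n : ℕ, P n := by
    intro n
    induction n with
    | zero => exact_mod_cast h0
    | succ n ih =>
      have := h2 _ (by omega) (h1 _ (by omega) ih)
      rwa [show -(-(n : ℤ) - 1) = ((n + 1 : ℕ) : ℤ) by push_cast; ring] at this
  rcases lt_or_ge m 0 with hm | hm
  · have := h1 _ (by omega) (key (-m - 1).toNat)
    rwa [Int.toNat_of_nonneg (by omega), show -(-m - 1) - 1 = m by ring] at this
  · have := key m.toNat
    rwa [Int.toNat_of_nonneg hm] at this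

/-! ### The eigenbasis of `Y` -/

namespace Params

variable {t : Params}

/-- A spectral vector: an eigenvector of `Y` with eigenvalue `γ_m`, normalized at the base point. -/
structure IsEigen (t : Params) (m : ℤ) (e : Laurent) : Prop where
  eigen : t.Y e = t.eig m • e
  ev : ev e t.basePt = 1

theorem Generic.β_ne (ht : t.Generic) {m : ℤ} (hm : m ≠ 0) : t.k₁ - t.β (t.eig m) ≠ 0 := by
  have h1 : t.eig m ^ 2 ≠ 1 := by simpa using ht.eig_sq m 0
  rw [ht.sub_β (ht.eig_ne_zero m) h1]
  exact div_ne_zero (ht.eig_lower_ne hm) (mul_ne_zero ht.k₁_ne (sub_ne_zero.mpr h1))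

theorem Generic.q_eig_sq (ht : t.Generic) (m : ℤ) : t.q * t.eig m ^ 2 ≠ 1 := fun h =>
  ht.eig_sq m (-1) (by rw [zpow_neg_one]; exact eq_inv_of_mul_eq_one_right h)

theorem Generic.δ_ne (ht : t.Generic) (m : ℤ) : t.u₁ - t.δ (t.eig m) ≠ 0 := by
  rw [ht.sub_δ (ht.eig_ne_zero m) (ht.q_eig_sq m)]
  exact div_ne_zero (ht.eig_raise_ne m)
    (mul_ne_zero ht.u₁_ne (sub_ne_zero.mpr (ht.q_eig_sq m).symm))

theorem Generic.isEigen_neg (ht : t.Generic) {m : ℤ} (hm : m ≠ 0) {e : Laurent}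
    (he : t.IsEigen m e) :
    t.IsEigen (-m) ((t.k₁ - t.β (t.eig m))⁻¹ • (t.T₁ e - t.β (t.eig m) • e)) where
  eigen := by
    have h1 : t.eig m ^ 2 ≠ 1 := by simpa using ht.eig_sq m 0
    rw [map_smul, ht.eigen_T₁ (ht.eig_ne_zero m) h1 he.eigen, t.eig_neg hm, smul_comm]
  ev := by
    rw [ev_smul, ev_sub, ev_smul, ht.ev_T₁, he.ev, mul_one, mul_one, inv_mul_cancel₀ (ht.β_ne hm)]

theorem Generic.isEigen_reflect (ht : t.Generic) (m : ℤ) {e : Laurent} (he : t.IsEigen m e) :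
    t.IsEigen (-m - 1) ((t.u₁ - t.δ (t.eig m))⁻¹ • (t.U e - t.δ (t.eig m) • e)) where
  eigen := by
    rw [map_smul, ht.eigen_U (ht.eig_ne_zero m) (ht.q_eig_sq m) he.eigen, ht.eig_reflect m,
      smul_comm]
  ev := by
    rw [ev_smul, ev_sub, ev_smul, ht.ev_U, he.ev, mul_one, mul_one, inv_mul_cancel₀ (ht.δ_ne m)]

theorem Generic.isEigen_zero (ht : t.Generic) : t.IsEigen 0 1 where
  eigen := by
    rw [Y_apply, ht.T₀_one, map_smul, T₁_one, smul_smul, eig_of_nonneg t le_rfl, zpow_zero, mul_one]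
  ev := ev_one _

theorem Generic.exists_isEigen (ht : t.Generic) (m : ℤ) :
    ∃ e, t.IsEigen m e ∧ e ∈ suppIn (lowerSet m) := by
  induction m using chain_induction with
  | h0 => exact ⟨1, ht.isEigen_zero, T_mem_suppIn (by simp [lowerSet])⟩
  | h1 n hn ih =>
    obtain ⟨e, he, hs⟩ := ih
    refine ⟨_, ht.isEigen_reflect n he, Submodule.smul_mem _ _ ?_⟩
    rw [lowerSet_of_nonneg hn] at hs
    rw [lowerSet_of_neg (by omega), show -(-n - 1) - 1 = n by ring]
    exact Submodule.sub_mem _ (t.U_mem hs) (Submodule.smul_mem _ _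
      (suppIn_mono (Set.Icc_subset_Icc (by omega) le_rfl) hs))
  | h2 n hn ih =>
    obtain ⟨e, he, hs⟩ := ih
    refine ⟨_, ht.isEigen_neg hn.ne he, Submodule.smul_mem _ _ ?_⟩
    rw [lowerSet_of_neg hn] at hs
    have hs' := suppIn_mono (s' := Set.Icc (- -n) (-n)) (Set.Icc_subset_Icc (by omega) (by omega)) hs
    rw [lowerSet_of_nonneg (by omega)]
    exact Submodule.sub_mem _ (t.T₁_mem hs') (Submodule.smul_mem _ _ hs')

/-- A choice of normalized eigenvectors; they turn out to be the polynomials `E_{γ_m}`. -/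
def eigvec (ht : t.Generic) (m : ℤ) : Laurent := (ht.exists_isEigen m).choose

theorem eigvec_isEigen (ht : t.Generic) (m : ℤ) : t.IsEigen m (eigvec ht m) :=
  (ht.exists_isEigen m).choose_spec.1

theorem eigvec_mem (ht : t.Generic) (m : ℤ) : eigvec ht m ∈ suppIn (lowerSet m) :=
  (ht.exists_isEigen m).choose_spec.2

theorem IsEigen.ne_zero {m : ℤ} {e : Laurent} (he : t.IsEigen m e) : e ≠ 0 := by
  rintro rfl
  simpa [ev_zero] using he.ev

theorem eigvec_linearIndependent (ht : t.Generic) : LinearIndependent ℂ (eigvec ht) :=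
  Module.End.eigenvectors_linearIndependent' t.Y t.eig ht.eig_injective _ fun m =>
    ⟨Module.End.mem_eigenspace_iff.mpr (eigvec_isEigen ht m).eigen, (eigvec_isEigen ht m).ne_zero⟩

/-- If all exponents below `m` are accounted for, the leading coefficient does not vanish. -/
theorem eigvec_coeff_ne_zero_of (ht : t.Generic) {m : ℤ} {s : Set ℤ} (hs : lowerSet m = insert m s)
    (hm : m ∉ s) (h : suppIn s ≤ Submodule.span ℂ (eigvec ht '' s)) :
    (eigvec ht m).coeff m ≠ 0 := by
  intro h0
  refine (eigvec_linearIndependent ht).notMem_span_image hm (h fun n hn => ?_)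
  rcases eq_or_ne n m with rfl | hnm
  · exact h0
  · refine eigvec_mem ht m n ?_
    rw [hs]
    simp [hnm, hn]

theorem suppIn_le_span_eigvec_of (ht : t.Generic) {m : ℤ} {s : Set ℤ}
    (hs : lowerSet m = insert m s) (hm : m ∉ s)
    (h : suppIn s ≤ Submodule.span ℂ (eigvec ht '' s)) :
    suppIn (lowerSet m) ≤ Submodule.span ℂ (eigvec ht '' lowerSet m) := by
  intro f hf
  have h0 := eigvec_coeff_ne_zero_of ht hs hm h
  have h1 : f - (f.coeff m / (eigvec ht m).coeff m) • eigvec ht m ∈ suppIn s := by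
    intro n hn
    rw [AddMonoidAlgebra.coeff_sub, AddMonoidAlgebra.coeff_smul, Finsupp.sub_apply,
      Finsupp.smul_apply, smul_eq_mul]
    rcases eq_or_ne n m with rfl | hnm
    · rw [div_mul_cancel₀ _ h0, sub_self]
    · have : n ∉ lowerSet m := by rw [hs]; simp [hnm, hn]
      rw [hf n this, eigvec_mem ht m n this, mul_zero, sub_zero]
  have h2 := Submodule.span_mono (R := ℂ)
    (Set.image_mono (f := eigvec ht) (hs ▸ Set.subset_insert m s)) (h h1)
  have h3 : eigvec ht m ∈ Submodule.span ℂ (eigvec ht '' lowerSet m) :=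
    Submodule.subset_span ⟨m, by rw [hs]; exact Set.mem_insert _ _, rfl⟩
  simpa using Submodule.add_mem _ h2 (Submodule.smul_mem _ (f.coeff m / (eigvec ht m).coeff m) h3)

theorem lowerSet_zero : lowerSet 0 = insert 0 ∅ := by
  ext n; simp [lowerSet]

theorem lowerSet_reflect {n : ℤ} (hn : 0 ≤ n) :
    lowerSet (-n - 1) = insert (-n - 1) (lowerSet n) := by
  rw [lowerSet_of_neg (by omega), lowerSet_of_nonneg hn]
  ext k; simp only [Set.mem_Icc, Set.mem_insert_iff]; omega

theorem lowerSet_neg {n : ℤ} (hn : n < 0) : lowerSet (-n) = insert (-n) (lowerSet n) := by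
  rw [lowerSet_of_neg hn, lowerSet_of_nonneg (by omega)]
  ext k; simp only [Set.mem_Icc, Set.mem_insert_iff]; omega

theorem notMem_lowerSet_reflect {n : ℤ} (hn : 0 ≤ n) : -n - 1 ∉ lowerSet n := by
  rw [lowerSet_of_nonneg hn, Set.mem_Icc]; omega

theorem notMem_lowerSet_neg {n : ℤ} (hn : n < 0) : -n ∉ lowerSet n := by
  rw [lowerSet_of_neg hn, Set.mem_Icc]; omega

theorem suppIn_empty_le (p : Submodule ℂ Laurent) : suppIn ∅ ≤ p := by
  intro f hf
  have : f = 0 := by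
    apply AddMonoidAlgebra.coeff_injective
    ext n
    simpa using hf n (by simp)
  rw [this]; exact Submodule.zero_mem _

theorem suppIn_le_span_eigvec (ht : t.Generic) (m : ℤ) :
    suppIn (lowerSet m) ≤ Submodule.span ℂ (eigvec ht '' lowerSet m) := by
  induction m using chain_induction with
  | h0 => exact suppIn_le_span_eigvec_of ht lowerSet_zero (by simp) (suppIn_empty_le _)
  | h1 n hn ih =>
    exact suppIn_le_span_eigvec_of ht (lowerSet_reflect hn) (notMem_lowerSet_reflect hn) ih
  | h2 n hn ih =>
    exact suppIn_le_span_eigvec_of ht (lowerSet_neg hn) (notMem_lowerSet_neg hn) ih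

theorem eigvec_coeff_ne_zero (ht : t.Generic) (m : ℤ) : (eigvec ht m).coeff m ≠ 0 := by
  induction m using chain_induction with
  | h0 => exact eigvec_coeff_ne_zero_of ht lowerSet_zero (by simp) (suppIn_empty_le _)
  | h1 n hn ih =>
    exact eigvec_coeff_ne_zero_of ht (lowerSet_reflect hn) (notMem_lowerSet_reflect hn)
      (suppIn_le_span_eigvec ht n)
  | h2 n hn ih =>
    exact eigvec_coeff_ne_zero_of ht (lowerSet_neg hn) (notMem_lowerSet_neg hn)
      (suppIn_le_span_eigvec ht n)

theorem span_eigvec (ht : t.Generic) : ⊤ ≤ Submodule.span ℂ (Set.range (eigvec ht)) := by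
  intro f _
  obtain ⟨N, hN⟩ : ∃ N : ℕ, ∀ n ∈ f.coeff.support, n.natAbs ≤ N :=
    ⟨f.coeff.support.sup Int.natAbs, fun n hn => Finset.le_sup (f := Int.natAbs) hn⟩
  refine Submodule.span_mono (Set.image_subset_range _ _) (suppIn_le_span_eigvec ht N fun n hn => ?_)
  by_contra h
  apply hn
  have := hN n (Finsupp.mem_support_iff.mpr h)
  rw [lowerSet_of_nonneg (by omega), Set.mem_Icc]
  omega

/-- The eigenbasis of `Y`. -/
def eigbasis (ht : t.Generic) : Module.Basis ℤ ℂ Laurent :=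
  Module.Basis.mk (eigvec_linearIndependent ht) (span_eigvec ht)

theorem eigbasis_apply (ht : t.Generic) (m : ℤ) : eigbasis ht m = eigvec ht m := by
  simp [eigbasis]

/-- The eigenspaces of `Y` are one-dimensional. -/
theorem eq_smul_eigvec (ht : t.Generic) {m : ℤ} {f : Laurent} (hf : t.Y f = t.eig m • f) :
    f = ev f t.basePt • eigvec ht m := by
  have h1 : ∀ n, (eigbasis ht).coord n ∘ₗ t.Y = t.eig n • (eigbasis ht).coord n := by
    intro n
    refine (eigbasis ht).ext fun k => ?_
    rw [LinearMap.comp_apply, eigbasis_apply, (eigvec_isEigen ht k).eigen, map_smul,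
      LinearMap.smul_apply, ← eigbasis_apply, Module.Basis.coord_apply, Module.Basis.repr_self]
    rcases eq_or_ne k n with rfl | hkn
    · rfl
    · rw [Finsupp.single_eq_of_ne hkn.symm, smul_zero, smul_zero]
  have h2 : ∀ n, n ≠ m → (eigbasis ht).repr f n = 0 := by
    intro n hn
    have h := LinearMap.congr_fun (h1 n) f
    rw [LinearMap.comp_apply, hf, map_smul, LinearMap.smul_apply, smul_eq_mul, smul_eq_mul,
      ← sub_eq_zero, ← sub_mul] at h
    exact (mul_eq_zero.mp h).resolve_left
      (sub_ne_zero.mpr fun h => hn (ht.eig_injective h.symm))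
  have h3 : f = (eigbasis ht).repr f m • eigvec ht m := by
    apply (eigbasis ht).repr.injective
    ext n
    rw [map_smul, ← eigbasis_apply, Module.Basis.repr_self, Finsupp.smul_apply]
    rcases eq_or_ne n m with rfl | hnm
    · simp
    · rw [h2 n hnm, Finsupp.single_eq_of_ne hnm, smul_zero]
  have h4 := congrArg (fun F => ev F t.basePt) h3
  simp only [ev_smul, (eigvec_isEigen ht m).ev, mul_one] at h4
  rw [h4]
  exact h3

theorem monicPoly_spec (ht : t.Generic) (m : ℤ) :
    IsMonicOfDegree (t.monicPoly m) m ∧ t.Y (t.monicPoly m) = t.eig m • t.monicPoly m := by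
  have h0 := eigvec_coeff_ne_zero ht m
  refine Classical.epsilon_spec
    (p := fun P => IsMonicOfDegree P m ∧ t.Y P = t.eig m • P)
    ⟨((eigvec ht m).coeff m)⁻¹ • eigvec ht m, ⟨?_, fun n hn hc => ?_⟩, ?_⟩
  · rw [AddMonoidAlgebra.coeff_smul, Finsupp.smul_apply, smul_eq_mul, inv_mul_cancel₀ h0]
  · rw [AddMonoidAlgebra.coeff_smul, Finsupp.smul_apply, smul_eq_mul] at hc
    by_contra hp
    exact right_ne_zero_of_mul hc (eigvec_mem ht m n fun h =>
      (mem_lowerSet_iff.mp h).elim hn hp)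
  · rw [map_smul, (eigvec_isEigen ht m).eigen, smul_comm]

theorem E_eig (ht : t.Generic) (m : ℤ) : t.E (t.eig m) = eigvec ht m := by
  obtain ⟨h1, h2⟩ := monicPoly_spec ht m
  have h3 := eq_smul_eigvec ht h2
  have h4 : ev (t.monicPoly m) t.basePt ≠ 0 := by
    intro h
    rw [h, zero_smul] at h3
    have := h1.1
    rw [h3] at this
    simp at this
  rw [E, ht.index_eig, ← basePt, inv_smul_eq_iff₀ h4]
  exact h3

theorem IsEigen.eq_E (ht : t.Generic) {m : ℤ} {e : Laurent} (he : t.IsEigen m e) :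
    e = t.E (t.eig m) := by
  rw [E_eig ht, eq_smul_eigvec ht he.eigen, he.ev, one_smul]

theorem E_isEigen (ht : t.Generic) (m : ℤ) : t.IsEigen m (t.E (t.eig m)) := by
  rw [E_eig ht]; exact eigvec_isEigen ht m

theorem E_eig_zero (ht : t.Generic) : t.E (t.eig 0) = 1 := (ht.isEigen_zero.eq_E ht).symm

theorem T₁_E (ht : t.Generic) {m : ℤ} (hm : m ≠ 0) :
    t.T₁ (t.E (t.eig m)) = t.β (t.eig m) • t.E (t.eig m) +
      (t.k₁ - t.β (t.eig m)) • t.E (t.eig (-m)) := by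
  rw [← (ht.isEigen_neg hm (E_isEigen ht m)).eq_E ht, smul_smul, mul_inv_cancel₀ (ht.β_ne hm)]
  module

theorem U_E (ht : t.Generic) (m : ℤ) :
    t.U (t.E (t.eig m)) = t.δ (t.eig m) • t.E (t.eig m) +
      (t.u₁ - t.δ (t.eig m)) • t.E (t.eig (-m - 1)) := by
  rw [← (ht.isEigen_reflect m (E_isEigen ht m)).eq_E ht, smul_smul, mul_inv_cancel₀ (ht.δ_ne m)]
  module

/-- The polynomials for the inverse parameters in terms of those for `t`. -/
theorem invert_E_inv (ht : t.Generic) (m : ℤ) :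
    LaurentPolynomial.invert (t.inv.E (t.inv.eig m)) = t.k₁ • t.T₁inv (t.E (t.eig m)) := by
  have he := E_isEigen ht m
  have h1 : ∀ f, t.inv.T₁ (LaurentPolynomial.invert f) =
      LaurentPolynomial.invert (t.T₁inv f) := fun f => by
    have h := invert_heckeOp_inv ht.k₁_ne ht.u₁_ne one_ne_zero (η := 1) (Or.inl rfl) f
    rw [inv_one] at h
    exact h
  have h0 : ∀ f, t.inv.T₀ (LaurentPolynomial.invert f) =
      LaurentPolynomial.invert (t.T₀inv f) :=
    invert_heckeOp_inv ht.k₀_ne ht.u₀_ne ht.r_ne (Or.inr rfl)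
  have h2 : t.T₀inv (t.T₁inv (t.E (t.eig m))) = (t.eig m)⁻¹ • t.E (t.eig m) := by
    have h := congrArg t.T₀inv (ht.T₀_eigen he.eigen)
    rw [ht.T₀inv_T₀, map_smul] at h
    conv_rhs => rw [h]
    rw [smul_smul, inv_mul_cancel₀ (ht.eig_ne_zero m), one_smul]
  have h3 : t.inv.IsEigen m
      (LaurentPolynomial.invert (t.k₁ • t.T₁inv (t.E (t.eig m)))) := by
    refine ⟨?_, ?_⟩
    · rw [Y_apply, h0, h1, map_smul, map_smul, h2, map_smul, map_smul, map_smul, map_smul, eig_inv,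
        smul_comm]
    · have : t.inv.basePt⁻¹ = t.basePt := by simp [basePt, inv, mul_comm]
      rw [ev_invert, this, ev_smul, ht.ev_T₁inv, he.ev, mul_one, mul_inv_cancel₀ ht.k₁_ne]
  rw [← h3.eq_E ht.inv]
  exact LaurentPolynomial.involutive_invert _

end Params

end AskeyWilson
end

open scoped LaurentPolynomial

noncomputable section

namespace AskeyWilson

namespace Params

/-! ### Functionals compatible with the difference-reflection operators -/

/-- A linear functional on which `T₀` and `T₁` act by their trivial eigenvalues. -/
structure IsInvariant (t : Params) (l : Laurent →ₗ[ℂ] ℂ) : Prop where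
  T₁ : ∀ f, l (t.T₁ f) = t.k₁ * l f
  T₀ : ∀ f, l (t.T₀ f) = t.k₀ * l f

variable {t : Params} {l : Laurent →ₗ[ℂ] ℂ}

/-- The bilinear form `(f, g) ↦ l (f T₁⁻¹ g)`. -/
def invPairing (t : Params) (l : Laurent →ₗ[ℂ] ℂ) (f g : Laurent) : ℂ := l (f * t.T₁inv g)

theorem IsInvariant.T₁_symm (hl : t.IsInvariant l) (f g : Laurent) :
    l (t.T₁ f * g) = l (f * t.T₁ g) := by
  rw [← sub_eq_zero, ← map_sub, Params.T₁, heckeOp_symm one_ne_zero (Or.inl rfl), map_sub, map_smul,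
    sub_eq_zero]
  exact hl.T₁ _

theorem IsInvariant.T₀_symm (ht : t.Generic) (hl : t.IsInvariant l) (f g : Laurent) :
    l (t.T₀ f * g) = l (f * t.T₀ g) := by
  rw [← sub_eq_zero, ← map_sub, Params.T₀, heckeOp_symm ht.r_ne (Or.inr rfl), map_sub, map_smul,
    sub_eq_zero]
  exact hl.T₀ _

theorem IsInvariant.T₁inv_symm (ht : t.Generic) (hl : t.IsInvariant l) (f g : Laurent) :
    l (t.T₁inv f * g) = l (f * t.T₁inv g) := by
  conv_lhs => rw [← ht.T₁_T₁inv g, ← hl.T₁_symm, ht.T₁_T₁inv]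

theorem IsInvariant.invPairing_T₁ (ht : t.Generic) (hl : t.IsInvariant l) (f g : Laurent) :
    t.invPairing l (t.T₁ f) g = t.invPairing l f (t.T₁ g) := by
  rw [invPairing, invPairing, hl.T₁_symm, ht.T₁_T₁inv, ht.T₁inv_T₁]

theorem IsInvariant.invPairing_U (ht : t.Generic) (hl : t.IsInvariant l) (f g : Laurent) :
    t.invPairing l (t.U f) g = t.invPairing l f (t.U g) := by
  rw [invPairing, invPairing, ← hl.T₁inv_symm ht f, U_apply, U_apply, mul_assoc, mul_left_comm]

theorem invPairing_add_left (f f' g : Laurent) :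
    t.invPairing l (f + f') g = t.invPairing l f g + t.invPairing l f' g := by
  rw [invPairing, add_mul, map_add]; rfl

theorem invPairing_add_right (f g g' : Laurent) :
    t.invPairing l f (g + g') = t.invPairing l f g + t.invPairing l f g' := by
  rw [invPairing, map_add, mul_add, map_add]; rfl

theorem invPairing_smul_left (r : ℂ) (f g : Laurent) :
    t.invPairing l (r • f) g = r * t.invPairing l f g := by
  rw [invPairing, smul_mul_assoc, map_smul]; rfl

theorem invPairing_smul_right (r : ℂ) (f g : Laurent) :
    t.invPairing l f (r • g) = r * t.invPairing l f g := by
  rw [invPairing, map_smul, mul_smul_comm, map_smul]; rfl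

theorem IsInvariant.orthogonal (ht : t.Generic) (hl : t.IsInvariant l) {m n : ℤ} (hmn : m ≠ n) :
    t.invPairing l (t.E (t.eig m)) (t.E (t.eig n)) = 0 := by
  have h1 : t.invPairing l (t.Y (t.E (t.eig m))) (t.E (t.eig n)) =
      t.eig n * t.invPairing l (t.E (t.eig m)) (t.E (t.eig n)) := by
    rw [invPairing, Y_apply, hl.T₁_symm, ht.T₁_T₁inv, hl.T₀_symm ht,
      ht.T₀_eigen (E_isEigen ht n).eigen, mul_smul_comm, map_smul]
    rfl
  rw [(E_isEigen ht m).eigen, invPairing_smul_left, ← sub_eq_zero, ← sub_mul] at h1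
  exact (mul_eq_zero.mp h1).resolve_left (sub_ne_zero.mpr fun h => hmn (ht.eig_injective h))

/-- The quadratic norm of `E_{γ_m}`. -/
def sqNorm (t : Params) (l : Laurent →ₗ[ℂ] ℂ) (m : ℤ) : ℂ :=
  t.invPairing l (t.E (t.eig m)) (t.E (t.eig m))

theorem IsInvariant.sqNorm_neg (ht : t.Generic) (hl : t.IsInvariant l) {m : ℤ} (hm : m ≠ 0) :
    (t.k₁ - t.β (t.eig m)) * t.sqNorm l (-m) = (t.k₁ - t.β (t.eig (-m))) * t.sqNorm l m := by
  have h := hl.invPairing_T₁ ht (t.E (t.eig m)) (t.E (t.eig (-m)))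
  rw [T₁_E ht hm, T₁_E ht (neg_ne_zero.mpr hm), neg_neg] at h
  simpa only [sqNorm, invPairing_add_left, invPairing_add_right, invPairing_smul_left,
    invPairing_smul_right, hl.orthogonal ht (show m ≠ -m by omega), mul_zero, zero_add] using h

theorem IsInvariant.sqNorm_reflect (ht : t.Generic) (hl : t.IsInvariant l) (m : ℤ) :
    (t.u₁ - t.δ (t.eig m)) * t.sqNorm l (-m - 1) =
      (t.u₁ - t.δ (t.eig (-m - 1))) * t.sqNorm l m := by
  have h := hl.invPairing_U ht (t.E (t.eig m)) (t.E (t.eig (-m - 1)))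
  rw [U_E ht, U_E ht, show -(-m - 1) - 1 = m by ring] at h
  simpa only [sqNorm, invPairing_add_left, invPairing_add_right, invPairing_smul_left,
    invPairing_smul_right, hl.orthogonal ht (show m ≠ -m - 1 by omega), mul_zero, zero_add] using h

theorem Generic.sqNorm_zero (ht : t.Generic) : t.k₁ * t.sqNorm l 0 = l 1 := by
  rw [sqNorm, E_eig_zero ht, invPairing, one_mul, T₁inv_apply, T₁_one, ← sub_smul, map_smul,
    smul_eq_mul, sub_sub_cancel, mul_inv_cancel_left₀ ht.k₁_ne]

theorem IsInvariant.eq_zero (ht : t.Generic) (hl : t.IsInvariant l) (h1 : l 1 = 0) : l = 0 := by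
  refine (eigbasis ht).ext fun m => ?_
  rw [eigbasis_apply, ← E_eig, LinearMap.zero_apply]
  rcases eq_or_ne m 0 with rfl | hm
  · rw [E_eig_zero ht, h1]
  · have h := congrArg l (E_isEigen ht m).eigen
    have h2 : t.eig 0 = t.k₁ * t.k₀ := by
      rw [eig_of_nonneg t le_rfl, zpow_zero, mul_one, mul_comm]
    rw [Y_apply, hl.T₁, hl.T₀, ← mul_assoc, ← h2, map_smul, smul_eq_mul, ← sub_eq_zero,
      ← sub_mul] at h
    exact (mul_eq_zero.mp h).resolve_left
      (sub_ne_zero.mpr fun h => hm (ht.eig_injective h.symm))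

end Params

end AskeyWilson
end

open scoped LaurentPolynomial

noncomputable section

namespace AskeyWilson

open MeasureTheory Filter Topology Set

/-! ### Integrals along closed Lipschitz curves -/

/-- A closed curve in a Lipschitz parametrization. -/
structure IsLoop (Γ : ℝ → ℂ) : Prop where
  lipschitz : ∃ K, LipschitzOnWith K Γ (Icc 0 1)
  closed : Γ 0 = Γ 1

/-- The image of the curve. -/
abbrev trace (Γ : ℝ → ℂ) : Set ℂ := Γ '' Icc 0 1

variable {Γ Γ₁ Γ₂ : ℝ → ℂ} {F G : ℂ → ℂ}

theorem IsLoop.continuousOn (h : IsLoop Γ) : ContinuousOn Γ (Icc 0 1) :=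
  h.lipschitz.choose_spec.continuousOn

theorem IsLoop.isCompact (h : IsLoop Γ) : IsCompact (trace Γ) :=
  isCompact_Icc.image_of_continuousOn h.continuousOn

theorem IsLoop.ae_differentiableAt (h : IsLoop Γ) :
    ∀ᵐ s : ℝ, s ∈ Ioo (0 : ℝ) 1 → DifferentiableAt ℝ Γ s := by
  obtain ⟨K, hK⟩ := h.lipschitz
  filter_upwards [hK.ae_differentiableWithinAt_of_mem_real] with s hs hs'
  exact (hs (Ioo_subset_Icc_self hs')).differentiableAt (Icc_mem_nhds hs'.1 hs'.2)

theorem IsLoop.norm_deriv_le (h : IsLoop Γ) : ∃ K : ℝ, ∀ s ∈ Ioo (0 : ℝ) 1, ‖deriv Γ s‖ ≤ K := by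
  obtain ⟨K, hK⟩ := h.lipschitz
  exact ⟨K, fun s hs => norm_deriv_le_of_lipschitzOn (Icc_mem_nhds hs.1 hs.2) hK⟩

theorem ae_mem_Ioo_of_uIoc : ∀ᵐ s : ℝ, s ∈ uIoc (0 : ℝ) 1 → s ∈ Ioo (0 : ℝ) 1 := by
  filter_upwards [compl_mem_ae_iff.mpr (measure_singleton (1 : ℝ))] with s hs hs'
  rw [uIoc_of_le zero_le_one] at hs'
  exact ⟨hs'.1, lt_of_le_of_ne hs'.2 hs⟩

theorem IsLoop.intervalIntegrable_deriv (h : IsLoop Γ) :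
    IntervalIntegrable (deriv Γ) volume 0 1 := by
  obtain ⟨K, hK⟩ := h.norm_deriv_le
  refine (intervalIntegrable_const (c := K)).mono_fun (measurable_deriv Γ).aestronglyMeasurable ?_
  filter_upwards [ae_restrict_of_ae ae_mem_Ioo_of_uIoc, ae_restrict_mem measurableSet_uIoc]
    with s hs hs'
  exact (hK s (hs hs')).trans (Real.le_norm_self K)

theorem IsLoop.intervalIntegrable (h : IsLoop Γ) (hF : ContinuousOn F (trace Γ)) :
    IntervalIntegrable (fun s => F (Γ s) * deriv Γ s) volume 0 1 := by
  refine h.intervalIntegrable_deriv.continuousOn_mul ?_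
  rw [uIcc_of_le zero_le_one]
  exact hF.comp h.continuousOn (mapsTo_image _ _)

theorem curveInt_congr (h : EqOn F G (trace Γ)) : curveInt Γ F = curveInt Γ G := by
  unfold curveInt
  congr 1
  refine intervalIntegral.integral_congr fun s hs => ?_
  rw [uIcc_of_le zero_le_one] at hs
  simp only [h (mem_image_of_mem Γ hs)]

theorem IsLoop.curveInt_add (h : IsLoop Γ) (hF : ContinuousOn F (trace Γ))
    (hG : ContinuousOn G (trace Γ)) :
    curveInt Γ (fun x => F x + G x) = curveInt Γ F + curveInt Γ G := by
  unfold curveInt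
  rw [← mul_add, ← intervalIntegral.integral_add (h.intervalIntegrable hF) (h.intervalIntegrable hG)]
  simp only [add_mul]

theorem curveInt_const_mul (r : ℂ) (F : ℂ → ℂ) :
    curveInt Γ (fun x => r * F x) = r * curveInt Γ F := by
  unfold curveInt
  have h : ∫ s in (0 : ℝ)..1, r * F (Γ s) * deriv Γ s =
      r * ∫ s in (0 : ℝ)..1, F (Γ s) * deriv Γ s := by
    rw [← intervalIntegral.integral_const_mul]
    simp only [mul_assoc]
  rw [h, mul_left_comm]

/-- The integral of a function with a primitive along a closed curve vanishes. -/
theorem IsLoop.curveInt_eq_zero (h : IsLoop Γ) {Φ : ℂ → ℂ} {U : Set ℂ} (hU : IsOpen U)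
    (hΓ : trace Γ ⊆ U) (hΦ : ∀ z ∈ U, HasDerivAt Φ (F z) z) : curveInt Γ F = 0 := by
  have hΦd : DifferentiableOn ℂ Φ U := fun z hz =>
    (hΦ z hz).differentiableAt.differentiableWithinAt
  have hFc : ContinuousOn F (trace Γ) := by
    have h1 : ContinuousOn (deriv Φ) U := ((hΦd.analyticOnNhd hU).deriv).continuousOn
    exact (h1.congr fun z hz => ((hΦ z hz).deriv).symm).mono hΓ
  obtain ⟨K, hK⟩ := h.lipschitz
  obtain ⟨K', hK'⟩ : ∃ K', LipschitzOnWith K' Φ (trace Γ) := by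
    refine LocallyLipschitzOn.exists_lipschitzOnWith_of_compact h.isCompact fun z hz => ?_
    have h1 : ContDiffAt ℂ 1 Φ z := ((hΦd.analyticOnNhd hU) z (hΓ hz)).contDiffAt
    obtain ⟨C, t, ht, hC⟩ := h1.exists_lipschitzOnWith
    exact ⟨C, t, mem_nhdsWithin_of_mem_nhds ht, hC⟩
  have hg : LipschitzOnWith (K' * K) (Φ ∘ Γ) (uIcc 0 1) := by
    rw [uIcc_of_le zero_le_one]
    exact hK'.comp hK (mapsTo_image _ _)
  have hd : ∀ᵐ s : ℝ, s ∈ uIoc (0 : ℝ) 1 → HasDerivAt (Φ ∘ Γ) (F (Γ s) * deriv Γ s) s := by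
    filter_upwards [h.ae_differentiableAt, ae_mem_Ioo_of_uIoc] with s hs hs' hs''
    have h1 := hs' hs''
    exact (hΦ (Γ s) (hΓ ⟨s, Ioo_subset_Icc_self h1, rfl⟩)).comp_of_eq s (hs h1).hasDerivAt rfl
  have key : ∀ L : ℂ →L[ℝ] ℝ, L (∫ s in (0 : ℝ)..1, F (Γ s) * deriv Γ s) = 0 := by
    intro L
    have h1 : AbsolutelyContinuousOnInterval (L ∘ Φ ∘ Γ) 0 1 :=
      (L.lipschitz.comp_lipschitzOnWith hg).absolutelyContinuousOnInterval
    have h2 := h1.integral_deriv_eq_sub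
    rw [Function.comp_apply, Function.comp_apply, Function.comp_apply, Function.comp_apply,
      h.closed, sub_self] at h2
    have h3 : ∫ s in (0 : ℝ)..1, L (F (Γ s) * deriv Γ s) =
        ∫ s in (0 : ℝ)..1, deriv (L ∘ Φ ∘ Γ) s := by
      refine intervalIntegral.integral_congr_ae ?_
      filter_upwards [hd] with s hs hs'
      have h4 : HasFDerivAt (fun z : ℂ => L z) L ((Φ ∘ Γ) s) := L.hasFDerivAt
      exact ((h4.comp_hasDerivAt s (hs hs')).deriv).symm
    rw [← L.intervalIntegral_comp_comm (h.intervalIntegrable hFc), h3, h2]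
  unfold curveInt
  have : (∫ s in (0 : ℝ)..1, F (Γ s) * deriv Γ s) = 0 :=
    Complex.ext (key Complex.reCLM) (key Complex.imCLM)
  rw [this, mul_zero]

/-- Integration along a curve commutes with uniform limits. -/
theorem IsLoop.tendsto_curveInt (h : IsLoop Γ) {f : ℕ → ℂ → ℂ}
    (hf : ∀ n, ContinuousOn (f n) (trace Γ)) (hlim : TendstoUniformlyOn f F atTop (trace Γ)) :
    Tendsto (fun n => curveInt Γ (f n)) atTop (𝓝 (curveInt Γ F)) := by
  refine Tendsto.const_mul _ ?_
  obtain ⟨K, hK⟩ := h.norm_deriv_le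
  have hFc : ContinuousOn F (trace Γ) := hlim.continuousOn (Frequently.of_forall hf)
  obtain ⟨C, hC⟩ := h.isCompact.exists_bound_of_continuousOn hFc
  refine intervalIntegral.tendsto_integral_filter_of_dominated_convergence
    (fun _ => (C + 1) * |K|) ?_ ?_ intervalIntegrable_const ?_
  · exact Eventually.of_forall fun n =>
      ((intervalIntegrable_iff.mp (h.intervalIntegrable (hf n))).aestronglyMeasurable)
  · filter_upwards [Metric.tendstoUniformlyOn_iff.mp hlim 1 one_pos] with n hn
    filter_upwards [ae_mem_Ioo_of_uIoc] with s hs hs'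
    have h1 := hs hs'
    have h2 : Γ s ∈ trace Γ := ⟨s, Ioo_subset_Icc_self h1, rfl⟩
    rw [norm_mul]
    have h3 := hn _ h2
    rw [dist_eq_norm, norm_sub_rev] at h3
    have h4 : ‖f n (Γ s)‖ ≤ C + 1 := by
      have := norm_le_norm_add_norm_sub' (f n (Γ s)) (F (Γ s))
      have := hC _ h2
      linarith
    exact mul_le_mul h4 ((hK s h1).trans (le_abs_self K)) (norm_nonneg _)
      ((norm_nonneg _).trans h4)
  · refine Eventually.of_forall fun s hs => ?_
    rw [uIoc_of_le zero_le_one] at hs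
    exact (hlim.tendsto_at ⟨s, Ioc_subset_Icc_self hs, rfl⟩).mul_const _

/-- The integrals along two curves are proportional with factor `ε`. -/
def RelInt (Γ₁ Γ₂ : ℝ → ℂ) (ε : ℂ) (F : ℂ → ℂ) : Prop := curveInt Γ₁ F = ε * curveInt Γ₂ F

variable {ε : ℂ}

theorem RelInt.congr (hF : RelInt Γ₁ Γ₂ ε F) (h : EqOn G F (trace Γ₁ ∪ trace Γ₂)) :
    RelInt Γ₁ Γ₂ ε G := by
  rw [RelInt, curveInt_congr (h.mono subset_union_left), curveInt_congr (h.mono subset_union_right)]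
  exact hF

theorem RelInt.add (h₁ : IsLoop Γ₁) (h₂ : IsLoop Γ₂) (hF : RelInt Γ₁ Γ₂ ε F)
    (hG : RelInt Γ₁ Γ₂ ε G) (hFc : ContinuousOn F (trace Γ₁ ∪ trace Γ₂))
    (hGc : ContinuousOn G (trace Γ₁ ∪ trace Γ₂)) : RelInt Γ₁ Γ₂ ε (fun x => F x + G x) := by
  rw [RelInt, h₁.curveInt_add (hFc.mono subset_union_left) (hGc.mono subset_union_left),
    h₂.curveInt_add (hFc.mono subset_union_right) (hGc.mono subset_union_right), hF, hG, mul_add]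

theorem RelInt.const_mul (r : ℂ) (hF : RelInt Γ₁ Γ₂ ε F) :
    RelInt Γ₁ Γ₂ ε (fun x => r * F x) := by
  rw [RelInt, curveInt_const_mul, curveInt_const_mul, hF]; ring

theorem RelInt.of_primitive (h₁ : IsLoop Γ₁) (h₂ : IsLoop Γ₂) {Φ : ℂ → ℂ} {U : Set ℂ}
    (hU : IsOpen U) (hΓ : trace Γ₁ ∪ trace Γ₂ ⊆ U) (hΦ : ∀ z ∈ U, HasDerivAt Φ (F z) z) :
    RelInt Γ₁ Γ₂ ε F := by
  rw [RelInt, h₁.curveInt_eq_zero hU (subset_union_left.trans hΓ) hΦ,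
    h₂.curveInt_eq_zero hU (subset_union_right.trans hΓ) hΦ, mul_zero]

theorem RelInt.of_tendsto (h₁ : IsLoop Γ₁) (h₂ : IsLoop Γ₂) {f : ℕ → ℂ → ℂ}
    (hf : ∀ n, ContinuousOn (f n) (trace Γ₁ ∪ trace Γ₂))
    (hlim : TendstoUniformlyOn f F atTop (trace Γ₁ ∪ trace Γ₂))
    (h : ∀ n, RelInt Γ₁ Γ₂ ε (f n)) : RelInt Γ₁ Γ₂ ε F :=
  tendsto_nhds_unique
    ((h₁.tendsto_curveInt (fun n => (hf n).mono subset_union_left)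
      (hlim.mono subset_union_left)).congr h)
    ((h₂.tendsto_curveInt (fun n => (hf n).mono subset_union_right)
      (hlim.mono subset_union_right)).const_mul ε)

theorem relInt_polynomial (h₁ : IsLoop Γ₁) (h₂ : IsLoop Γ₂) (P : Polynomial ℂ) :
    RelInt Γ₁ Γ₂ ε (fun x => P.eval x) := by
  induction P using Polynomial.induction_on' with
  | add p q hp hq =>
    simp only [Polynomial.eval_add]
    exact hp.add h₁ h₂ hq p.continuous.continuousOn q.continuous.continuousOn
  | monomial n a =>
    simp only [Polynomial.eval_monomial]
    refine RelInt.const_mul a (RelInt.of_primitive h₁ h₂ (Φ := fun x => x ^ (n + 1) / (n + 1))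
      isOpen_univ (subset_univ _) fun z _ => ?_)
    have hn : (n + 1 : ℂ) ≠ 0 := by exact_mod_cast n.succ_ne_zero
    refine ((hasDerivAt_pow (n + 1) z).div_const (n + 1 : ℂ)).congr_deriv ?_
    rw [Nat.add_sub_cancel]
    push_cast
    field_simp

/-- The product of the simple fractions with poles in a multiset. -/
def fracProd (L : Multiset ℂ) (x : ℂ) : ℂ := (L.map fun z => (x - z)⁻¹).prod

theorem fracProd_cons (z : ℂ) (L : Multiset ℂ) (x : ℂ) :
    fracProd (z ::ₘ L) x = (x - z)⁻¹ * fracProd L x := by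
  simp [fracProd]

theorem continuousOn_fracProd {S : Set ℂ} (L : Multiset ℂ) (hL : ∀ z ∈ L, z ∉ S) :
    ContinuousOn (fracProd L) S := by
  induction L using Multiset.induction_on with
  | empty => exact (continuousOn_const (c := (1 : ℂ))).congr fun x _ => by simp [fracProd]
  | cons z L ih =>
    simp only [Multiset.mem_cons, forall_eq_or_imp] at hL
    refine ContinuousOn.congr (f := fun x => (x - z)⁻¹ * fracProd L x) ?_
      fun x _ => fracProd_cons z L x
    refine ContinuousOn.mul (ContinuousOn.inv₀ (by fun_prop) fun x hx h => hL.1 ?_) (ih hL.2)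
    rwa [← sub_eq_zero.mp h]

/-- For a rational function, the integrals are proportional as soon as the winding numbers around
its poles are. -/
theorem relInt_rational (h₁ : IsLoop Γ₁) (h₂ : IsLoop Γ₂) (L : Multiset ℂ)
    (hL : ∀ z ∈ L, z ∉ trace Γ₁ ∪ trace Γ₂)
    (hw : ∀ z ∈ L, RelInt Γ₁ Γ₂ ε fun x => (x - z)⁻¹) (P : Polynomial ℂ) :
    RelInt Γ₁ Γ₂ ε (fun x => P.eval x * fracProd L x) := by
  obtain ⟨n, hn⟩ : ∃ n, L.card = n := ⟨_, rfl⟩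
  induction n generalizing L P with
  | zero =>
    rw [Multiset.card_eq_zero] at hn
    subst hn
    simpa [fracProd] using relInt_polynomial h₁ h₂ P
  | succ n ih =>
    obtain ⟨z, L, rfl⟩ : ∃ z L', L = z ::ₘ L' := by
      obtain ⟨z, hz⟩ := Multiset.card_pos_iff_exists_mem.mp (by omega : 0 < L.card)
      exact ⟨z, Multiset.exists_cons_of_mem hz⟩
    have hcard : L.card = n := by simpa using hn
    simp only [Multiset.mem_cons, forall_eq_or_imp] at hL hw
    have hone : RelInt Γ₁ Γ₂ ε (fracProd (z ::ₘ L)) := by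
      by_cases hall : ∀ w ∈ L, w = z
      · rw [Multiset.eq_replicate.mpr ⟨hcard, hall⟩, ← Multiset.replicate_succ]
        have e : ∀ k : ℕ, fracProd (Multiset.replicate k z) = fun x => ((x - z) ^ k)⁻¹ := by
          intro k; ext x; simp [fracProd]
        rw [e]
        rcases n with _ | n
        · simpa using hw.1
        · refine RelInt.of_primitive h₁ h₂
            (Φ := fun x => ((x - z) ^ (n + 1))⁻¹ / (-(n + 1))) (U := {z}ᶜ)
            isOpen_compl_singleton (fun x hx hxz => hL.1 (hxz ▸ hx)) fun x hx => ?_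
          have hxz : x - z ≠ 0 := sub_ne_zero.mpr hx
          have hn : (n + 1 : ℂ) ≠ 0 := by exact_mod_cast n.succ_ne_zero
          have h3 := ((((hasDerivAt_id x).sub_const z).pow (n + 1)).inv
            (pow_ne_zero _ hxz)).div_const (-(n + 1) : ℂ)
          refine h3.congr_deriv ?_
          simp only [id, Nat.add_sub_cancel, Pi.pow_apply]
          push_cast
          field_simp
          ring
      · push Not at hall
        obtain ⟨w, hwL, hwz⟩ := hall
        obtain ⟨L, rfl⟩ := Multiset.exists_cons_of_mem hwL
        simp only [Multiset.mem_cons, forall_eq_or_imp] at hL hw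
        have hcard' : L.card + 1 = n := by simpa using hcard
        have i1 := ih (z ::ₘ L) (by simpa only [Multiset.mem_cons, forall_eq_or_imp] using ⟨hL.1, hL.2.2⟩) (by simpa only [Multiset.mem_cons, forall_eq_or_imp] using ⟨hw.1, hw.2.2⟩) 1
          (by simpa using hcard')
        have i2 := ih (w ::ₘ L) (by simpa only [Multiset.mem_cons, forall_eq_or_imp] using hL.2) (by simpa only [Multiset.mem_cons, forall_eq_or_imp] using hw.2) (-1)
          (by simpa using hcard')
        have c1 := continuousOn_fracProd (S := trace Γ₁ ∪ trace Γ₂) (z ::ₘ L)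
          (by simpa only [Multiset.mem_cons, forall_eq_or_imp] using ⟨hL.1, hL.2.2⟩)
        have c2 := continuousOn_fracProd (S := trace Γ₁ ∪ trace Γ₂) (w ::ₘ L)
          (by simpa only [Multiset.mem_cons, forall_eq_or_imp] using hL.2)
        refine ((i1.add h₁ h₂ i2 (by simpa using c1)
          (by simpa using ContinuousOn.fun_neg c2)).const_mul
          (z - w)⁻¹).congr fun x hx => ?_
        have hxz : x - z ≠ 0 := sub_ne_zero.mpr fun h => hL.1 (h ▸ hx)
        have hxw : x - w ≠ 0 := sub_ne_zero.mpr fun h => hL.2.1 (h ▸ hx)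
        have hzw : z - w ≠ 0 := sub_ne_zero.mpr hwz.symm
        simp only [fracProd_cons, Polynomial.eval_one, Polynomial.eval_neg]
        field_simp
        ring
    have hQ := ih L hL.2 hw.2 (P /ₘ (Polynomial.X - Polynomial.C z)) hcard
    refine (hQ.add h₁ h₂ (hone.const_mul (P.eval z))
      ((Polynomial.continuous _).continuousOn.mul (continuousOn_fracProd L hL.2))
      (continuousOn_const.mul (continuousOn_fracProd (z ::ₘ L)
        (by simpa only [Multiset.mem_cons, forall_eq_or_imp] using hL)))).congr fun x hx => ?_
    have hxz : x - z ≠ 0 := sub_ne_zero.mpr fun h => hL.1 (h ▸ hx)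
    have h5 := congrArg (Polynomial.eval x)
      (Polynomial.modByMonic_add_div P (Polynomial.X - Polynomial.C z))
    rw [Polynomial.modByMonic_X_sub_C_eq_C_eval] at h5
    simp only [Polynomial.eval_add, Polynomial.eval_mul, Polynomial.eval_sub, Polynomial.eval_X,
      Polynomial.eval_C] at h5
    simp only [fracProd_cons]
    rw [← h5]
    field_simp
    ring

/-! ### Inversion of curves and the unit circle -/

theorem IsLoop.inversion (h : IsLoop Γ) (h0 : 0 ∉ trace Γ) (p : ℂ) :
    IsLoop fun s => p * (Γ s)⁻¹ where
  lipschitz := by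
    obtain ⟨K, hK⟩ := h.lipschitz
    obtain ⟨K', hK'⟩ : ∃ K', LipschitzOnWith K' (fun x : ℂ => p * x⁻¹) (trace Γ) := by
      refine LocallyLipschitzOn.exists_lipschitzOnWith_of_compact h.isCompact fun z hz => ?_
      have hz0 : z ≠ 0 := fun h => h0 (h ▸ hz)
      have h1 : ContDiffAt ℂ 1 (fun x : ℂ => p * x⁻¹) z := by fun_prop (disch := exact hz0)
      obtain ⟨C, t, ht, hC⟩ := h1.exists_lipschitzOnWith
      exact ⟨C, t, mem_nhdsWithin_of_mem_nhds ht, hC⟩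
    exact ⟨_, hK'.comp hK (mapsTo_image _ _)⟩
  closed := by simp only [h.closed]

theorem IsLoop.curveInt_inversion (h : IsLoop Γ) (h0 : 0 ∉ trace Γ) (p : ℂ) (F : ℂ → ℂ) :
    curveInt (fun s => p * (Γ s)⁻¹) F =
      curveInt Γ (fun x => -(F (p * x⁻¹) * p * x⁻¹ ^ 2)) := by
  unfold curveInt
  congr 1
  refine intervalIntegral.integral_congr_ae ?_
  filter_upwards [h.ae_differentiableAt, ae_mem_Ioo_of_uIoc] with s hs hs' hs''
  have h1 := hs' hs''
  have h2 : Γ s ≠ 0 := fun h => h0 (h ▸ ⟨s, Ioo_subset_Icc_self h1, rfl⟩)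
  have h3 := (((hs h1).hasDerivAt.fun_inv h2).const_mul p).deriv
  rw [h3]
  field_simp

/-- The unit circle. -/
def unitCircle (s : ℝ) : ℂ := circleMap 0 1 (2 * Real.pi * s)

theorem isLoop_unitCircle : IsLoop unitCircle where
  lipschitz := by
    refine ⟨_, LipschitzWith.lipschitzOnWith
      ((lipschitzWith_circleMap 0 1).comp (lipschitzWith_smul (2 * Real.pi)))⟩
  closed := by simp [unitCircle, circleMap]

theorem trace_unitCircle_subset : trace unitCircle ⊆ Metric.sphere 0 1 := by
  rintro _ ⟨s, _, rfl⟩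
  exact circleMap_mem_sphere 0 zero_le_one _

theorem curveInt_unitCircle (F : ℂ → ℂ) :
    curveInt unitCircle F = (2 * Real.pi * Complex.I)⁻¹ * ∮ x in C(0, 1), F x := by
  unfold curveInt circleIntegral
  congr 1
  have h := intervalIntegral.smul_integral_comp_mul_left (a := 0) (b := 1)
    (fun θ => deriv (circleMap 0 1) θ • F (circleMap 0 1 θ)) (2 * Real.pi)
  rw [mul_zero, mul_one] at h
  rw [← h, ← intervalIntegral.integral_smul]
  refine intervalIntegral.integral_congr fun s _ => ?_
  have h1 : HasDerivAt unitCircle _ s :=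
    HasDerivAt.scomp s (hasDerivAt_circleMap 0 1 (2 * Real.pi * s))
      ((hasDerivAt_id s).const_mul (2 * Real.pi))
  rw [h1.deriv, deriv_circleMap]
  simp only [smul_eq_mul, mul_one, unitCircle, Complex.real_smul]
  ring

theorem curveInt_unitCircle_of_inside {w : ℂ} (hw : ‖w‖ < 1) :
    curveInt unitCircle (fun x => (x - w)⁻¹) = 1 := by
  rw [curveInt_unitCircle, circleIntegral.integral_sub_inv_of_mem_ball (by simpa using hw)]
  exact inv_mul_cancel₀ Complex.two_pi_I_ne_zero

theorem curveInt_unitCircle_of_outside {w : ℂ} (hw : 1 < ‖w‖) :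
    curveInt unitCircle (fun x => (x - w)⁻¹) = 0 := by
  rw [curveInt_unitCircle]
  have : ∮ x in C(0, 1), (x - w)⁻¹ = 0 := by
    refine Complex.circleIntegral_eq_zero_of_differentiable_on_off_countable zero_le_one
      Set.countable_empty ?_ ?_
    · refine ContinuousOn.inv₀ (by fun_prop) fun x hx h => ?_
      rw [mem_closedBall_zero_iff, sub_eq_zero.mp h] at hx
      linarith
    · intro x hx
      have : x - w ≠ 0 := fun h => by
        have := hx.1
        rw [mem_ball_zero_iff, sub_eq_zero.mp h] at this
        linarith
      fun_prop (disch := exact this)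
  rw [this, mul_zero]

end AskeyWilson
end

open scoped LaurentPolynomial

noncomputable section

namespace AskeyWilson

open MeasureTheory Filter Topology Set

/-! ### The infinite `q`-shifted factorial -/

section QPoch

variable {q : ℂ}

theorem summable_qPoch (hq : ‖q‖ < 1) (a : ℂ) : Summable fun k : ℕ => ‖-(a * q ^ k)‖ := by
  simp only [norm_neg, norm_mul, norm_pow]
  exact (summable_geometric_of_lt_one (norm_nonneg q) hq).mul_left _

theorem tendsto_qPoch_uniformly (hq : ‖q‖ < 1) {X : Set ℂ} (hX : IsCompact X) {g : ℂ → ℂ}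
    (hg : ContinuousOn g X) :
    TendstoUniformlyOn (fun (N : ℕ) x => ∏ j ∈ Finset.range N, (1 - g x * q ^ j))
      (fun x => qPochInf (g x) q) atTop X := by
  obtain ⟨C, hC⟩ := hX.exists_bound_of_continuousOn hg
  have h := Summable.hasProdUniformlyOn_nat_one_add (f := fun k x => -(g x * q ^ k)) hX
    (u := fun k => C * ‖q‖ ^ k)
    ((summable_geometric_of_lt_one (norm_nonneg q) hq).mul_left _)
    (Eventually.of_forall fun k x hx => by
      rw [norm_neg, norm_mul, norm_pow]
      exact mul_le_mul_of_nonneg_right (hC x hx) (by positivity))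
    (fun k => by fun_prop)
  simpa only [sub_eq_add_neg, qPochInf] using h.tendstoUniformlyOn_finsetRange

theorem continuous_qPochInf (hq : ‖q‖ < 1) : Continuous fun a => qPochInf a q := by
  rw [continuous_iff_continuousAt]
  intro a
  have h := (tendsto_qPoch_uniformly hq (isCompact_closedBall a 1) continuousOn_id).continuousOn
    (Frequently.of_forall fun N => by fun_prop)
  exact h.continuousAt (Metric.closedBall_mem_nhds a one_pos)

theorem differentiable_qPochInf (hq : ‖q‖ < 1) : Differentiable ℂ fun a => qPochInf a q := by
  intro a
  have h := ((tendsto_qPoch_uniformly hq (isCompact_closedBall a 1) continuousOn_id).mono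
    Metric.ball_subset_closedBall).tendstoLocallyUniformlyOn.differentiableOn
    (Eventually.of_forall fun N => by
      refine DifferentiableOn.fun_finsetProd fun j _ => ?_
      simp only [id]
      fun_prop) Metric.isOpen_ball
  exact h.differentiableAt (Metric.ball_mem_nhds a one_pos)

theorem qPochInf_ne_zero (hq : ‖q‖ < 1) {a : ℂ} (h : ∀ k : ℕ, a * q ^ k ≠ 1) :
    qPochInf a q ≠ 0 := by
  have := tprod_one_add_ne_zero_of_summable (f := fun k : ℕ => -(a * q ^ k))
    (fun k => by rw [← sub_eq_add_neg]; exact sub_ne_zero.mpr (h k).symm) (summable_qPoch hq a)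
  simpa only [sub_eq_add_neg, qPochInf] using this

theorem qPochInf_eq (hq : ‖q‖ < 1) (a : ℂ) :
    qPochInf a q = (1 - a) * qPochInf (q * a) q := by
  have hm : ∀ a : ℂ, Multipliable fun k : ℕ => 1 - a * q ^ k := fun a => by
    simpa only [sub_eq_add_neg] using multipliable_one_add_of_summable (summable_qPoch hq a)
  have e : (fun k : ℕ => 1 - a * q ^ (k + 1)) = fun k => 1 - q * a * q ^ k := by
    funext k; ring
  unfold qPochInf
  rw [tprod_eq_zero_mul' (by rw [e]; exact hm _), e, pow_zero, mul_one]

theorem qPochInf_eq_prod (hq : ‖q‖ < 1) (a : ℂ) (M : ℕ) :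
    qPochInf a q = (∏ j ∈ Finset.range M, (1 - a * q ^ j)) * qPochInf (a * q ^ M) q := by
  induction M with
  | zero => simp
  | succ M ih =>
    rw [ih, Finset.prod_range_succ, qPochInf_eq hq (a * q ^ M)]
    rw [show q * (a * q ^ M) = a * q ^ (M + 1) by ring]
    ring

end QPoch

/-! ### Limits of rational functions with prescribed poles -/

/-- `F` agrees on `X` with a rational function whose poles lie in `S`. -/
def IsRat (S X : Set ℂ) (F : ℂ → ℂ) : Prop :=
  ∃ (P : Polynomial ℂ) (L : Multiset ℂ), (∀ z ∈ L, z ∈ S) ∧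
    EqOn F (fun x => P.eval x * fracProd L x) X

/-- `F` is on `X` a locally uniform limit of rational functions with poles in `S`. -/
def IsLimRat (S X : Set ℂ) (F : ℂ → ℂ) : Prop :=
  ContinuousOn F X ∧ ∃ f : ℕ → ℂ → ℂ, (∀ n, IsRat S X (f n)) ∧
    TendstoLocallyUniformlyOn f F atTop X

section Rat

variable {S X : Set ℂ} {F G : ℂ → ℂ}

theorem IsRat.mul (hF : IsRat S X F) (hG : IsRat S X G) : IsRat S X fun x => F x * G x := by
  obtain ⟨P, L, hL, hP⟩ := hF
  obtain ⟨P', L', hL', hP'⟩ := hG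
  refine ⟨P * P', L + L', fun z hz => (Multiset.mem_add.mp hz).elim (hL z) (hL' z), fun x hx => ?_⟩
  simp only [hP hx, hP' hx, Polynomial.eval_mul, fracProd, Multiset.map_add, Multiset.prod_add]
  ring

theorem IsRat.congr (hF : IsRat S X F) (h : EqOn G F X) : IsRat S X G := by
  obtain ⟨P, L, hL, hP⟩ := hF
  exact ⟨P, L, hL, h.trans hP⟩

theorem isRat_polynomial (P : Polynomial ℂ) : IsRat S X fun x => P.eval x :=
  ⟨P, 0, by simp, fun x _ => by simp [fracProd]⟩

theorem isRat_const (r : ℂ) : IsRat S X fun _ => r := by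
  simpa using isRat_polynomial (S := S) (X := X) (Polynomial.C r)

theorem isRat_id : IsRat S X fun x => x := by
  simpa using isRat_polynomial (S := S) (X := X) Polynomial.X

theorem isRat_frac {z : ℂ} (hz : z ∈ S) : IsRat S X fun x => (x - z)⁻¹ :=
  ⟨1, {z}, by simpa using hz, fun x _ => by simp [fracProd]⟩

theorem isRat_inv (h0 : (0 : ℂ) ∈ S) : IsRat S X fun x => x⁻¹ := by
  simpa using isRat_frac (X := X) h0

theorem IsRat.pow (hF : IsRat S X F) (n : ℕ) : IsRat S X fun x => F x ^ n := by
  induction n with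
  | zero => simpa using isRat_const 1
  | succ n ih => simpa only [pow_succ] using ih.mul hF

theorem IsRat.prod {f : ℕ → ℂ → ℂ} (hf : ∀ j, IsRat S X (f j)) (N : ℕ) :
    IsRat S X fun x => ∏ j ∈ Finset.range N, f j x := by
  induction N with
  | zero => simpa using isRat_const 1
  | succ N ih => simpa only [Finset.prod_range_succ] using ih.mul (hf N)

theorem isRat_ev (h0 : (0 : ℂ) ∈ S) (hX : Disjoint S X) (f : Laurent) : IsRat S X (ev f) := by
  obtain ⟨n, p, hp⟩ := LaurentPolynomial.exists_T_pow f
  refine ((isRat_polynomial p).mul ((isRat_inv h0).pow n)).congr fun x hx => ?_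
  have hx0 : x ≠ 0 := fun h => hX.le_bot ⟨h0, h ▸ hx⟩
  have h := congrArg (fun F => ev F x) hp
  simp only [ev_mul _ _ hx0, ev_T] at h
  rw [ev_eq_eval₂ _ hx0, LaurentPolynomial.eval₂_toLaurent] at h
  have h' : p.eval x = ev f x * x ^ n := by
    simpa [Polynomial.eval₂_eq_eval_map] using h
  simp only [h', inv_pow]
  rw [mul_inv_cancel_right₀ (pow_ne_zero n hx0)]

theorem IsRat.continuousOn (hX : Disjoint S X) (hF : IsRat S X F) : ContinuousOn F X := by
  obtain ⟨P, L, hL, hP⟩ := hF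
  exact ((Polynomial.continuous P).continuousOn.mul (continuousOn_fracProd L fun z hz hzX =>
    hX.le_bot ⟨hL z hz, hzX⟩)).congr hP

theorem IsRat.isLimRat (hX : Disjoint S X) (hF : IsRat S X F) : IsLimRat S X F :=
  ⟨hF.continuousOn hX, fun _ => F, fun _ => hF, fun _ hu _ _ =>
    ⟨univ, univ_mem, Eventually.of_forall fun _ _ _ => refl_mem_uniformity hu⟩⟩

theorem IsLimRat.mul (hF : IsLimRat S X F) (hG : IsLimRat S X G) :
    IsLimRat S X fun x => F x * G x := by
  obtain ⟨hFc, f, hf, hlim⟩ := hF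
  obtain ⟨hGc, g, hg, hlim'⟩ := hG
  exact ⟨hFc.mul hGc, fun n x => f n x * g n x, fun n => (hf n).mul (hg n),
    hlim.mul₀ hlim' hFc hGc⟩

theorem IsLimRat.congr (hF : IsLimRat S X F) (h : EqOn G F X) : IsLimRat S X G := by
  obtain ⟨hFc, f, hf, hlim⟩ := hF
  exact ⟨hFc.congr h, f, hf, hlim.congr_right h.symm⟩

theorem IsLimRat.prod {n : ℕ} (hX : Disjoint S X) {f : Fin n → ℂ → ℂ}
    (hf : ∀ i, IsLimRat S X (f i)) : IsLimRat S X fun x => ∏ i, f i x := by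
  induction n with
  | zero => simpa using (isRat_const 1).isLimRat hX
  | succ n ih =>
    simp only [Fin.prod_univ_succ]
    exact (hf 0).mul (ih fun i => hf i.succ)

variable {q : ℂ} {g : ℂ → ℂ}

theorem isLimRat_qPochInf (hq : ‖q‖ < 1) (hXc : IsCompact X) (hg : ContinuousOn g X)
    (hr : ∀ j : ℕ, IsRat S X fun x => 1 - g x * q ^ j) :
    IsLimRat S X fun x => qPochInf (g x) q :=
  ⟨(continuous_qPochInf hq).comp_continuousOn hg, _, fun N => IsRat.prod hr N,
    (tendsto_qPoch_uniformly hq hXc hg).tendstoLocallyUniformlyOn⟩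

theorem isLimRat_qPochInf_inv (hq : ‖q‖ < 1) (hXc : IsCompact X) (hg : ContinuousOn g X)
    (hr : ∀ j : ℕ, IsRat S X fun x => (1 - g x * q ^ j)⁻¹)
    (hne : ∀ x ∈ X, ∀ j : ℕ, g x * q ^ j ≠ 1) :
    IsLimRat S X fun x => (qPochInf (g x) q)⁻¹ := by
  have hc : ContinuousOn (fun x => qPochInf (g x) q) X :=
    (continuous_qPochInf hq).comp_continuousOn hg
  have h0 : ∀ x ∈ X, qPochInf (g x) q ≠ 0 := fun x hx => qPochInf_ne_zero hq (hne x hx)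
  refine ⟨hc.inv₀ h0, _, fun N => IsRat.prod hr N, ?_⟩
  have h := (tendsto_qPoch_uniformly hq hXc hg).tendstoLocallyUniformlyOn.fun_inv₀ hc h0
  simpa only [Finset.prod_inv_distrib] using h

theorem isLimRat_qPochInf_sq (hq : ‖q‖ < 1) (hXc : IsCompact X) (α : ℂ) :
    IsLimRat S X fun x => qPochInf (α * x ^ 2) q := by
  refine isLimRat_qPochInf hq hXc (by fun_prop) fun j => ?_
  exact (isRat_polynomial
    (1 - Polynomial.C α * Polynomial.X ^ 2 * Polynomial.C (q ^ j))).congr fun x _ => by simp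

theorem isLimRat_qPochInf_inv_sq (hq : ‖q‖ < 1) (hXc : IsCompact X) (h0 : (0 : ℂ) ∈ S)
    (hX : Disjoint S X) (α : ℂ) :
    IsLimRat S X fun x => qPochInf (α * x⁻¹ ^ 2) q := by
  have hx0 : ∀ x ∈ X, x ≠ 0 := fun x hx h => hX.le_bot ⟨h0, h ▸ hx⟩
  refine isLimRat_qPochInf hq hXc ?_ fun j => ?_
  · exact continuousOn_const.mul ((continuousOn_inv₀.mono fun x hx => hx0 x hx).pow 2)
  · refine ((isRat_polynomial (Polynomial.X ^ 2 - Polynomial.C (α * q ^ j))).mul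
      ((isRat_inv h0).pow 2)).congr fun x hx => ?_
    have := hx0 x hx
    simp only [Polynomial.eval_sub, Polynomial.eval_pow, Polynomial.eval_X, Polynomial.eval_C]
    field_simp

theorem isLimRat_qPochInf_linear (hq : ‖q‖ < 1) (hq0 : q ≠ 0) (hXc : IsCompact X)
    (hX : Disjoint S X) {e : ℂ} (he : e ≠ 0) (hS : ∀ j : ℕ, (e * q ^ j)⁻¹ ∈ S) :
    IsLimRat S X fun x => (qPochInf (e * x) q)⁻¹ := by
  have hne : ∀ x ∈ X, ∀ j : ℕ, e * x * q ^ j ≠ 1 := by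
    intro x hx j h
    refine hX.le_bot ⟨hS j, ?_⟩
    rwa [← eq_inv_of_mul_eq_one_right (show e * q ^ j * x = 1 by rw [← h]; ring)]
  refine isLimRat_qPochInf_inv hq hXc (by fun_prop) (fun j => ?_) hne
  refine ((isRat_const (-(e * q ^ j)⁻¹)).mul (isRat_frac (hS j))).congr fun x hx => ?_
  have hqj := pow_ne_zero j hq0
  have h1 : e * q ^ j ≠ 0 := mul_ne_zero he hqj
  have h2 := sub_ne_zero.mpr (hne x hx j).symm
  have h3 : x - (e * q ^ j)⁻¹ = -(1 - e * x * q ^ j) / (e * q ^ j) := by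
    field_simp; ring
  simp only [h3]
  rw [inv_div, neg_mul, div_neg, mul_neg, neg_neg, ← mul_div_assoc, inv_mul_cancel₀ h1, one_div]

theorem isLimRat_qPochInf_inv_linear (hq : ‖q‖ < 1) (hXc : IsCompact X) (h0 : (0 : ℂ) ∈ S)
    (hX : Disjoint S X) {e : ℂ} (hS : ∀ j : ℕ, e * q ^ j ∈ S) :
    IsLimRat S X fun x => (qPochInf (e * x⁻¹) q)⁻¹ := by
  have hx0 : ∀ x ∈ X, x ≠ 0 := fun x hx h => hX.le_bot ⟨h0, h ▸ hx⟩
  have hne : ∀ x ∈ X, ∀ j : ℕ, e * x⁻¹ * q ^ j ≠ 1 := by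
    intro x hx j h
    refine hX.le_bot ⟨hS j, ?_⟩
    have := hx0 x hx
    have h2 : e * q ^ j = x := by field_simp at h; exact h
    rwa [h2]
  refine isLimRat_qPochInf_inv hq hXc ?_ (fun j => ?_) hne
  · exact continuousOn_const.mul (continuousOn_inv₀.mono fun x hx => hx0 x hx)
  refine (isRat_id.mul (isRat_frac (hS j))).congr fun x hx => ?_
  have h1 := hx0 x hx
  have h2 := sub_ne_zero.mpr (hne x hx j).symm
  have h3 : x - e * q ^ j = x * (1 - e * x⁻¹ * q ^ j) := by field_simp
  simp only [h3]
  rw [mul_inv, mul_inv_cancel_left₀ h1]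

/-- The points around which the winding numbers of two curves are proportional. -/
def relPoints (Γ₁ Γ₂ : ℝ → ℂ) (ε : ℂ) : Set ℂ :=
  {z | z ∉ trace Γ₁ ∪ trace Γ₂ ∧ RelInt Γ₁ Γ₂ ε fun x => (x - z)⁻¹}

variable {Γ₁ Γ₂ : ℝ → ℂ} {ε : ℂ}

theorem disjoint_relPoints : Disjoint (relPoints Γ₁ Γ₂ ε) (trace Γ₁ ∪ trace Γ₂) :=
  Set.disjoint_left.mpr fun _ hz => hz.1

theorem IsLimRat.relInt (h₁ : IsLoop Γ₁) (h₂ : IsLoop Γ₂)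
    (hF : IsLimRat (relPoints Γ₁ Γ₂ ε) (trace Γ₁ ∪ trace Γ₂) F) : RelInt Γ₁ Γ₂ ε F := by
  obtain ⟨hFc, f, hf, hlim⟩ := hF
  refine RelInt.of_tendsto h₁ h₂ (fun n => (hf n).continuousOn disjoint_relPoints) ?_ fun n => ?_
  · exact (tendstoLocallyUniformlyOn_iff_tendstoUniformlyOn_of_compact
      (h₁.isCompact.union h₂.isCompact)).mp hlim
  · obtain ⟨P, L, hL, hP⟩ := hf n
    exact (relInt_rational h₁ h₂ L (fun z hz => (hL z hz).1) (fun z hz => (hL z hz).2) P).congr hP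

end Rat

end AskeyWilson
end

open scoped LaurentPolynomial

noncomputable section

namespace AskeyWilson

open MeasureTheory Filter Topology Set

/-! ### Kernels built from infinite products -/

/-- `(α x², β x⁻²; q)_∞ / ∏ᵢ (Eᵢ x, E'ᵢ x⁻¹; q)_∞`. -/
def kern (q α β : ℂ) (E E' : Fin 4 → ℂ) (x : ℂ) : ℂ :=
  qPochInf (α * x ^ 2) q * qPochInf (β * x⁻¹ ^ 2) q *
    (∏ i, (qPochInf (E i * x) q)⁻¹) * ∏ i, (qPochInf (E' i * x⁻¹) q)⁻¹

theorem isLimRat_kern {S X : Set ℂ} {q : ℂ} (hq : ‖q‖ < 1) (hq0 : q ≠ 0) (hXc : IsCompact X)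
    (h0 : (0 : ℂ) ∈ S) (hX : Disjoint S X) (α β : ℂ) {E E' : Fin 4 → ℂ} (hE : ∀ i, E i ≠ 0)
    (hES : ∀ i, ∀ j : ℕ, (E i * q ^ j)⁻¹ ∈ S) (hES' : ∀ i, ∀ j : ℕ, E' i * q ^ j ∈ S) :
    IsLimRat S X (kern q α β E E') :=
  (((isLimRat_qPochInf_sq hq hXc α).mul (isLimRat_qPochInf_inv_sq hq hXc h0 hX β)).mul
    (IsLimRat.prod hX fun i => isLimRat_qPochInf_linear hq hq0 hXc hX (hE i) (hES i))).mul
      (IsLimRat.prod hX fun i => isLimRat_qPochInf_inv_linear hq hXc h0 hX (hES' i))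

theorem kern_symm {q p : ℂ} (hp : p ≠ 0) (α : ℂ) (E : Fin 4 → ℂ) (x : ℂ) :
    kern q α (α * p ^ 2) E (fun i => p * E i) (p * x⁻¹) =
      kern q α (α * p ^ 2) E (fun i => p * E i) x := by
  have e1 : α * (p * x⁻¹) ^ 2 = α * p ^ 2 * x⁻¹ ^ 2 := by ring
  have e2 : α * p ^ 2 * (p * x⁻¹)⁻¹ ^ 2 = α * x ^ 2 := by
    rw [mul_inv, inv_inv]; field_simp
  have e3 : ∀ i, E i * (p * x⁻¹) = p * E i * x⁻¹ := fun i => by ring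
  have e4 : ∀ i, p * E i * (p * x⁻¹)⁻¹ = E i * x := fun i => by
    rw [mul_inv, inv_inv]; field_simp
  simp only [kern, e1, e2, e3, e4]
  ring

/-! ### Symmetry of contour integrals -/

section Inversion

variable {Γ : ℝ → ℂ} {p : ℂ}

theorem notMem_trace_inversion (hp : p ≠ 0) {z : ℂ} (hz : z ≠ 0) (h : p * z⁻¹ ∉ trace Γ) :
    z ∉ trace fun s => p * (Γ s)⁻¹ := by
  rintro ⟨s, hs, rfl⟩
  refine h ⟨s, hs, ?_⟩
  rw [mul_inv, inv_inv, mul_inv_cancel_left₀ hp]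

theorem curveInt_inversion_sub_inv (hΓ : IsLoop Γ) (h0 : 0 ∉ trace Γ) {z : ℂ}
    (hz : z ≠ 0) (h : p * z⁻¹ ∉ trace Γ) :
    curveInt (fun s => p * (Γ s)⁻¹) (fun x => (x - z)⁻¹) =
      -curveInt Γ (fun x => (x - 0)⁻¹) + curveInt Γ (fun x => (x - p * z⁻¹)⁻¹) := by
  have hx0 : ∀ x ∈ trace Γ, x ≠ 0 := fun x hx h => h0 (h ▸ hx)
  have hxz : ∀ x ∈ trace Γ, x - p * z⁻¹ ≠ 0 := fun x hx h' => h (sub_eq_zero.mp h' ▸ hx)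
  rw [hΓ.curveInt_inversion h0, ← neg_one_mul (curveInt _ _), ← curveInt_const_mul,
    ← hΓ.curveInt_add]
  · refine curveInt_congr fun x hx => ?_
    have h1 := hx0 x hx
    have h2 := hxz x hx
    have h3 : p * x⁻¹ - z = -(z * x⁻¹) * (x - p * z⁻¹) := by field_simp; ring
    simp only [h3, sub_zero]
    generalize hD : x - p * z⁻¹ = D at h2
    have h4 : p = z * (x - D) := by rw [← hD]; field_simp; ring
    rw [h4]
    field_simp
    ring
  · exact continuousOn_const.mul (ContinuousOn.inv₀ (by fun_prop) fun x hx => by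
      simpa using hx0 x hx)
  · exact ContinuousOn.inv₀ (by fun_prop) hxz

theorem zero_mem_relPoints_inversion (hΓ : IsLoop Γ) (h0 : 0 ∉ trace Γ) (hp : p ≠ 0) :
    (0 : ℂ) ∈ relPoints Γ (fun s => p * (Γ s)⁻¹) (-1) := by
  have hx0 : ∀ x ∈ trace Γ, x ≠ 0 := fun x hx h => h0 (h ▸ hx)
  refine ⟨?_, ?_⟩
  · rintro (h | ⟨s, hs, h⟩)
    · exact h0 h
    · exact mul_ne_zero hp (inv_ne_zero (hx0 _ ⟨s, hs, rfl⟩)) h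
  · rw [RelInt, hΓ.curveInt_inversion h0, ← curveInt_const_mul]
    refine curveInt_congr fun x hx => ?_
    have := hx0 x hx
    simp only [sub_zero]
    field_simp

theorem mem_relPoints_inversion (hΓ : IsLoop Γ) (h0 : InInterior Γ 0) (hp : p ≠ 0) {z z' : ℂ}
    (hz : z ≠ 0) (hzz' : z * z' = p) (h : InInterior Γ z ∧ InExterior Γ z' ∨
      InExterior Γ z ∧ InInterior Γ z') :
    z ∈ relPoints Γ (fun s => p * (Γ s)⁻¹) (-1) := by
  have hz' : z' = p * z⁻¹ := by rw [← hzz']; field_simp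
  have hzt : z ∉ trace Γ := h.elim (fun h => h.1.1) fun h => h.1.1
  have hzt' : p * z⁻¹ ∉ trace Γ := hz' ▸ h.elim (fun h => h.2.1) fun h => h.2.1
  refine ⟨?_, ?_⟩
  · rintro (h | h)
    · exact hzt h
    · exact notMem_trace_inversion hp hz hzt' h
  · rw [RelInt, curveInt_inversion_sub_inv hΓ h0.1 hz hzt', h0.2, ← hz']
    rcases h with h | h <;> rw [h.1.2, h.2.2] <;> norm_num

theorem curveInt_eq_zero_of_antisymm (hΓ : IsLoop Γ) (h0 : 0 ∉ trace Γ) (hp : p ≠ 0) {H : ℂ → ℂ}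
    (hrel : RelInt Γ (fun s => p * (Γ s)⁻¹) (-1) fun x => H x * x⁻¹)
    (hH : ∀ x ∈ trace Γ, H (p * x⁻¹) = -H x) : curveInt Γ (fun x => H x * x⁻¹) = 0 := by
  have h : curveInt (fun s => p * (Γ s)⁻¹) (fun x => H x * x⁻¹) =
      curveInt Γ fun x => H x * x⁻¹ := by
    rw [hΓ.curveInt_inversion h0]
    refine curveInt_congr fun x hx => ?_
    have hx0 : x ≠ 0 := fun h => h0 (h ▸ hx)
    simp only [hH x hx, mul_inv, inv_inv]
    field_simp
  rw [RelInt, h] at hrel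
  linear_combination hrel / 2

end Inversion

/-! ### The weight and its functional -/

namespace Params

variable {t : Params} {Γ : ℝ → ℂ}

/-- The Askey-Wilson parameters as a vector. -/
def vec (t : Params) : Fin 4 → ℂ := ![t.a, t.b, t.c, t.d]

theorem vec_mem (t : Params) (i : Fin 4) : t.vec i ∈ t.abcd := by
  fin_cases i <;> simp [vec, abcd]

theorem Generic.ne_zero_of_mem (ht : t.Generic) {e : ℂ} (he : e ∈ t.abcd) : e ≠ 0 := by
  have := ht.k₀_ne
  have := ht.k₁_ne
  have := ht.u₀_ne
  have := ht.u₁_ne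
  have := ht.r_ne
  simp only [abcd, Set.mem_insert_iff, Set.mem_singleton_iff, a, b, c, d] at he
  rcases he with rfl | rfl | rfl | rfl <;> simp [*]

theorem weight_eq_kern (t : Params) (x : ℂ) :
    t.weight x = kern t.q 1 t.q t.vec ![t.q * t.a, t.q * t.b, t.c, t.d] x := by
  simp only [weight, kern, vec, Fin.prod_univ_four, one_mul, div_eq_mul_inv, mul_inv]
  simp
  ring

theorem IsContour.isLoop (h : t.IsContour Γ) : IsLoop Γ := ⟨h.jordan.lipschitz, h.jordan.closed⟩

/-- The vector of parameters in the second half of the denominator of the weight. -/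
theorem vec'_eq (t : Params) (i : Fin 4) : ∃ e ∈ t.abcd, ∃ k : ℕ,
    (![t.q * t.a, t.q * t.b, t.c, t.d] : Fin 4 → ℂ) i = e * t.q ^ k := by
  fin_cases i
  · exact ⟨_, t.a_mem, 1, by simp [mul_comm]⟩
  · exact ⟨_, t.b_mem, 1, by simp [mul_comm]⟩
  · exact ⟨_, t.c_mem, 0, by simp⟩
  · exact ⟨_, t.d_mem, 0, by simp⟩

theorem isLimRat_weight {S X : Set ℂ} (ht : t.Generic) (hq : ‖t.q‖ < 1) (hXc : IsCompact X)
    (h0 : (0 : ℂ) ∈ S) (hX : Disjoint S X)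
    (hS : ∀ e ∈ t.abcd, ∀ k : ℕ, e * t.q ^ k ∈ S ∧ (e * t.q ^ k)⁻¹ ∈ S) :
    IsLimRat S X t.weight := by
  refine (isLimRat_kern hq ht.q_ne hXc h0 hX 1 t.q (fun i => ht.ne_zero_of_mem (t.vec_mem i))
    (fun i j => (hS _ (t.vec_mem i) j).2) fun i j => ?_).congr fun x _ => t.weight_eq_kern x
  obtain ⟨e, he, k, h⟩ := t.vec'_eq i
  rw [h, mul_assoc, ← pow_add]
  exact (hS e he _).1

theorem IsContour.continuousOn_weight (ht : t.Generic) (hq : ‖t.q‖ < 1) (h : t.IsContour Γ) :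
    ContinuousOn t.weight (trace Γ) := by
  have hS : Disjoint (trace Γ)ᶜ (trace Γ) := disjoint_compl_left
  exact (isLimRat_weight ht hq h.isLoop.isCompact (S := (trace Γ)ᶜ) h.zero_mem.1 hS
    fun e he k => ⟨(h.interior e he k).1, (h.exterior e he k).1⟩).1

theorem continuousOn_ev {X : Set ℂ} (h0 : (0 : ℂ) ∉ X) (f : Laurent) : ContinuousOn (ev f) X :=
  (isRat_ev (S := Xᶜ) h0 disjoint_compl_left f).continuousOn disjoint_compl_left

/-- The functional `f ↦ ⟨f, 1⟩`. -/
def functional (ht : t.Generic) (hq : ‖t.q‖ < 1) (h : t.IsContour Γ) : Laurent →ₗ[ℂ] ℂ where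
  toFun f := curveInt Γ fun x => ev f x * t.weight x / x
  map_add' f g := by
    have hc : ∀ f : Laurent, ContinuousOn (fun x => ev f x * t.weight x / x) (trace Γ) := fun f =>
      ((continuousOn_ev h.zero_mem.1 f).mul (h.continuousOn_weight ht hq)).div continuousOn_id
        fun x hx hx0 => h.zero_mem.1 (hx0 ▸ hx)
    rw [← h.isLoop.curveInt_add (hc f) (hc g)]
    simp only [ev_add, add_mul, add_div]
  map_smul' r f := by
    rw [RingHom.id_apply, smul_eq_mul, ← curveInt_const_mul]
    simp only [ev_smul, mul_assoc, mul_div_assoc]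

theorem functional_apply (ht : t.Generic) (hq : ‖t.q‖ < 1) (h : t.IsContour Γ) (f : Laurent) :
    functional ht hq h f = curveInt Γ fun x => ev f x * t.weight x / x := rfl

theorem pairing_eq (ht : t.Generic) (hq : ‖t.q‖ < 1) (h : t.IsContour Γ) (f g : Laurent) :
    t.pairing Γ f g = functional ht hq h (f * LaurentPolynomial.invert g) := by
  rw [functional_apply, pairing]
  refine curveInt_congr fun x hx => ?_
  have hx0 : x ≠ 0 := fun h' => h.zero_mem.1 (h' ▸ hx)
  simp only [ev_mul _ _ hx0, ev_invert]

theorem ev_heckeOp_sub (k u s : ℂ) (η : ℤ) (f : Laurent) {x : ℂ} (hx : x ≠ 0) :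
    ev (heckeOp k u s η f - k • f) x = -k⁻¹ * ((1 - k * u * (s * x ^ η)) *
      (1 + k * u⁻¹ * (s * x ^ η)) * ev (dividedDiff s η f) x) := by
  simp only [heckeOp, LinearMap.sub_apply, LinearMap.smul_apply, LinearMap.id_apply,
    LinearMap.comp_apply, LinearMap.mulLeft_apply, ev_sub, ev_smul, ev_mul _ _ hx, ev_add, ev_one,
    ev_rootMonomial]
  ring

theorem qPochInf_inv_mul {q : ℂ} (hq : ‖q‖ < 1) {y : ℂ} (hy : y ≠ 1) :
    (1 - y) * (qPochInf y q)⁻¹ = (qPochInf (q * y) q)⁻¹ := by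
  rw [qPochInf_eq hq y, mul_inv, mul_inv_cancel_left₀ (sub_ne_zero.mpr hy.symm)]

/-- The points at which the weight may have poles have suitable winding numbers with respect to a
contour and its inversion. -/
theorem IsContour.mem_relPoints (ht : t.Generic) (h : t.IsContour Γ) {e : ℂ} (he : e ∈ t.abcd)
    {p : ℂ} {m k n : ℕ} (hp : p = t.q ^ m) (hmk : m + n = k) :
    e * t.q ^ k ∈ relPoints Γ (fun s => p * (Γ s)⁻¹) (-1) ∧
      (e * t.q ^ n)⁻¹ ∈ relPoints Γ (fun s => p * (Γ s)⁻¹) (-1) := by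
  have hq := ht.q_ne
  have he0 := ht.ne_zero_of_mem he
  have hp0 : p ≠ 0 := hp ▸ pow_ne_zero m hq
  have h1 : e * t.q ^ k * (e * t.q ^ n)⁻¹ = p := by
    rw [hp, ← hmk, pow_add]; field_simp
  have hk : e * t.q ^ k ≠ 0 := mul_ne_zero he0 (pow_ne_zero k hq)
  have hn : e * t.q ^ n ≠ 0 := mul_ne_zero he0 (pow_ne_zero n hq)
  exact ⟨mem_relPoints_inversion h.isLoop h.zero_mem hp0 hk h1
      (Or.inl ⟨h.interior e he k, h.exterior e he n⟩),
    mem_relPoints_inversion h.isLoop h.zero_mem hp0 (inv_ne_zero hn) (by rw [mul_comm, h1])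
      (Or.inr ⟨h.exterior e he n, h.interior e he k⟩)⟩

theorem IsContour.curveInt_kern_eq_zero (ht : t.Generic) (hq : ‖t.q‖ < 1) (h : t.IsContour Γ)
    {s : ℂ} {η : ℤ} {p : ℂ} {m : ℕ} (hp : p = t.q ^ m) (hsp : s ^ (-2 * η) = p)
    (α : ℂ) {E : Fin 4 → ℂ}
    (hE : ∀ i, ∃ e ∈ t.abcd, ∃ k : ℕ, E i = e * t.q ^ k) (f : Laurent) :
    curveInt Γ (fun x => (ev f x - ev f (p * x⁻¹)) *
      kern t.q α (α * p ^ 2) E (fun i => p * E i) x * x⁻¹) = 0 := by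
  have hp0 : p ≠ 0 := hp ▸ pow_ne_zero m ht.q_ne
  have h0 := zero_mem_relPoints_inversion h.isLoop h.zero_mem.1 hp0
  have hloop := h.isLoop.inversion h.zero_mem.1 p
  refine curveInt_eq_zero_of_antisymm h.isLoop h.zero_mem.1 hp0
    (IsLimRat.relInt h.isLoop hloop (IsLimRat.mul (IsLimRat.mul ?_ ?_) ?_)) ?_
  · refine ((isRat_ev h0 disjoint_relPoints (f - reflection s η f)).isLimRat
      disjoint_relPoints).congr fun x _ => ?_
    rw [ev_sub, ev_reflection, hsp]
  · refine isLimRat_kern hq ht.q_ne (h.isLoop.isCompact.union hloop.isCompact) h0 disjoint_relPoints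
      _ _ (fun i => ?_) (fun i j => ?_) fun i j => ?_
    · obtain ⟨e, he, k, hi⟩ := hE i
      rw [hi]
      exact mul_ne_zero (ht.ne_zero_of_mem he) (pow_ne_zero k ht.q_ne)
    · obtain ⟨e, he, k, hi⟩ := hE i
      rw [hi, mul_assoc, ← pow_add]
      exact (h.mem_relPoints ht he hp rfl).2
    · obtain ⟨e, he, k, hi⟩ := hE i
      rw [hi, hp, show t.q ^ m * (e * t.q ^ k) * t.q ^ j = e * t.q ^ (m + (k + j)) by ring, ← hp]
      exact (h.mem_relPoints ht he hp rfl).1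
  · exact (isRat_inv h0).isLimRat disjoint_relPoints
  · intro x _
    rw [kern_symm hp0, mul_inv, inv_inv, mul_inv_cancel_left₀ hp0]
    ring

theorem IsContour.mul_ne_one (h : t.IsContour Γ) {e : ℂ} (he : e ∈ t.abcd) {x : ℂ}
    (hx : x ∈ trace Γ) : e * x ≠ 1 ∧ e * x⁻¹ ≠ 1 := by
  constructor
  · intro h1
    refine (h.exterior e he 0).1 ?_
    rw [pow_zero, mul_one, ← eq_inv_of_mul_eq_one_right h1]
    exact hx
  · intro h1
    refine (h.interior e he 0).1 ?_
    rw [pow_zero, mul_one, eq_inv_of_mul_eq_one_left h1, inv_inv]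
    exact hx

theorem IsContour.functional_T₁ (ht : t.Generic) (hq : ‖t.q‖ < 1) (h : t.IsContour Γ)
    (f : Laurent) : functional ht hq h (t.T₁ f) = t.k₁ * functional ht hq h f := by
  rw [← sub_eq_zero, ← smul_eq_mul, ← map_smul, ← map_sub, functional_apply]
  have hz := h.curveInt_kern_eq_zero ht hq (s := 1) (η := 1) (p := 1) (m := 0) (by simp)
    (by simp) t.q (E := ![t.q * t.a, t.q * t.b, t.c, t.d]) t.vec'_eq f
  rw [← mul_zero (-t.k₁⁻¹), ← hz, ← curveInt_const_mul]
  refine curveInt_congr fun x hx => ?_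
  have hx0 : x ≠ 0 := fun h' => h.zero_mem.1 (h' ▸ hx)
  have h1 := ev_dividedDiff one_ne_zero (Or.inl rfl) f hx0 (s := 1) (η := 1)
  have ha := qPochInf_inv_mul hq (h.mul_ne_one t.a_mem hx).1
  have hb := qPochInf_inv_mul hq (h.mul_ne_one t.b_mem hx).1
  have hn := qPochInf_eq hq (x ^ 2)
  simp only [T₁, ev_heckeOp_sub _ _ _ _ _ hx0, weight_eq_kern, kern, vec, Fin.prod_univ_four]
  simp only [one_zpow, one_mul, zpow_one, one_pow, mul_one, Matrix.cons_val, div_eq_mul_inv]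
    at h1 ⊢
  rw [hn, ← h1, mul_assoc t.q t.a x, mul_assoc t.q t.b x, ← ha, ← hb, a, b]
  ring

theorem IsContour.functional_T₀ (ht : t.Generic) (hq : ‖t.q‖ < 1) (h : t.IsContour Γ)
    (f : Laurent) : functional ht hq h (t.T₀ f) = t.k₀ * functional ht hq h f := by
  rw [← sub_eq_zero, ← smul_eq_mul, ← map_smul, ← map_sub, functional_apply]
  have hr2 : t.r ^ (-2 * -1 : ℤ) = t.q := by rw [q]; norm_cast
  have hz := h.curveInt_kern_eq_zero ht hq (s := t.r) (η := -1) (p := t.q) (m := 1) (by simp)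
    hr2 1 (E := t.vec) (fun i => ⟨_, t.vec_mem i, 0, by simp⟩) f
  rw [← mul_zero (-t.k₀⁻¹), ← hz, ← curveInt_const_mul]
  refine curveInt_congr fun x hx => ?_
  have hx0 : x ≠ 0 := fun h' => h.zero_mem.1 (h' ▸ hx)
  have h1 := ev_dividedDiff ht.r_ne (Or.inr rfl) f hx0 (s := t.r) (η := -1)
  have hc := qPochInf_inv_mul hq (h.mul_ne_one t.c_mem hx).2
  have hd := qPochInf_inv_mul hq (h.mul_ne_one t.d_mem hx).2
  have hn := qPochInf_eq hq (t.q * x⁻¹ ^ 2)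
  rw [hr2] at h1
  simp only [T₀, ev_heckeOp_sub _ _ _ _ _ hx0, weight_eq_kern, kern, vec, Fin.prod_univ_four]
  simp only [one_mul, zpow_neg_one, Matrix.cons_val, div_eq_mul_inv] at h1 ⊢
  rw [hn, ← h1, mul_assoc t.q t.c, mul_assoc t.q t.d, ← hc, ← hd, c, d, sq t.q,
    mul_assoc t.q t.q, q]
  ring

theorem IsContour.isInvariant (ht : t.Generic) (hq : ‖t.q‖ < 1) (h : t.IsContour Γ) :
    t.IsInvariant (functional ht hq h) :=
  ⟨h.functional_T₁ ht hq, h.functional_T₀ ht hq⟩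

end Params

end AskeyWilson
end

open scoped LaurentPolynomial

noncomputable section

namespace AskeyWilson

open MeasureTheory Filter Topology Set

/-! ### Non-degeneracy of the functional -/

theorem ev_finsetProd {ι : Type*} (s : Finset ι) (f : ι → Laurent) {x : ℂ} (hx : x ≠ 0) :
    ev (∏ i ∈ s, f i) x = ∏ i ∈ s, ev (f i) x := by
  simp only [ev_eq_eval₂ _ hx, map_prod]

theorem qPochInf_inv_mul_prod {q : ℂ} (hq : ‖q‖ < 1) {y : ℂ} (hy : ∀ j : ℕ, y * q ^ j ≠ 1) (M : ℕ) :
    (∏ j ∈ Finset.range M, (1 - y * q ^ j)) * (qPochInf y q)⁻¹ = (qPochInf (y * q ^ M) q)⁻¹ := by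
  rw [qPochInf_eq_prod hq y M, mul_inv, mul_inv_cancel_left₀]
  exact Finset.prod_ne_zero_iff.mpr fun j _ => sub_ne_zero.mpr (hy j).symm

theorem sphere_subset_trace_unitCircle : Metric.sphere (0 : ℂ) 1 ⊆ trace unitCircle := by
  intro z hz
  have h := image_circleMap_Ioc 0 1
  rw [abs_one] at h
  rw [← h] at hz
  obtain ⟨θ, hθ, rfl⟩ := hz
  have hpi := Real.two_pi_pos
  refine ⟨θ / (2 * Real.pi), ⟨by have := hθ.1; positivity, (div_le_one hpi).mpr hθ.2⟩, ?_⟩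
  rw [unitCircle, mul_div_cancel₀ _ hpi.ne']

theorem curveInt_unitCircle_eq (F : ℂ → ℂ) :
    curveInt unitCircle F = ∫ s in (0 : ℝ)..1, F (unitCircle s) * unitCircle s := by
  have h1 : ∀ s, deriv unitCircle s = 2 * Real.pi * Complex.I * unitCircle s := by
    intro s
    have h : HasDerivAt unitCircle _ s :=
      HasDerivAt.scomp s (hasDerivAt_circleMap 0 1 (2 * Real.pi * s))
        ((hasDerivAt_id s).const_mul (2 * Real.pi))
    rw [h.deriv]
    simp only [mul_one, unitCircle, Complex.real_smul]
    push_cast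
    ring
  have h2 := Complex.two_pi_I_ne_zero
  unfold curveInt
  rw [← intervalIntegral.integral_const_mul]
  refine intervalIntegral.integral_congr fun s _ => ?_
  simp only [h1]
  field_simp

/-- A continuous function on the unit circle all of whose moments vanish is zero. -/
theorem eq_zero_of_moments {F : ℂ → ℂ} (hF : ContinuousOn F (trace unitCircle))
    (h : ∀ n : ℤ, curveInt unitCircle (fun x => x ^ n * F x) = 0) {z : ℂ}
    (hz : z ∈ Metric.sphere (0 : ℂ) 1) : F z = 0 := by
  have hmem : ∀ θ : AddCircle (1 : ℝ), (AddCircle.toCircle θ : ℂ) ∈ trace unitCircle := fun θ =>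
    sphere_subset_trace_unitCircle (mem_sphere_zero_iff_norm.mpr (Circle.norm_coe _))
  have hu : ∀ s : ℝ, (AddCircle.toCircle (s : AddCircle (1 : ℝ)) : ℂ) = unitCircle s := by
    intro s
    rw [AddCircle.toCircle_apply_mk, Circle.coe_exp, unitCircle, circleMap]
    simp
  let g : C(AddCircle (1 : ℝ), ℂ) := ⟨fun θ => F (AddCircle.toCircle θ),
    hF.comp_continuous (by fun_prop) hmem⟩
  have : Fact (0 < (1 : ℝ)) := ⟨one_pos⟩
  have hcoeff : ∀ n, fourierCoeff g n = 0 := by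
    intro n
    rw [fourierCoeff_eq_intervalIntegral g n 0, zero_add, div_one, one_smul]
    rw [← h (-n - 1), curveInt_unitCircle_eq]
    refine intervalIntegral.integral_congr fun s _ => ?_
    have h0 : unitCircle s ≠ 0 := by
      rw [← hu]; exact Circle.coe_ne_zero _
    have h1 : fourier (-n) (s : AddCircle (1 : ℝ)) = unitCircle s ^ (-n) := by
      rw [fourier_apply, AddCircle.toCircle_zsmul, Circle.coe_zpow, hu]
    change fourier (-n) (s : AddCircle (1 : ℝ)) • F (AddCircle.toCircle (s : AddCircle (1 : ℝ))) =
      unitCircle s ^ (-n - 1) * F (unitCircle s) * unitCircle s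
    rw [h1, hu, zpow_sub_one₀ h0, smul_eq_mul]
    field_simp
  have hsum := hasSum_fourier_series_of_summable (f := g) (by
    rw [funext hcoeff]; exact summable_zero)
  simp only [hcoeff, zero_smul] at hsum
  have hg : g = 0 := hsum.unique hasSum_zero
  obtain ⟨s, -, rfl⟩ := sphere_subset_trace_unitCircle hz
  have := DFunLike.congr_fun hg (s : AddCircle (1 : ℝ))
  rw [← hu]
  exact this

theorem mem_relPoints_unitCircle_of_interior {Γ : ℝ → ℂ} {z : ℂ} (hz : InInterior Γ z)
    (hz1 : ‖z‖ < 1) : z ∈ relPoints Γ unitCircle 1 := by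
  refine ⟨?_, ?_⟩
  · rintro (h | h)
    · exact hz.1 h
    · have := trace_unitCircle_subset h
      rw [mem_sphere_zero_iff_norm] at this
      linarith
  · rw [RelInt, hz.2, curveInt_unitCircle_of_inside hz1, one_mul]

theorem mem_relPoints_unitCircle_of_exterior {Γ : ℝ → ℂ} {z : ℂ} (hz : InExterior Γ z)
    (hz1 : 1 < ‖z‖) : z ∈ relPoints Γ unitCircle 1 := by
  refine ⟨?_, ?_⟩
  · rintro (h | h)
    · exact hz.1 h
    · have := trace_unitCircle_subset h
      rw [mem_sphere_zero_iff_norm] at this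
      linarith
  · rw [RelInt, hz.2, curveInt_unitCircle_of_outside hz1, one_mul]

namespace Params

variable {t : Params} {Γ : ℝ → ℂ}

/-- The vector of parameters in the second half of the denominator of the weight. -/
def vec' (t : Params) : Fin 4 → ℂ := ![t.q * t.a, t.q * t.b, t.c, t.d]

/-- A Laurent polynomial removing the first `M` poles of the weight in each direction. -/
def poleRemover (t : Params) (M : ℕ) : Laurent :=
  (∏ i, ∏ j ∈ Finset.range M,
    (1 - LaurentPolynomial.C (t.vec i * t.q ^ j) * LaurentPolynomial.T 1)) *
  ∏ i, ∏ j ∈ Finset.range M,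
    (1 - LaurentPolynomial.C (t.vec' i * t.q ^ j) * LaurentPolynomial.T (-1))

theorem IsContour.ev_poleRemover_mul_weight (hq : ‖t.q‖ < 1) (h : t.IsContour Γ) (M : ℕ) {x : ℂ}
    (hx : x ∈ trace Γ) :
    ev (t.poleRemover M) x * t.weight x =
      kern t.q 1 t.q (fun i => t.vec i * t.q ^ M) (fun i => t.vec' i * t.q ^ M) x := by
  have hx0 : x ≠ 0 := fun h' => h.zero_mem.1 (h' ▸ hx)
  have h1 : ∀ i, (∏ j ∈ Finset.range M, (1 - t.vec i * x * t.q ^ j)) *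
      (qPochInf (t.vec i * x) t.q)⁻¹ = (qPochInf (t.vec i * x * t.q ^ M) t.q)⁻¹ := fun i => by
    refine qPochInf_inv_mul_prod hq (fun j hj => (h.exterior _ (t.vec_mem i) j).1 ?_) M
    rwa [← eq_inv_of_mul_eq_one_right (show t.vec i * t.q ^ j * x = 1 by rw [← hj]; ring)]
  have h2 : ∀ i, (∏ j ∈ Finset.range M, (1 - t.vec' i * x⁻¹ * t.q ^ j)) *
      (qPochInf (t.vec' i * x⁻¹) t.q)⁻¹ = (qPochInf (t.vec' i * x⁻¹ * t.q ^ M) t.q)⁻¹ := fun i => by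
    obtain ⟨e, he, k, hk⟩ := t.vec'_eq i
    refine qPochInf_inv_mul_prod hq (fun j hj => (h.interior _ he (k + j)).1 ?_) M
    have h3 : t.vec' i = e * t.q ^ k := hk
    rw [h3] at hj
    field_simp at hj
    rw [pow_add, ← mul_assoc, hj]
    exact hx
  rw [weight_eq_kern]
  simp only [poleRemover, ev_mul _ _ hx0, ev_finsetProd _ _ hx0, ev_sub, ev_one, ev_C, ev_T, zpow_one,
    zpow_neg_one]
  have e1 : ∀ i, qPochInf (t.vec i * t.q ^ M * x) t.q = qPochInf (t.vec i * x * t.q ^ M) t.q :=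
    fun i => by rw [mul_right_comm]
  have e2 : ∀ i, qPochInf (t.vec' i * t.q ^ M * x⁻¹) t.q = qPochInf (t.vec' i * x⁻¹ * t.q ^ M) t.q :=
    fun i => by rw [mul_right_comm]
  simp only [kern, e1, e2, ← h1, ← h2, Finset.prod_mul_distrib]
  simp only [mul_right_comm _ (t.q ^ _) x, mul_right_comm _ (t.q ^ _) x⁻¹, vec']
  ring

theorem IsContour.functional_one_ne_zero (ht : t.Generic) (hq : ‖t.q‖ < 1) (h : t.IsContour Γ) :
    functional ht hq h 1 ≠ 0 := by
  intro h1
  have hl := (h.isInvariant ht hq).eq_zero ht h1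
  obtain ⟨M, hM⟩ : ∃ M : ℕ, ∀ i, ‖t.vec i * t.q ^ M‖ < 1 := by
    have : ∀ᶠ M : ℕ in atTop, ∀ i, ‖t.vec i * t.q ^ M‖ < 1 := by
      refine eventually_all.mpr fun i => ?_
      have h2 := (tendsto_pow_atTop_nhds_zero_of_norm_lt_one hq).const_mul (t.vec i)
      rw [mul_zero] at h2
      exact (h2.norm.eventually_lt_const (by simp))
    exact this.exists
  have hM1 : ∀ i, ∀ j : ℕ, ‖t.vec i * t.q ^ (M + j)‖ < 1 := fun i j => by
    rw [pow_add, ← mul_assoc, norm_mul, norm_pow]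
    exact mul_lt_one_of_nonneg_of_lt_one_left (norm_nonneg _) (hM i)
      (pow_le_one₀ (norm_nonneg _) hq.le)
  have hM2 : ∀ i, ∀ j : ℕ, ‖t.vec' i * t.q ^ (M + j)‖ < 1 := fun i j => by
    fin_cases i
    · have := hM1 0 (1 + j)
      simp only [vec, vec', Fin.zero_eta, Matrix.cons_val] at this ⊢
      convert this using 2; ring
    · have := hM1 1 (1 + j)
      simp only [vec, vec', Fin.mk_one, Matrix.cons_val] at this ⊢
      convert this using 2; ring
    · exact hM1 2 j
    · exact hM1 3 j
  have h0 : (0 : ℂ) ∈ relPoints Γ unitCircle 1 :=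
    mem_relPoints_unitCircle_of_interior h.zero_mem (by simp)
  have hkern : IsLimRat (relPoints Γ unitCircle 1) (trace Γ ∪ trace unitCircle)
      (kern t.q 1 t.q (fun i => t.vec i * t.q ^ M) (fun i => t.vec' i * t.q ^ M)) := by
    refine isLimRat_kern hq ht.q_ne (h.isLoop.isCompact.union isLoop_unitCircle.isCompact) h0
      disjoint_relPoints _ _ (fun i => mul_ne_zero (ht.ne_zero_of_mem (t.vec_mem i))
        (pow_ne_zero _ ht.q_ne)) (fun i j => ?_) fun i j => ?_
    · rw [mul_assoc, ← pow_add]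
      refine mem_relPoints_unitCircle_of_exterior (h.exterior _ (t.vec_mem i) _) ?_
      rw [norm_inv]
      exact (one_lt_inv₀ (norm_pos_iff.mpr (mul_ne_zero (ht.ne_zero_of_mem (t.vec_mem i))
        (pow_ne_zero _ ht.q_ne)))).mpr (hM1 i j)
    · rw [mul_assoc, ← pow_add]
      refine mem_relPoints_unitCircle_of_interior ?_ (hM2 i j)
      obtain ⟨e, he, k, hk⟩ := t.vec'_eq i
      have h3 : t.vec' i = e * t.q ^ k := hk
      rw [h3, mul_assoc, ← pow_add]
      exact h.interior e he _
  have hmom : ∀ n : ℤ, curveInt unitCircle (fun x => x ^ n *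
      kern t.q 1 t.q (fun i => t.vec i * t.q ^ M) (fun i => t.vec' i * t.q ^ M) x) = 0 := by
    intro n
    have hrel := IsLimRat.relInt h.isLoop isLoop_unitCircle
      (((isRat_ev h0 disjoint_relPoints (LaurentPolynomial.T n)).isLimRat disjoint_relPoints).mul
        hkern)
    simp only [ev_T] at hrel
    rw [RelInt, one_mul] at hrel
    rw [← hrel]
    have h2 := LinearMap.congr_fun hl (LaurentPolynomial.T (n + 1) * t.poleRemover M)
    rw [functional_apply, LinearMap.zero_apply] at h2
    rw [← h2]
    refine curveInt_congr fun x hx => ?_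
    have hx0 : x ≠ 0 := fun h' => h.zero_mem.1 (h' ▸ hx)
    simp only [ev_mul _ _ hx0, ev_T, ← h.ev_poleRemover_mul_weight hq M hx, zpow_add_one₀ hx0]
    field_simp
  have hI := eq_zero_of_moments (hkern.1.mono subset_union_right) hmom
    (z := Complex.I) (by simp)
  have hlt : ∀ a : ℂ, ‖a‖ < 1 → qPochInf a t.q ≠ 0 := fun a ha =>
    qPochInf_ne_zero hq fun k hk => by
      have h3 := congrArg norm hk
      rw [norm_mul, norm_pow, norm_one] at h3
      have h4 := mul_lt_one_of_nonneg_of_lt_one_left (norm_nonneg _) ha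
        (pow_le_one₀ (n := k) (norm_nonneg t.q) hq.le)
      linarith
  have hnum : qPochInf (1 * Complex.I ^ 2) t.q ≠ 0 := by
    rw [qPochInf_eq hq]
    refine mul_ne_zero ?_ (hlt _ ?_)
    · rw [Complex.I_sq]; norm_num
    · simpa using hq
  refine absurd hI ?_
  unfold kern
  refine mul_ne_zero (mul_ne_zero (mul_ne_zero hnum (hlt _ (by simpa using hq))) ?_) ?_
  · exact Finset.prod_ne_zero_iff.mpr fun i _ => inv_ne_zero (hlt _ (by
      simpa using hM1 i 0))
  · exact Finset.prod_ne_zero_iff.mpr fun i _ => inv_ne_zero (hlt _ (by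
      simpa using hM2 i 0))

end Params

end AskeyWilson
end

open scoped LaurentPolynomial

noncomputable section

namespace AskeyWilson

open MeasureTheory Filter Topology Set

/-! ### Residues at simple poles -/

/-- `h` has at most a simple pole at `z`, with residue `L`. -/
structure HasSimplePole (h : ℂ → ℂ) (z L : ℂ) : Prop where
  differentiable : ∀ᶠ y in 𝓝[≠] z, DifferentiableAt ℂ h y
  tendsto : Tendsto (fun y => (y - z) * h y) (𝓝[≠] z) (𝓝 L)

theorem HasSimplePole.residue_eq {h : ℂ → ℂ} {z L : ℂ} (hp : HasSimplePole h z L) :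
    residue h z = L := by
  refine Tendsto.limUnder_eq (tendsto_const_nhds.congr' ?_)
  obtain ⟨ε, hε, hball⟩ := Metric.mem_nhdsWithin_iff.mp hp.differentiable
  filter_upwards [Ioo_mem_nhdsGT hε] with R hR
  have hd : ∀ y, y ≠ z → y ∈ Metric.closedBall z R → DifferentiableAt ℂ h y := fun y hy hyR =>
    hball ⟨Metric.closedBall_subset_ball hR.2 hyR, hy⟩
  set g : ℂ → ℂ := Function.update (fun y => (y - z) * h y) z L with hg
  have hgy : ∀ y, y ≠ z → g y = (y - z) * h y := fun y hy => Function.update_of_ne hy _ _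
  have hgd : ∀ y, y ≠ z → y ∈ Metric.closedBall z R → DifferentiableAt ℂ g y := by
    intro y hy hyR
    have h1 : DifferentiableAt ℂ (fun y => (y - z) * h y) y :=
      (by fun_prop : DifferentiableAt ℂ (fun y => y - z) y).mul (hd y hy hyR)
    exact h1.congr_of_eventuallyEq ((eventually_ne_nhds hy).mono hgy)
  have hc : ContinuousOn g (Metric.closedBall z R) := by
    intro y hyR
    refine ContinuousAt.continuousWithinAt ?_
    rcases eq_or_ne y z with rfl | hy
    · exact continuousAt_update_same.mpr hp.tendsto
    · exact (hgd y hy hyR).continuousAt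
  have hcauchy := Complex.circleIntegral_sub_inv_smul_of_differentiable_on_off_countable
    (countable_singleton z) (Metric.mem_ball_self hR.1) hc
    fun y hy => hgd y hy.2 (Metric.ball_subset_closedBall hy.1)
  have hgz : g z = L := Function.update_self _ _ _
  have hint : ∮ y in C(z, R), h y = ∮ y in C(z, R), (y - z)⁻¹ • g y := by
    refine circleIntegral.integral_congr hR.1.le fun y hy => ?_
    have hyz : y ≠ z := by
      rintro rfl
      have := hR.1
      simp at hy
      linarith
    simp only [hgy y hyz, smul_eq_mul]
    rw [inv_mul_cancel_left₀ (sub_ne_zero.mpr hyz)]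
  rw [hint, hcauchy, hgz, smul_eq_mul, inv_mul_cancel_left₀ Complex.two_pi_I_ne_zero]

theorem hasSimplePole_of_analyticAt {h G : ℂ → ℂ} {z : ℂ} (hG : AnalyticAt ℂ G z)
    (hh : ∀ y, h y = (y - z)⁻¹ * G y) : HasSimplePole h z (G z) where
  differentiable := by
    have h1 := hG.eventually_analyticAt.filter_mono (nhdsWithin_le_nhds (s := {z}ᶜ))
    filter_upwards [h1, self_mem_nhdsWithin] with y hy hyz
    have h2 : y - z ≠ 0 := sub_ne_zero.mpr hyz
    rw [show h = fun y => (y - z)⁻¹ * G y from funext hh]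
    exact (by fun_prop (disch := exact h2) : DifferentiableAt ℂ (fun y => (y - z)⁻¹) y).mul
      hy.differentiableAt
  tendsto := by
    refine (hG.continuousAt.tendsto.mono_left nhdsWithin_le_nhds).congr' ?_
    filter_upwards [self_mem_nhdsWithin] with y hyz
    rw [hh, mul_inv_cancel_left₀ (sub_ne_zero.mpr hyz)]

/-- Residues of `W(y) / y` under `y ↦ p / y`. -/
theorem HasSimplePole.inversion {W ρ : ℂ → ℂ} {z L p : ℂ} (hz : z ≠ 0) (hp : p ≠ 0)
    (h : HasSimplePole (fun y => W y / y) z L) (hρ : AnalyticAt ℂ ρ z)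
    (hW : ∀ᶠ y in 𝓝 z, W (p * y⁻¹) = ρ y * W y) :
    HasSimplePole (fun y => W y / y) (p * z⁻¹) (-(ρ z * L)) := by
  have hz' : p * z⁻¹ ≠ 0 := mul_ne_zero hp (inv_ne_zero hz)
  have hinv : ∀ y : ℂ, y ≠ 0 → p * (p * y⁻¹)⁻¹ = y := fun y hy => by field_simp
  have hψ : Tendsto (fun y => p * y⁻¹) (𝓝 (p * z⁻¹)) (𝓝 z) := by
    have h1 : ContinuousAt (fun y => p * y⁻¹) (p * z⁻¹) :=
      continuousAt_const.mul (continuousAt_inv₀ hz')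
    have := h1.tendsto
    rwa [hinv z hz] at this
  have hψ' : Tendsto (fun y => p * y⁻¹) (𝓝[≠] (p * z⁻¹)) (𝓝[≠] z) := by
    refine tendsto_nhdsWithin_iff.mpr ⟨hψ.mono_left nhdsWithin_le_nhds, ?_⟩
    have h0 := (eventually_ne_nhds hz').filter_mono (nhdsWithin_le_nhds (s := {p * z⁻¹}ᶜ))
    filter_upwards [self_mem_nhdsWithin, h0] with y hy hy0 hyz
    exact hy (by
      rw [mem_singleton_iff] at hyz ⊢
      rw [← hyz, hinv y hy0])
  have heq : ∀ᶠ y in 𝓝 (p * z⁻¹), W y / y =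
      ρ (p * y⁻¹) * (W (p * y⁻¹) / (p * y⁻¹)) * ((p * y⁻¹) ^ 2 / p) := by
    filter_upwards [hψ.eventually hW, eventually_ne_nhds hz'] with y hy hy0
    rw [hinv y hy0] at hy
    rw [hy]
    field_simp
  refine ⟨?_, ?_⟩
  · have h1 := heq.eventually_nhds.filter_mono (nhdsWithin_le_nhds (s := {p * z⁻¹}ᶜ))
    have h2 := (hψ.eventually hρ.eventually_analyticAt).filter_mono
      (nhdsWithin_le_nhds (s := {p * z⁻¹}ᶜ))
    have h0 := (eventually_ne_nhds hz').filter_mono (nhdsWithin_le_nhds (s := {p * z⁻¹}ᶜ))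
    filter_upwards [h1, h2, h0, hψ'.eventually h.differentiable] with y hy1 hy2 hy0 hy3
    have hd : DifferentiableAt ℂ (fun y => p * y⁻¹) y := by fun_prop (disch := exact hy0)
    refine DifferentiableAt.congr_of_eventuallyEq ?_ hy1
    exact ((hy2.differentiableAt.comp y hd).mul (hy3.comp y hd)).mul ((hd.pow 2).div_const p)
  · have hlim : Tendsto (fun y => -(ρ y * ((y - z) * (W y / y)) * (y / z))) (𝓝[≠] z)
        (𝓝 (-(ρ z * L * (z / z)))) :=
      (((hρ.continuousAt.tendsto.mono_left nhdsWithin_le_nhds).mul h.tendsto).mul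
        ((tendsto_id.mono_left nhdsWithin_le_nhds).div_const z)).neg
    rw [div_self hz, mul_one] at hlim
    refine (hlim.comp hψ').congr' ?_
    have h0 := (eventually_ne_nhds hz').filter_mono (nhdsWithin_le_nhds (s := {p * z⁻¹}ᶜ))
    filter_upwards [heq.filter_mono nhdsWithin_le_nhds, h0] with y hy hy0
    rw [hy, Function.comp_apply]
    generalize W (p * y⁻¹) = w
    generalize ρ (p * y⁻¹) = r
    field_simp
    ring

theorem analyticAt_kern {q : ℂ} (hq : ‖q‖ < 1) (α β : ℂ) {E E' : Fin 4 → ℂ} {z : ℂ} (hz : z ≠ 0)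
    (hE : ∀ i, qPochInf (E i * z) q ≠ 0) (hE' : ∀ i, qPochInf (E' i * z⁻¹) q ≠ 0) :
    AnalyticAt ℂ (kern q α β E E') z := by
  have hP : ∀ (a : ℂ), AnalyticAt ℂ (fun a => qPochInf a q) a := fun a =>
    (differentiable_qPochInf hq).analyticAt a
  have hinv : AnalyticAt ℂ (fun y : ℂ => y⁻¹) z := analyticAt_inv hz
  refine AnalyticAt.mul (AnalyticAt.mul (AnalyticAt.mul ?_ ?_) ?_) ?_
  · exact (hP _).fun_comp (analyticAt_const.mul (analyticAt_id.pow 2))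
  · exact (hP _).fun_comp (analyticAt_const.mul (hinv.pow 2))
  · exact Finset.analyticAt_fun_prod _ fun i _ =>
      ((hP _).fun_comp (analyticAt_const.mul analyticAt_id)).inv (hE i)
  · exact Finset.analyticAt_fun_prod _ fun i _ =>
      ((hP _).fun_comp (analyticAt_const.mul hinv)).inv (hE' i)

namespace Params

/-! ### Functional equations of the weight -/

/-- The ratio `Δ(1/y) / Δ(y)`. -/
def ratioInv (s : Params) (y : ℂ) : ℂ :=
  (1 - s.a * y) * (1 - s.b * y) * (1 - y⁻¹ ^ 2) /
    ((1 - y ^ 2) * (1 - s.a * y⁻¹) * (1 - s.b * y⁻¹))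

/-- The ratio `Δ(q/y) / Δ(y)`. -/
def ratioShift (s : Params) (y : ℂ) : ℂ :=
  (1 - y ^ 2 * s.q⁻¹) * (1 - s.c * y⁻¹) * (1 - s.d * y⁻¹) /
    ((1 - s.q * y⁻¹ ^ 2) * (1 - s.c * y * s.q⁻¹) * (1 - s.d * y * s.q⁻¹))

theorem weight_inv {s : Params} (hq : ‖s.q‖ < 1) {y : ℂ} (h2 : y ^ 2 ≠ 1)
    (ha : s.a * y ≠ 1) (hb : s.b * y ≠ 1) :
    s.weight (1 * y⁻¹) = s.ratioInv y * s.weight y := by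
  have e1 := qPochInf_inv_mul hq ha
  have e2 := qPochInf_inv_mul hq hb
  have e3 := qPochInf_eq hq (s.a * y⁻¹)
  have e4 := qPochInf_eq hq (s.b * y⁻¹)
  have h3 : 1 - y ^ 2 ≠ 0 := sub_ne_zero.mpr h2.symm
  have e5 : qPochInf (s.q * y ^ 2) s.q = (1 - y ^ 2)⁻¹ * qPochInf (y ^ 2) s.q := by
    rw [qPochInf_eq hq (y ^ 2), inv_mul_cancel_left₀ h3]
  have e6 := qPochInf_eq hq (y⁻¹ ^ 2)
  simp only [weight, one_mul, inv_inv, div_eq_mul_inv, mul_inv, ratioInv]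
  simp only [mul_assoc s.q] at e1 e2 e3 e4 ⊢
  rw [← e1, ← e2, e3, e4, e5, e6, mul_inv (1 - s.a * y⁻¹), mul_inv (1 - s.b * y⁻¹)]
  ring

theorem weight_shift {s : Params} (hq : ‖s.q‖ < 1) (hq0 : s.q ≠ 0) {y : ℂ}
    (h2 : s.q * y⁻¹ ^ 2 ≠ 1) (hc : s.c * y⁻¹ ≠ 1) (hd : s.d * y⁻¹ ≠ 1) :
    s.weight (s.q * y⁻¹) = s.ratioShift y * s.weight y := by
  have e1 := qPochInf_inv_mul hq hc
  have e2 := qPochInf_inv_mul hq hd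
  have e3 := qPochInf_eq hq (s.c * y * s.q⁻¹)
  have e4 := qPochInf_eq hq (s.d * y * s.q⁻¹)
  have h3 : 1 - s.q * y⁻¹ ^ 2 ≠ 0 := sub_ne_zero.mpr h2.symm
  have e5 : qPochInf (s.q * (s.q * y⁻¹ ^ 2)) s.q =
      (1 - s.q * y⁻¹ ^ 2)⁻¹ * qPochInf (s.q * y⁻¹ ^ 2) s.q := by
    rw [qPochInf_eq hq (s.q * y⁻¹ ^ 2), inv_mul_cancel_left₀ h3]
  have e6 := qPochInf_eq hq (y ^ 2 * s.q⁻¹)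
  rw [mul_comm s.q (_ * s.q⁻¹), inv_mul_cancel_right₀ hq0] at e3 e4 e6
  have f1 : (s.q * y⁻¹) ^ 2 = s.q * (s.q * y⁻¹ ^ 2) := by ring
  have f2 : s.q * (s.q⁻¹ * y) ^ 2 = y ^ 2 * s.q⁻¹ := by field_simp
  have f3 : ∀ e, s.q * e * (s.q⁻¹ * y) = e * y := fun e => by field_simp
  have f4 : ∀ e, e * (s.q⁻¹ * y) = e * y * s.q⁻¹ := fun e => by ring
  have f5 : ∀ e, e * (s.q * y⁻¹) = s.q * (e * y⁻¹) := fun e => by ring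
  simp only [weight, ratioShift, mul_inv s.q y⁻¹, inv_inv, f1, f2, f3, f5]
  simp only [f4, div_eq_mul_inv, mul_inv]
  simp only [mul_assoc s.q] at e1 e2 e5 ⊢
  rw [← e1, ← e2, e3, e4, e5, e6, mul_inv (1 - s.c * y * s.q⁻¹), mul_inv (1 - s.d * y * s.q⁻¹)]
  ring

theorem analyticAt_ratioInv {s : Params} {z : ℂ} (hz : z ≠ 0) (h2 : z ^ 2 ≠ 1)
    (ha : s.a * z⁻¹ ≠ 1) (hb : s.b * z⁻¹ ≠ 1) : AnalyticAt ℂ s.ratioInv z := by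
  have h2' := sub_ne_zero.mpr h2.symm
  have ha' := sub_ne_zero.mpr ha.symm
  have hb' := sub_ne_zero.mpr hb.symm
  unfold ratioInv
  fun_prop (disch := first | assumption | exact mul_ne_zero (mul_ne_zero h2' ha') hb')

theorem analyticAt_ratioShift {s : Params} {z : ℂ} (hz : z ≠ 0) (h2 : s.q * z⁻¹ ^ 2 ≠ 1)
    (hc : s.c * z * s.q⁻¹ ≠ 1) (hd : s.d * z * s.q⁻¹ ≠ 1) : AnalyticAt ℂ s.ratioShift z := by
  have h2' := sub_ne_zero.mpr h2.symm
  have hc' := sub_ne_zero.mpr hc.symm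
  have hd' := sub_ne_zero.mpr hd.symm
  unfold ratioShift
  fun_prop (disch := first | assumption | exact mul_ne_zero (mul_ne_zero h2' hc') hd')

end Params

end AskeyWilson
end

open scoped LaurentPolynomial

noncomputable section

namespace AskeyWilson

open MeasureTheory Filter Topology Set

namespace Params

variable {t : Params}

/-! ### The dual weights -/

theorem Generic.hasSimplePole_zero (ht : t.Generic) (hq : ‖t.q‖ < 1) :
    ∃ L ≠ 0, HasSimplePole (fun y => t.dual.weight y / y) (t.eig 0)⁻¹ L := by
  have hk0 := ht.k₀_ne
  have hk1 := ht.k₁_ne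
  have hu0 := ht.u₀_ne
  have hu1 := ht.u₁_ne
  have hr := ht.r_ne
  have hq0 := ht.q_ne
  have e0 : t.eig 0 = t.dual.a := by
    rw [eig_of_nonneg t le_rfl, zpow_zero, mul_one, mul_comm]; rfl
  have hqs : t.dual.q = t.q := rfl
  have hqr : t.q = t.r ^ 2 := rfl
  set s := t.dual with hs
  have ha : s.a ≠ 0 := e0 ▸ ht.eig_ne_zero 0
  rw [e0]
  have hpow : ∀ x : ℂ, (∀ n : ℤ, x ≠ t.q ^ n) → qPochInf x t.q ≠ 0 := by
    refine fun x hx => qPochInf_ne_zero hq fun k hk => hx (-k) ?_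
    rw [zpow_neg, zpow_natCast]
    exact eq_inv_of_mul_eq_one_left hk
  have hE : ∀ i, qPochInf ((![t.q * s.a, s.b, s.c, s.d] : Fin 4 → ℂ) i * s.a⁻¹) t.q ≠ 0 := by
    intro i
    fin_cases i
    · refine qPochInf_ne_zero hq fun k hk => ?_
      have h1 : t.q ^ ((k : ℤ) + 1) = 1 := by
        rw [zpow_add_one₀ hq0, zpow_natCast, ← hk]
        simp only [Fin.zero_eta, Matrix.cons_val_zero]
        field_simp
      have := ht.q_zpow _ h1
      omega
    · refine hpow _ fun n hn => ht.k₀_sq (-n) ?_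
      rw [zpow_neg, ← hn]
      simp [hs, a, b, dual]
      field_simp
    · refine hpow _ fun n hn => ht.products _ t.b_mem _ t.d_mem (1 - n) ?_
      rw [zpow_sub₀ hq0, ← hn]
      simp [hs, a, b, c, d, dual, hqr]
      field_simp
    · refine hpow _ fun n hn => ht.products _ t.b_mem _ t.c_mem (1 - n) ?_
      rw [zpow_sub₀ hq0, ← hn]
      simp [hs, a, b, c, d, dual, hqr]
      field_simp
  have hE' : ∀ i, qPochInf ((![t.q * s.a, t.q * s.b, s.c, s.d] : Fin 4 → ℂ) i * s.a⁻¹⁻¹) t.q ≠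
      0 := by
    intro i
    obtain ⟨e, he, k, hk⟩ := s.vec'_eq i
    rw [hqs] at hk
    rw [hk, inv_inv]
    refine hpow _ fun n hn => ht.products_dual _ he _ s.a_mem (n - k) ?_
    change _ = t.q ^ (n - (k : ℤ))
    rw [zpow_sub₀ hq0, ← hn, zpow_natCast]
    have := pow_ne_zero k hq0
    field_simp
  have hG : AnalyticAt ℂ (fun y => -s.a⁻¹ * y⁻¹ *
      kern t.q 1 t.q ![t.q * s.a, s.b, s.c, s.d] ![t.q * s.a, t.q * s.b, s.c, s.d] y) s.a⁻¹ :=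
    (analyticAt_const.mul (analyticAt_inv (inv_ne_zero ha))).mul
      (analyticAt_kern hq 1 t.q (inv_ne_zero ha) hE hE')
  refine ⟨_, ?_, hasSimplePole_of_analyticAt hG fun y => ?_⟩
  · refine mul_ne_zero (by simpa using ha) ?_
    have haa : ∀ n : ℤ, s.a * s.a ≠ t.q ^ n := ht.products_dual _ s.a_mem _ s.a_mem
    refine mul_ne_zero (mul_ne_zero (mul_ne_zero (hpow _ fun n hn => haa (-n) ?_)
      (hpow _ fun n hn => haa (n - 1) ?_)) (Finset.prod_ne_zero_iff.mpr fun i _ =>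
        inv_ne_zero (hE i))) (Finset.prod_ne_zero_iff.mpr fun i _ => inv_ne_zero (hE' i))
    · rw [zpow_neg, ← hn]
      field_simp
    · rw [zpow_sub_one₀ hq0, ← hn]
      field_simp
  · have h1 := qPochInf_eq hq (s.a * y)
    have h2 : (1 - s.a * y)⁻¹ = -s.a⁻¹ * (y - s.a⁻¹)⁻¹ := by
      rw [show 1 - s.a * y = -s.a * (y - s.a⁻¹) by field_simp; ring, mul_inv, inv_neg]
    rw [← mul_assoc] at h1
    rw [weight_eq_kern, hqs]
    simp only [kern, vec, Fin.prod_univ_four, Matrix.cons_val]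
    rw [h1, mul_inv, h2]
    ring

theorem Generic.a_dual_mul_inv_ne (ht : t.Generic) {m : ℤ} (hm : m ≠ 0) :
    t.dual.a * (t.eig m)⁻¹ ≠ 1 ∧ t.dual.b * (t.eig m)⁻¹ ≠ 1 := by
  have h := mul_ne_zero_iff.mp (ht.eig_lower_ne hm)
  have h0 := ht.eig_ne_zero m
  refine ⟨fun h1 => h.1 ?_, fun h1 => h.2 ?_⟩
  all_goals
    rw [mul_inv_eq_one₀ h0] at h1
    rw [← h1]
    simp only [dual, a, b]
    ring

theorem Generic.c_dual_mul_ne (ht : t.Generic) (m : ℤ) :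
    t.dual.c * t.eig m ≠ 1 ∧ t.dual.d * t.eig m ≠ 1 := by
  have h := mul_ne_zero_iff.mp (ht.eig_raise_ne m)
  refine ⟨fun h1 => h.1 ?_, fun h1 => h.2 ?_⟩
  · simp only [dual, c] at h1
    linear_combination -h1
  · simp only [dual, d] at h1
    linear_combination -h1

theorem Generic.hasSimplePole_neg (ht : t.Generic) (hq : ‖t.q‖ < 1) {m : ℤ} (hm : m ≠ 0) {L : ℂ}
    (hL : HasSimplePole (fun y => t.dual.weight y / y) (t.eig m)⁻¹ L) :
    HasSimplePole (fun y => t.dual.weight y / y) (t.eig (-m))⁻¹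
      (-(t.dual.ratioInv (t.eig m)⁻¹ * L)) := by
  have hz := inv_ne_zero (ht.eig_ne_zero m)
  have h2 : (t.eig m)⁻¹ ^ 2 ≠ 1 := fun h => by
    rw [inv_pow, inv_eq_one] at h
    exact ht.eig_sq m 0 (by rw [h, zpow_zero])
  obtain ⟨ha, hb⟩ := ht.a_dual_mul_inv_ne hm
  obtain ⟨ha', hb'⟩ := ht.a_dual_mul_inv_ne (neg_ne_zero.mpr hm)
  rw [eig_neg t hm] at ha' hb' ⊢
  rw [← one_mul (t.eig m)⁻¹⁻¹]
  refine HasSimplePole.inversion hz one_ne_zero hL (analyticAt_ratioInv hz h2 ha' hb') ?_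
  have c1 : ∀ᶠ y in 𝓝 (t.eig m)⁻¹, y ^ 2 ≠ 1 := ContinuousAt.eventually_ne (by fun_prop) h2
  have c2 : ∀ᶠ y in 𝓝 (t.eig m)⁻¹, t.dual.a * y ≠ 1 := ContinuousAt.eventually_ne (by fun_prop) ha
  have c3 : ∀ᶠ y in 𝓝 (t.eig m)⁻¹, t.dual.b * y ≠ 1 := ContinuousAt.eventually_ne (by fun_prop) hb
  filter_upwards [c1, c2, c3] with y h1 h2 h3 using weight_inv (s := t.dual) hq h1 h2 h3

theorem Generic.hasSimplePole_reflect (ht : t.Generic) (hq : ‖t.q‖ < 1) (m : ℤ) {L : ℂ}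
    (hL : HasSimplePole (fun y => t.dual.weight y / y) (t.eig m)⁻¹ L) :
    HasSimplePole (fun y => t.dual.weight y / y) (t.eig (-m - 1))⁻¹
      (-(t.dual.ratioShift (t.eig m)⁻¹ * L)) := by
  have hq0 := ht.q_ne
  have hz := inv_ne_zero (ht.eig_ne_zero m)
  have h2 : t.q * (t.eig m)⁻¹⁻¹ ^ 2 ≠ 1 := by
    rw [inv_inv]
    exact ht.q_eig_sq m
  have hcd := ht.c_dual_mul_ne m
  rw [← inv_inv (t.eig m)] at hcd
  obtain ⟨hc', hd'⟩ := ht.c_dual_mul_ne (-m - 1)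
  have e1 : ∀ e, e * t.eig (-m - 1) = e * (t.eig m)⁻¹ * t.q⁻¹ := fun e => by
    rw [ht.eig_reflect, mul_inv]; ring
  rw [e1] at hc' hd'
  rw [show (t.eig (-m - 1))⁻¹ = t.q * (t.eig m)⁻¹⁻¹ by rw [ht.eig_reflect, inv_inv, inv_inv]]
  refine HasSimplePole.inversion hz hq0 hL (analyticAt_ratioShift hz h2 hc' hd') ?_
  have c1 : ∀ᶠ y in 𝓝 (t.eig m)⁻¹, t.q * y⁻¹ ^ 2 ≠ 1 :=
    ContinuousAt.eventually_ne (by fun_prop (disch := exact hz)) h2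
  have c2 : ∀ᶠ y in 𝓝 (t.eig m)⁻¹, t.dual.c * y⁻¹ ≠ 1 :=
    ContinuousAt.eventually_ne (by fun_prop (disch := exact hz)) hcd.1
  have c3 : ∀ᶠ y in 𝓝 (t.eig m)⁻¹, t.dual.d * y⁻¹ ≠ 1 :=
    ContinuousAt.eventually_ne (by fun_prop (disch := exact hz)) hcd.2
  filter_upwards [c1, c2, c3] with y h1 h2 h3 using weight_shift (s := t.dual) hq hq0 h1 h2 h3

theorem Generic.dualWeight_eig (ht : t.Generic) {m : ℤ} {L : ℂ}
    (hL : HasSimplePole (fun y => t.dual.weight y / y) (t.eig m)⁻¹ L) :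
    t.dualWeight (t.eig m)⁻¹ = L * sgnInt m := by
  rw [dualWeight, hL.residue_eq, ← eig_inv, ht.inv.index_eig]

theorem Generic.ratioInv_mul (ht : t.Generic) {m : ℤ} (hm : m ≠ 0) :
    (t.k₁ - t.β (t.eig (-m))) * t.dual.ratioInv (t.eig m)⁻¹ = t.k₁ - t.β (t.eig m) := by
  have hk0 := ht.k₀_ne
  have hk1 := ht.k₁_ne
  have hg := ht.eig_ne_zero m
  have h2 : t.eig m ^ 2 ≠ 1 := by simpa using ht.eig_sq m 0
  have h2' : t.eig (-m) ^ 2 ≠ 1 := by simpa using ht.eig_sq (-m) 0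
  have h3 := mul_ne_zero_iff.mp (ht.eig_lower_ne (neg_ne_zero.mpr hm))
  rw [ht.sub_β hg h2, ht.sub_β (ht.eig_ne_zero (-m)) h2']
  rw [eig_neg t hm] at *
  generalize t.eig m = g at *
  simp only [ratioInv, dual, a, b, inv_inv, ← sub_neg_eq_add, mul_comm t.k₀ t.k₁] at *
  generalize t.k₁ * t.k₀ = A at *
  generalize -(t.k₁ * t.k₀⁻¹) = B at *
  have h4 : g ^ 2 - 1 ≠ 0 := sub_ne_zero.mpr h2
  have h5 : 1 - g ^ 2 ≠ 0 := sub_ne_zero.mpr h2.symm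
  obtain ⟨h6, h7⟩ := h3
  have h8 : 1 - g * A ≠ 0 := fun h => h6 (by field_simp; linear_combination h)
  have h9 : 1 - g * B ≠ 0 := fun h => h7 (by field_simp; linear_combination h)
  field_simp

theorem Generic.ratioShift_mul (ht : t.Generic) (m : ℤ) :
    (t.u₁ - t.δ (t.eig (-m - 1))) * t.dual.ratioShift (t.eig m)⁻¹ = t.u₁ - t.δ (t.eig m) := by
  have hu0 := ht.u₀_ne
  have hu1 := ht.u₁_ne
  have hr := ht.r_ne
  have hg := ht.eig_ne_zero m
  have h2 := ht.q_eig_sq m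
  have h2' := ht.q_eig_sq (-m - 1)
  have h3 := mul_ne_zero_iff.mp (ht.eig_raise_ne (-m - 1))
  have hq0 := ht.q_ne
  rw [ht.sub_δ hg h2, ht.sub_δ (ht.eig_ne_zero _) h2']
  rw [ht.eig_reflect] at *
  generalize t.eig m = g at *
  have e1 : t.dual.c = t.r * t.u₁ * t.u₀ := rfl
  have e2 : 1 + t.r * t.u₁ * t.u₀⁻¹ * g = 1 - t.dual.d * g := by simp only [dual, d]; ring
  have e3 : 1 + t.r * t.u₁ * t.u₀⁻¹ * (t.q * g)⁻¹ = 1 - t.dual.d * (t.q * g)⁻¹ := by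
    simp only [dual, d]; ring
  rw [e2, e3, ← e1]
  rw [e3, ← e1] at h3
  have e4 : t.dual.q = t.q := rfl
  simp only [ratioShift, inv_inv, e4] at *
  generalize t.dual.c = A at *
  generalize t.dual.d = B at *
  generalize t.q = q at *
  obtain ⟨h6, h7⟩ := h3
  have h5 : 1 - q * g ^ 2 ≠ 0 := sub_ne_zero.mpr h2.symm
  have h4 : q * g ^ 2 - 1 ≠ 0 := sub_ne_zero.mpr h2
  have h8 : q * g - A ≠ 0 := fun h => h6 (by field_simp; linear_combination h)
  have h9 : q * g - B ≠ 0 := fun h => h7 (by field_simp; linear_combination h)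
  field_simp

theorem sgnInt_cast_mul_self (m : ℤ) : (sgnInt m : ℂ) * sgnInt m = 1 := by
  unfold sgnInt; split_ifs <;> simp

/-- The dual weights do not vanish, and are inverse to the quadratic norms. -/
theorem IsInvariant.dualWeight_mul_sqNorm (ht : t.Generic) (hq : ‖t.q‖ < 1)
    {l : Laurent →ₗ[ℂ] ℂ} (hl : t.IsInvariant l) (m : ℤ) :
    t.dualWeight (t.eig m)⁻¹ ≠ 0 ∧
      t.k₁ * t.sqNorm l m * t.dualWeight (t.eig m)⁻¹ = l 1 * t.dualWeight (t.eig 0)⁻¹ := by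
  suffices h : HasSimplePole (fun y => t.dual.weight y / y) (t.eig m)⁻¹
      (t.dualWeight (t.eig m)⁻¹ * sgnInt m) ∧ t.dualWeight (t.eig m)⁻¹ ≠ 0 ∧
      t.k₁ * t.sqNorm l m * t.dualWeight (t.eig m)⁻¹ = l 1 * t.dualWeight (t.eig 0)⁻¹ from h.2
  induction m using chain_induction with
  | h0 =>
    refine ⟨?_, ?_, ?_⟩
    · obtain ⟨L, -, hL⟩ := ht.hasSimplePole_zero hq
      rwa [ht.dualWeight_eig hL, mul_assoc, sgnInt_cast_mul_self, mul_one]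
    · obtain ⟨L, hL0, hL⟩ := ht.hasSimplePole_zero hq
      rw [ht.dualWeight_eig hL]
      simpa [sgnInt] using hL0
    · rw [ht.sqNorm_zero]
  | h1 n hn ih =>
    obtain ⟨hp, hw, he⟩ := ih
    have hp' := ht.hasSimplePole_reflect hq n hp
    have e1 : t.dualWeight (t.eig (-n - 1))⁻¹ =
        t.dual.ratioShift (t.eig n)⁻¹ * t.dualWeight (t.eig n)⁻¹ := by
      rw [ht.dualWeight_eig hp', sgnInt, sgnInt, if_pos hn, if_neg (by omega)]
      push_cast
      ring
    have h1 := ht.ratioShift_mul n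
    have h2 := hl.sqNorm_reflect ht n
    have h3 : t.u₁ - t.δ (t.eig n) ≠ 0 := by
      rw [ht.sub_δ (ht.eig_ne_zero n) (ht.q_eig_sq n)]
      exact div_ne_zero (ht.eig_raise_ne n)
        (mul_ne_zero ht.u₁_ne (sub_ne_zero.mpr (ht.q_eig_sq n).symm))
    have h4 := right_ne_zero_of_mul (h1 ▸ h3)
    refine ⟨?_, e1 ▸ mul_ne_zero h4 hw, ?_⟩
    · convert hp' using 1
      rw [e1, sgnInt, sgnInt, if_pos hn, if_neg (by omega)]
      push_cast
      ring
    · rw [e1, ← he]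
      refine mul_left_cancel₀ h3 ?_
      linear_combination t.k₁ * t.dual.ratioShift (t.eig n)⁻¹ * t.dualWeight (t.eig n)⁻¹ * h2 +
        t.k₁ * t.sqNorm l n * t.dualWeight (t.eig n)⁻¹ * h1
  | h2 n hn ih =>
    obtain ⟨hp, hw, he⟩ := ih
    have a1 : sgnInt n = -1 := if_neg (by omega)
    have a2 : sgnInt (-n) = 1 := if_pos (by omega)
    have hp' := ht.hasSimplePole_neg hq hn.ne hp
    have e1 : t.dualWeight (t.eig (-n))⁻¹ =
        t.dual.ratioInv (t.eig n)⁻¹ * t.dualWeight (t.eig n)⁻¹ := by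
      rw [ht.dualWeight_eig hp', a1, a2]
      push_cast
      ring
    have h1 := ht.ratioInv_mul hn.ne
    have h2 := hl.sqNorm_neg ht hn.ne
    have h5 : t.eig n ^ 2 ≠ 1 := by simpa using ht.eig_sq n 0
    have h3 : t.k₁ - t.β (t.eig n) ≠ 0 := by
      rw [ht.sub_β (ht.eig_ne_zero n) h5]
      exact div_ne_zero (ht.eig_lower_ne hn.ne) (mul_ne_zero ht.k₁_ne (sub_ne_zero.mpr h5))
    have h4 := right_ne_zero_of_mul (h1 ▸ h3)
    refine ⟨?_, e1 ▸ mul_ne_zero h4 hw, ?_⟩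
    · convert hp' using 1
      rw [e1, a2, a1]
      push_cast
      ring
    · rw [e1, ← he]
      refine mul_left_cancel₀ h3 ?_
      linear_combination t.k₁ * t.dual.ratioInv (t.eig n)⁻¹ * t.dualWeight (t.eig n)⁻¹ * h2 +
        t.k₁ * t.sqNorm l n * t.dualWeight (t.eig n)⁻¹ * h1

end Params

end AskeyWilson
end

open scoped LaurentPolynomial

noncomputable section

namespace AskeyWilson

namespace Params

variable {t : Params} {Γ : ℝ → ℂ}

/-! ### The transforms -/

theorem Admissible.pairing_one_ne_zero (ht : t.Admissible) (hΓ : t.IsContour Γ) :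
    t.pairing Γ 1 1 ≠ 0 := by
  rw [pairing_eq ht.generic ht.q_lt hΓ, map_one, mul_one]
  exact IsContour.functional_one_ne_zero ht.generic ht.q_lt hΓ

theorem Admissible.dualWeight_ne_zero (ht : t.Admissible) (hΓ : t.IsContour Γ) (m : ℤ) :
    t.dualWeight (t.eig m)⁻¹ ≠ 0 :=
  ((IsContour.isInvariant ht.generic ht.q_lt hΓ).dualWeight_mul_sqNorm ht.generic ht.q_lt m).1

theorem Admissible.pairing_E (ht : t.Admissible) (hΓ : t.IsContour Γ) (m n : ℤ) :
    t.pairing Γ (t.E (t.eig m)) (t.inv.E (t.eig n)⁻¹) =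
      if m = n then t.const Γ / t.dualWeight (t.eig n)⁻¹ else 0 := by
  have hg := ht.generic
  have hl := IsContour.isInvariant hg ht.q_lt hΓ
  have e : t.pairing Γ (t.E (t.eig m)) (t.inv.E (t.eig n)⁻¹) =
      t.k₁ * t.invPairing (functional hg ht.q_lt hΓ) (t.E (t.eig m)) (t.E (t.eig n)) := by
    rw [pairing_eq hg ht.q_lt hΓ, ← eig_inv, invert_E_inv hg, mul_smul_comm, map_smul, smul_eq_mul,
      invPairing]
  rw [e]
  split_ifs with h
  · subst h
    obtain ⟨h1, h2⟩ := hl.dualWeight_mul_sqNorm hg ht.q_lt m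
    rw [eq_div_iff h1, const, pairing_eq hg ht.q_lt hΓ, map_one, mul_one, mul_comm (t.dualWeight _)]
    exact h2
  · rw [hl.orthogonal hg h, mul_zero]

theorem mem_spec_inv (γ : t.inv.spec) : ∃ n, (t.eig n)⁻¹ = γ := by
  obtain ⟨n, hn⟩ := γ.2
  exact ⟨n, by rw [← hn, eig_inv]⟩

theorem Admissible.transformF_add (ht : t.Admissible) (hΓ : t.IsContour Γ) (f g : Laurent) :
    t.transformF Γ (f + g) = t.transformF Γ f + t.transformF Γ g := by
  funext γ
  simp only [transformF, Pi.add_apply, pairing_eq ht.generic ht.q_lt hΓ, add_mul, map_add]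

theorem Admissible.transformF_smul (ht : t.Admissible) (hΓ : t.IsContour Γ) (c : ℂ) (f : Laurent) :
    t.transformF Γ (c • f) = c • t.transformF Γ f := by
  funext γ
  simp only [transformF, Pi.smul_apply, pairing_eq ht.generic ht.q_lt hΓ, smul_mul_assoc, map_smul]

theorem transformG_add (f g : t.inv.spec →₀ ℂ) :
    t.transformG (f + g) = t.transformG f + t.transformG g :=
  Finsupp.sum_add_index' (by simp) (by intros; rw [add_mul, add_smul])

theorem transformG_smul (c : ℂ) (g : t.inv.spec →₀ ℂ) :
    t.transformG (c • g) = c • t.transformG g := by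
  rw [transformG, transformG, Finsupp.sum_smul_index (by simp), Finsupp.smul_sum]
  simp only [mul_assoc, smul_smul]

theorem transformG_single (γ : t.inv.spec) (z : ℂ) :
    t.transformG (Finsupp.single γ z) = (z * t.dualWeight γ) • t.E (γ : ℂ)⁻¹ :=
  Finsupp.sum_single_index (by simp)

theorem Admissible.transformF_E (ht : t.Admissible) (hΓ : t.IsContour Γ) (γ : t.inv.spec) :
    t.transformF Γ (t.E (γ : ℂ)⁻¹) =
      (t.const Γ / t.dualWeight γ) • (Finsupp.single γ (1 : ℂ) : t.inv.spec → ℂ) := by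
  classical
  funext δ
  obtain ⟨m, hm⟩ := mem_spec_inv γ
  obtain ⟨n, hn⟩ := mem_spec_inv δ
  rw [transformF, Pi.smul_apply, Finsupp.single_apply, smul_eq_mul, ← hm, ← hn, inv_inv,
    ht.pairing_E hΓ]
  have : γ = δ ↔ m = n := by
    rw [← Subtype.coe_inj, ← hm, ← hn, inv_inj, ht.generic.eig_injective.eq_iff]
  by_cases h : m = n
  · rw [if_pos h, if_pos (this.mpr h), h, mul_one]
  · rw [if_neg h, if_neg (mt this.mp h), mul_zero]

theorem Admissible.transformF_transformG (ht : t.Admissible) (hΓ : t.IsContour Γ)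
    (g : t.inv.spec →₀ ℂ) :
    t.transformF Γ (t.transformG g) = t.const Γ • (g : t.inv.spec → ℂ) := by
  induction g using Finsupp.induction_linear with
  | zero =>
    have := ht.transformF_smul hΓ 0 0
    simpa [transformG] using this
  | add f g hf hg => rw [transformG_add, ht.transformF_add hΓ, hf, hg, Finsupp.coe_add, smul_add]
  | single γ z =>
    obtain ⟨m, hm⟩ := mem_spec_inv γ
    have h0 : t.dualWeight γ ≠ 0 := hm ▸ ht.dualWeight_ne_zero hΓ m
    rw [transformG_single, ht.transformF_smul hΓ, ht.transformF_E hΓ, smul_smul,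
      ← mul_one z, ← smul_eq_mul z 1, ← Finsupp.smul_single, Finsupp.coe_smul, smul_smul, smul_eq_mul,
      mul_one]
    congr 1
    field_simp

theorem Admissible.transformG_transformF (ht : t.Admissible) (hΓ : t.IsContour Γ) (f : Laurent) :
    ∃ g : t.inv.spec →₀ ℂ, (g : t.inv.spec → ℂ) = t.transformF Γ f ∧
      t.transformG g = t.const Γ • f := by
  have hf : f ∈ Submodule.span ℂ (Set.range (eigvec ht.generic)) := span_eigvec ht.generic trivial
  induction hf using Submodule.span_induction with
  | mem f hf =>
    obtain ⟨m, rfl⟩ := hf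
    have hm : (t.eig m)⁻¹ ∈ t.inv.spec := ⟨m, t.eig_inv m⟩
    refine ⟨(t.const Γ / t.dualWeight (t.eig m)⁻¹) • Finsupp.single ⟨_, hm⟩ 1, ?_, ?_⟩
    · have := ht.transformF_E hΓ ⟨_, hm⟩
      rw [inv_inv, E_eig ht.generic] at this
      rw [this, Finsupp.coe_smul]
    · rw [transformG_smul, transformG_single, inv_inv, E_eig ht.generic, one_mul, smul_smul,
        div_mul_cancel₀ _ (ht.dualWeight_ne_zero hΓ m)]
  | zero =>
    refine ⟨0, ?_, ?_⟩
    · have := ht.transformF_smul hΓ 0 0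
      rw [zero_smul, zero_smul] at this
      rw [this, Finsupp.coe_zero]
    · rw [smul_zero]
      exact Finsupp.sum_zero_index
  | add f f' _ _ h h' =>
    obtain ⟨g, h1, h2⟩ := h
    obtain ⟨g', h1', h2'⟩ := h'
    exact ⟨g + g', by rw [ht.transformF_add hΓ, Finsupp.coe_add, h1, h1'],
      by rw [transformG_add, h2, h2', smul_add]⟩
  | smul c f _ h =>
    obtain ⟨g, h1, h2⟩ := h
    exact ⟨c • g, by rw [ht.transformF_smul hΓ, Finsupp.coe_smul, h1],
      by rw [transformG_smul, h2, smul_comm]⟩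

end Params

end AskeyWilson

end

theorem theorem11p5 (t : AskeyWilson.Params) (ht : t.Admissible)
    (Γ : ℝ → ℂ) (hΓ : t.IsContour Γ) :
    -- part (i): `𝒢 ∘ ℱ = c Id` (with `ℱ f` finitely supported) and `ℱ ∘ 𝒢 = c Id`
    (∀ f : AskeyWilson.Laurent, ∃ g : t.inv.spec →₀ ℂ,
      (g : t.inv.spec → ℂ) = t.transformF Γ f ∧ t.transformG g = t.const Γ • f) ∧
    (∀ g : t.inv.spec →₀ ℂ, t.transformF Γ (t.transformG g) = t.const Γ • (g : t.inv.spec → ℂ)) ∧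
    -- part (ii), with nonvanishing denominators
    t.pairing Γ 1 1 ≠ 0 ∧
    (∀ γ ∈ t.spec, t.dualWeight γ⁻¹ ≠ 0 ∧
      t.pairing Γ (t.E γ) (t.inv.E γ⁻¹) / t.pairing Γ 1 1 =
        t.dualWeight (t.eig 0)⁻¹ / t.dualWeight γ⁻¹) := by
  refine ⟨fun f => ht.transformG_transformF hΓ f, fun g => ht.transformF_transformG hΓ g,
    ht.pairing_one_ne_zero hΓ, ?_⟩
  rintro _ ⟨m, rfl⟩
  have h0 := ht.pairing_one_ne_zero hΓ
  refine ⟨ht.dualWeight_ne_zero hΓ m, ?_⟩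
  rw [ht.pairing_E hΓ, if_pos rfl, AskeyWilson.Params.const, div_right_comm,
    mul_div_cancel_right₀ _ h0]
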